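/- Let $X$ be a real Banach space, let $(G,|\cdot|)$ be an abelian group with a norm (so $|g|=0$ only for $g=0$, $|-g|=|g|$, $|g+h|\le|g|+|h|$) whose metric is complete, and let $k\ge 0$ be an integer. A convex $k$-polyhedron in $X$ is a nonempty bounded subset of a $k$-dimensional affine plane (its affine span) that is cut out of this plane by finitely many closed half-spaces. The group $\mathcal P_k=\mathcal P_k(X,G)$ of polyhedral $k$-chains consists of the finite formal sums $\sum_i g_i[P_i]$ with $g_i\in G$ and $P_i$ oriented convex $k$-polyhedra, modulo $(g_1+g_2)[P]=g_1[P]+g_2[P]$, $(-g)[P]=g[-P]$ (where $-P$ is $P$ with the opposite orientation), and $g[P_1\cup P_2]=g[P_1]+g[P_2]$ if $P_1$, $P_2$ and $P_1\cup P_2$ are convex $k$-polyhedra with compatible orientations and $P_1,P_2$ have disjoint relative interiors. The boundary $\partial:\mathcal P_{k+1}\to\mathcal P_k$ is the homomorphism that sends $g[P]$ to $\sum_F g[F]$, the sum over the facets $F$ of $P$ with the induced (outward vector first) orientation. For a continuous linear functional $f$ on $X$ and $r\in\mathbb R$ let $P_r$ denote the portion of the chain $P$ in $\{f<r\}$, and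 let $P\cap f^{-1}(r)=\partial(P_r)-(\partial P)_r$ be the slice. The mass $M$ is defined by induction on the dimension: $M\bigl(\sum_i g_i[P_i]\bigr)=\sum_i M(g_i[P_i])$ whenever the $P_i$ have pairwise disjoint relative interiors, where $M(g[x])=|g|$ for a point $x$, and $$M(g[P])=\sup_{f\in X^*,\ \|f\|=1}\int_{-\infty}^{\infty}M\bigl(g[P]\cap f^{-1}(r)\bigr)\,dr$$ in positive dimension. The flat norm of $P\in\mathcal P_k$ is $$F(P)=\inf_{Q\in\mathcal P_{k+1}}\bigl(M(Q)+M(\partial Q-P)\bigr).$$ Then $F$ is a norm on the group $\mathcal P_k(X,G)$: for all $P,Q\in\mathcal P_k(X,G)$ we have $F(P)<\infty$, $F(0)=0$, $F(-P)=F(P)$, $F(P+Q)\le F(P)+F(Q)$, and $F(P)=0$ implies $P=0$. -/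

import Mathlib

noncomputable section

open Set MeasureTheory
open scoped ENNReal

namespace FlatChain

variable {X : Type*} [NormedAddCommGroup X] [NormedSpace ℝ X]

/-- A convex polyhedron of dimension `k` in `X`: a nonempty bounded set that is cut out of its
affine span, a `k`-dimensional plane, by finitely many closed half-spaces. -/
structure IsPolyhedron (k : ℕ) (C : Set X) : Prop where
  nonempty : C.Nonempty
  bounded : Bornology.IsBounded C
  finiteDimensional : FiniteDimensional ℝ (vectorSpan ℝ C)
  finrank_eq : Module.finrank ℝ (vectorSpan ℝ C) = k
  halfSpaces : ∃ s : Finset (StrongDual ℝ X × ℝ),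
    C = {x | x ∈ affineSpan ℝ C ∧ ∀ p ∈ s, p.1 x ≤ p.2}

/-- An orientation of a `k`-dimensional subspace `V`, recorded as the set of its positively
oriented `k`-frames: these are the frames of `V` on which some alternating `k`-form that does not
vanish on `V` is positive. (For `k = 0` the two orientations are the set of the empty frame and
the empty set; they stand for the signs `+` and `-`.) -/
def IsOrientation {k : ℕ} (V : Submodule ℝ X) (o : Set (Fin k → X)) : Prop :=
  ∃ ω : X [⋀^Fin k]→ₗ[ℝ] ℝ, (∃ v, (∀ i, v i ∈ V) ∧ ω v ≠ 0) ∧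
    o = {v | (∀ i, v i ∈ V) ∧ 0 < ω v}

variable (X) in
/-- An oriented convex polyhedron of dimension `k` in `X`. -/
@[ext]
structure OrientedPolyhedron (k : ℕ) where
  carrier : Set X
  isPolyhedron : IsPolyhedron k carrier
  orientation : Set (Fin k → X)
  isOrientation : IsOrientation (vectorSpan ℝ carrier) orientation

/-! ### Convex geometry of polyhedra -/

namespace IsPolyhedron

variable {k : ℕ} {C D : Set X}

theorem convex (hC : IsPolyhedron k C) : Convex ℝ C := by
  obtain ⟨s, hs⟩ := hC.halfSpaces
  intro x hx y hy a b ha hb hab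
  rw [hs] at hx hy ⊢
  refine ⟨(affineSpan ℝ C).convex hx.1 hy.1 ha hb hab, fun p hp => ?_⟩
  have h1 := hx.2 p hp
  have h2 := hy.2 p hp
  simp only [map_add, map_smul, smul_eq_mul]
  calc a * p.1 x + b * p.1 y ≤ a * p.2 + b * p.2 := by gcongr
    _ = p.2 := by rw [← add_mul, hab, one_mul]

theorem isClosed (hC : IsPolyhedron k C) : IsClosed C := by
  obtain ⟨s, hs⟩ := hC.halfSpaces
  have := hC.finiteDimensional
  have : FiniteDimensional ℝ (affineSpan ℝ C).direction := by
    rw [direction_affineSpan]; infer_instance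
  have h1 : IsClosed (affineSpan ℝ C : Set X) := AffineSubspace.closed_of_finiteDimensional _
  rw [hs]
  refine h1.inter ?_
  have : {x : X | ∀ p ∈ s, p.1 x ≤ p.2} = ⋂ p ∈ s, {x | p.1 x ≤ p.2} := by ext; simp
  change IsClosed {x : X | ∀ p ∈ s, p.1 x ≤ p.2}
  rw [this]
  exact isClosed_biInter fun p _ => isClosed_le p.1.continuous continuous_const

/-- Polyhedra of the same dimension that lie in each other span the same plane. -/
theorem affineSpan_eq (hC : IsPolyhedron k C) (hD : IsPolyhedron k D) (h : D ⊆ C) :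
    affineSpan ℝ D = affineSpan ℝ C := by
  have := hC.finiteDimensional
  have hv : vectorSpan ℝ D = vectorSpan ℝ C :=
    Submodule.eq_of_le_of_finrank_eq (vectorSpan_mono ℝ h) (by rw [hC.finrank_eq, hD.finrank_eq])
  refine AffineSubspace.ext_of_direction_eq (by rw [direction_affineSpan, direction_affineSpan, hv])
    ?_
  obtain ⟨x, hx⟩ := hD.nonempty
  exact ⟨x, subset_affineSpan ℝ _ hx, subset_affineSpan ℝ _ (h hx)⟩

theorem vectorSpan_eq (hC : IsPolyhedron k C) (hD : IsPolyhedron k D) (h : D ⊆ C) :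
    vectorSpan ℝ D = vectorSpan ℝ C := by
  rw [← direction_affineSpan, ← direction_affineSpan, affineSpan_eq hC hD h]

theorem affineSpan_eq_of_subset_cut {C : Set X} (hC : Convex ℝ C) {h : StrongDual ℝ X} {c : ℝ}
    {a : X} (ha : a ∈ C) (hac : h a < c) :
    affineSpan ℝ {x ∈ C | h x ≤ c} = affineSpan ℝ C := by
  refine le_antisymm (affineSpan_mono ℝ (sep_subset _ _)) (affineSpan_le.2 fun p hp => ?_)
  have ha' : a ∈ affineSpan ℝ {x ∈ C | h x ≤ c} := subset_affineSpan ℝ _ ⟨ha, hac.le⟩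
  by_cases hpc : h p ≤ c
  · exact subset_affineSpan ℝ _ ⟨hp, hpc⟩
  push Not at hpc
  set t : ℝ := (c - h a) / (h p - h a) with ht
  have hpos : 0 < h p - h a := by linarith
  have ht0 : 0 < t := div_pos (by linarith) hpos
  have ht1 : t ≤ 1 := by rw [ht, div_le_one hpos]; linarith
  have hq : a + t • (p - a) ∈ affineSpan ℝ {x ∈ C | h x ≤ c} := by
    refine subset_affineSpan ℝ _ ⟨hC.add_smul_sub_mem ha hp ⟨ht0.le, ht1⟩, ?_⟩
    simp only [map_add, map_smul, map_sub, smul_eq_mul]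
    rw [ht, div_mul_cancel₀ _ hpos.ne']; linarith
  have := AffineMap.lineMap_mem (Q := affineSpan ℝ {x ∈ C | h x ≤ c}) (t⁻¹) ha' hq
  rw [AffineMap.lineMap_apply] at this
  simpa [smul_smul, inv_mul_cancel₀ ht0.ne'] using this

/-- The part of a polyhedron in a closed half-space that meets it properly. -/
theorem cut (hC : IsPolyhedron k C) {h : StrongDual ℝ X} {c : ℝ} {a : X} (ha : a ∈ C)
    (hac : h a < c) : IsPolyhedron k {x ∈ C | h x ≤ c} := by
  classical
  have hspan := affineSpan_eq_of_subset_cut hC.convex ha hac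
  have hv : vectorSpan ℝ {x ∈ C | h x ≤ c} = vectorSpan ℝ C := by
    rw [← direction_affineSpan, ← direction_affineSpan, hspan]
  refine ⟨⟨a, ha, hac.le⟩, hC.bounded.subset (sep_subset _ _), ?_, ?_, ?_⟩
  · rw [hv]; exact hC.finiteDimensional
  · rw [hv]; exact hC.finrank_eq
  · obtain ⟨s, hs⟩ := hC.halfSpaces
    refine ⟨insert (h, c) s, ?_⟩
    rw [hspan]
    ext x
    simp only [mem_ofPred_eq, Finset.mem_insert, forall_eq_or_imp]
    constructor
    · rintro ⟨hx, hxc⟩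
      rw [hs] at hx
      exact ⟨hx.1, hxc, hx.2⟩
    · rintro ⟨h1, h2, h3⟩
      refine ⟨?_, h2⟩
      rw [hs]; exact ⟨h1, h3⟩

/-- A subset cut out of a polyhedron by an equation is a polyhedron of its own dimension. -/
theorem section_of_finrank {n : ℕ} (hC : IsPolyhedron n C) {l : StrongDual ℝ X} {m : ℝ}
    (hne : {x ∈ C | l x = m}.Nonempty)
    (hk : Module.finrank ℝ (vectorSpan ℝ {x ∈ C | l x = m}) = k) :
    IsPolyhedron k {x ∈ C | l x = m} := by
  classical
  have := hC.finiteDimensional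
  have hsub : {x ∈ C | l x = m} ⊆ C := sep_subset _ _
  refine ⟨hne, hC.bounded.subset hsub,
    Submodule.finiteDimensional_of_le (vectorSpan_mono ℝ hsub), hk, ?_⟩
  obtain ⟨s, hs⟩ := hC.halfSpaces
  refine ⟨insert (l, m) (insert (-l, -m) s), ?_⟩
  ext x
  simp only [mem_ofPred_eq, Finset.mem_insert, forall_eq_or_imp, neg_apply,
    neg_le_neg_iff]
  constructor
  · rintro ⟨hx, hxm⟩
    refine ⟨subset_affineSpan ℝ _ ⟨hx, hxm⟩, hxm.le, hxm.ge, ?_⟩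
    rw [hs] at hx
    exact hx.2
  · rintro ⟨h1, h2, h3, h4⟩
    refine ⟨?_, le_antisymm h2 h3⟩
    rw [hs]
    exact ⟨affineSpan_mono ℝ hsub h1, h4⟩

/-- In a `(k+1)`-dimensional polyhedron on which `l` is not constant, a `k`-dimensional piece of a
level set of `l` has the kernel of `l` as its direction. -/
theorem vectorSpan_level (hC : IsPolyhedron (k + 1) C) (hD : IsPolyhedron k D) (hDC : D ⊆ C)
    {l : StrongDual ℝ X} {m : ℝ} (hl : ∀ x ∈ D, l x = m) {y : X} (hy : y ∈ C) (hym : l y ≠ m) :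
    vectorSpan ℝ D = vectorSpan ℝ C ⊓ LinearMap.ker (l : X →ₗ[ℝ] ℝ) := by
  have := hC.finiteDimensional
  obtain ⟨x, hx⟩ := hD.nonempty
  have hle : vectorSpan ℝ D ≤ vectorSpan ℝ C ⊓ LinearMap.ker (l : X →ₗ[ℝ] ℝ) := by
    refine le_inf (vectorSpan_mono ℝ hDC) ?_
    rw [vectorSpan_def, Submodule.span_le]
    rintro _ ⟨p, hp, q, hq, rfl⟩
    simp [hl p hp, hl q hq]
  refine Submodule.eq_of_le_of_finrank_le hle ?_
  rw [hD.finrank_eq]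
  have hlt : vectorSpan ℝ C ⊓ LinearMap.ker (l : X →ₗ[ℝ] ℝ) < vectorSpan ℝ C := by
    refine lt_of_le_of_ne inf_le_left fun he => ?_
    have h1 : y - x ∈ vectorSpan ℝ C := vsub_mem_vectorSpan ℝ hy (hDC hx)
    rw [← he] at h1
    have h2 : l (y - x) = 0 := h1.2
    rw [map_sub, hl x hx, sub_eq_zero] at h2
    exact hym h2
  have := Submodule.finrank_lt_finrank_of_lt hlt
  rw [hC.finrank_eq] at this
  omega

/-- A hyperplane that meets a `(k+1)`-dimensional polyhedron properly cuts out a `k`-dimensional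
polyhedron. -/
theorem hyperplane_section (hC : IsPolyhedron (k + 1) C) {h : StrongDual ℝ X} {c : ℝ} {a b : X}
    (ha : a ∈ C) (hac : h a < c) (hb : b ∈ C) (hbc : c < h b) :
    IsPolyhedron k {x ∈ C | h x = c} := by
  have hfd := hC.finiteDimensional
  set T := {x ∈ C | h x = c} with hT
  -- the point of `T` on the segment between `p` and `q`
  have key : ∀ p ∈ C, ∀ q ∈ C, h p < c → c ≤ h q →
      ∃ t : ℝ, 0 < t ∧ t ≤ 1 ∧ p + t • (q - p) ∈ T := by
    intro p hp q hq hpc hqc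
    have hpos : 0 < h q - h p := by linarith
    have ht0 : 0 < (c - h p) / (h q - h p) := div_pos (by linarith) hpos
    have ht1 : (c - h p) / (h q - h p) ≤ 1 := by rw [div_le_one hpos]; linarith
    refine ⟨_, ht0, ht1, hC.convex.add_smul_sub_mem hp hq ⟨ht0.le, ht1⟩, ?_⟩
    simp only [map_add, map_smul, map_sub, smul_eq_mul]
    rw [div_mul_cancel₀ _ hpos.ne']; linarith
  obtain ⟨t₀, ht₀, ht₀1, hz⟩ := key a ha b hb hac hbc.le
  set z := a + t₀ • (b - a) with hzdef
  refine section_of_finrank hC ⟨z, hz⟩ (le_antisymm ?_ ?_) <;> rw [← hT]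
  · have hle : vectorSpan ℝ T ≤ vectorSpan ℝ C := vectorSpan_mono ℝ (sep_subset _ _)
    have hlt : vectorSpan ℝ T < vectorSpan ℝ C := by
      refine lt_of_le_of_ne hle fun he => ?_
      have h1 : b - a ∈ vectorSpan ℝ T := he ▸ vsub_mem_vectorSpan ℝ hb ha
      have h2 : vectorSpan ℝ T ≤ LinearMap.ker (h : X →ₗ[ℝ] ℝ) := by
        rw [vectorSpan_def, Submodule.span_le]
        rintro _ ⟨p, hp, q, hq, rfl⟩
        simp [hp.2, hq.2]
      have h3 : h (b - a) = 0 := h2 h1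
      rw [map_sub] at h3; linarith
    have := Submodule.finrank_lt_finrank_of_lt hlt
    rw [hC.finrank_eq] at this
    omega
  · have hle : vectorSpan ℝ C ≤ vectorSpan ℝ T ⊔ ℝ ∙ (a - z) := by
      set W := vectorSpan ℝ T ⊔ ℝ ∙ (a - z) with hW
      have haz : a - z ∈ W := Submodule.mem_sup_right (Submodule.mem_span_singleton_self _)
      have hTz : ∀ q ∈ T, q - z ∈ W := fun q hq =>
        Submodule.mem_sup_left (vsub_mem_vectorSpan ℝ hq hz)
      have hbz : b - z ∈ W := by
        have : b - z = (1 - t₀⁻¹) • (a - z) := by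
          have e : b = a + t₀⁻¹ • (z - a) := by
            rw [hzdef, add_sub_cancel_left, smul_smul, inv_mul_cancel₀ ht₀.ne', one_smul]; abel
          conv_lhs => rw [e]
          module
        rw [this]; exact W.smul_mem _ haz
      have hall : ∀ p ∈ C, p - z ∈ W := by
        intro p hp
        rcases lt_or_ge (h p) c with hpc | hpc
        · obtain ⟨t, ht, ht1, hq⟩ := key p hp b hb hpc hbc.le
          have ht' : t ≠ 1 := by
            rintro rfl
            have : h b = c := by simpa using hq.2
            linarith
          have h1 := hTz _ hq
          have h2 : p - z = (1 - t)⁻¹ • ((p + t • (b - p) - z) - t • (b - z)) := by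
            have : (p + t • (b - p) - z) - t • (b - z) = (1 - t) • (p - z) := by module
            rw [this, smul_smul, inv_mul_cancel₀ (sub_ne_zero.2 ht'.symm), one_smul]
          rw [h2]
          exact W.smul_mem _ (W.sub_mem h1 (W.smul_mem _ hbz))
        · obtain ⟨t, ht, ht1, hq⟩ := key a ha p hp hac hpc
          have h1 := hTz _ hq
          have h2 : p - z = t⁻¹ • ((a + t • (p - a) - z) - (1 - t) • (a - z)) := by
            have : (a + t • (p - a) - z) - (1 - t) • (a - z) = t • (p - z) := by module
            rw [this, smul_smul, inv_mul_cancel₀ ht.ne', one_smul]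
          rw [h2]
          exact W.smul_mem _ (W.sub_mem h1 (W.smul_mem _ haz))
      rw [vectorSpan_def, Submodule.span_le]
      rintro _ ⟨p, hp, q, hq, rfl⟩
      have : p -ᵥ q = (p - z) - (q - z) := by simp
      change p -ᵥ q ∈ W
      rw [this]
      exact W.sub_mem (hall p hp) (hall q hq)
    have hfT : FiniteDimensional ℝ (vectorSpan ℝ T) :=
      Submodule.finiteDimensional_of_le (vectorSpan_mono ℝ (sep_subset _ _))
    have h1 := Submodule.finrank_mono hle
    have h2 := Submodule.finrank_add_le_finrank_add_finrank (vectorSpan ℝ T) (ℝ ∙ (a - z))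
    have h3 : Module.finrank ℝ (ℝ ∙ (a - z)) ≤ 1 := by
      simpa using finrank_span_le_card (R := ℝ) ({a - z} : Set X)
    rw [hC.finrank_eq] at h1
    omega

end IsPolyhedron


/-- `F` is a facet of the `(k+1)`-dimensional polyhedron `C`: a `k`-dimensional exposed face. -/
def IsFacet (k : ℕ) (C F : Set X) : Prop := IsExposed ℝ C F ∧ IsPolyhedron k F

namespace IsFacet

variable {k : ℕ} {C F E : Set X}

theorem subset (hF : IsFacet k C F) : F ⊆ C := hF.1.subset

theorem exists_level (hC : IsPolyhedron (k + 1) C) (hF : IsFacet k C F) :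
    ∃ (l : StrongDual ℝ X) (m : ℝ), F = {x ∈ C | l x = m} ∧ (∀ x ∈ C, l x ≤ m) ∧
      ∃ y ∈ C, l y < m := by
  obtain ⟨l, hl⟩ := hF.1 hF.2.nonempty
  obtain ⟨x₀, hx₀⟩ := hF.2.nonempty
  have hx₀' := hx₀
  rw [hl] at hx₀'
  have hFl : F = {x ∈ C | l x = l x₀} := by
    rw [hl]
    ext x
    simp only [mem_ofPred_eq]
    constructor
    · rintro ⟨h1, h2⟩
      exact ⟨h1, le_antisymm (hx₀'.2 x h1) (h2 x₀ hx₀'.1)⟩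
    · rintro ⟨h1, h2⟩
      exact ⟨h1, fun y hy => h2 ▸ hx₀'.2 y hy⟩
  refine ⟨l, l x₀, hFl, hx₀'.2, ?_⟩
  by_contra! hcon
  have : F = C := by
    rw [hFl]
    ext x
    simp only [mem_ofPred_eq, and_iff_left_iff_imp]
    exact fun hx => le_antisymm (hx₀'.2 x hx) (hcon x hx)
  have h1 := hF.2.finrank_eq
  rw [this, hC.finrank_eq] at h1
  omega

theorem of_level {n : ℕ} (hC : IsPolyhedron n C) {l : StrongDual ℝ X} {m : ℝ}
    (hm : ∀ x ∈ C, l x ≤ m) (hne : {x ∈ C | l x = m}.Nonempty)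
    (hk : Module.finrank ℝ (vectorSpan ℝ {x ∈ C | l x = m}) = k) :
    IsFacet k C {x ∈ C | l x = m} := by
  refine ⟨fun _ => ⟨l, ?_⟩, hC.section_of_finrank hne hk⟩
  obtain ⟨z, hz, hzm⟩ := hne
  ext x
  simp only [mem_ofPred_eq]
  constructor
  · rintro ⟨h1, h2⟩
    exact ⟨h1, fun y hy => h2 ▸ hm y hy⟩
  · rintro ⟨h1, h2⟩
    exact ⟨h1, le_antisymm (hm x h1) (hzm ▸ h2 z hz)⟩

/-- A facet that lies in a level set not containing the whole polyhedron is that level set. -/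
theorem eq_level (hC : IsPolyhedron (k + 1) C) (hF : IsFacet k C F) {p : StrongDual ℝ X} {q : ℝ}
    (hFp : ∀ x ∈ F, p x = q) {y : X} (hy : y ∈ C) (hyq : p y ≠ q) : F = {x ∈ C | p x = q} := by
  obtain ⟨l, m, hl, -, z, hz, hzm⟩ := hF.exists_level hC
  refine Subset.antisymm (fun x hx => ⟨hF.subset hx, hFp x hx⟩) ?_
  rintro x ⟨hx, hxq⟩
  obtain ⟨x₀, hx₀⟩ := hF.2.nonempty
  have h1 := hC.vectorSpan_level hF.2 hF.subset hFp hy hyq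
  have h2 := hC.vectorSpan_level hF.2 hF.subset (fun x hx => (hl ▸ hx : x ∈ {x ∈ C | l x = m}).2)
    hz hzm.ne
  have h3 : x - x₀ ∈ vectorSpan ℝ F := by
    rw [h1]
    refine ⟨vsub_mem_vectorSpan ℝ hx (hF.subset hx₀), ?_⟩
    simp [hxq, hFp x₀ hx₀]
  rw [h2] at h3
  have h4 : l (x - x₀) = 0 := h3.2
  have h5 : l x₀ = m := (hl ▸ hx₀ : x₀ ∈ {x ∈ C | l x = m}).2
  rw [map_sub, h5, sub_eq_zero] at h4
  rw [hl]
  exact ⟨hx, h4⟩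

theorem finite (hC : IsPolyhedron (k + 1) C) : {F | IsFacet k C F}.Finite := by
  classical
  obtain ⟨s, hs⟩ := hC.halfSpaces
  refine (s.finite_toSet.image fun p => {x ∈ C | p.1 x = p.2}).subset ?_
  intro F hF
  have hF : IsFacet k C F := hF
  suffices ∃ p ∈ s, (∀ x ∈ F, p.1 x = p.2) ∧ ∃ y ∈ C, p.1 y ≠ p.2 by
    obtain ⟨p, hp, h1, y, hy, hyp⟩ := this
    exact ⟨p, hp, (hF.eq_level hC h1 hy hyp).symm⟩
  by_contra! hcon
  obtain ⟨l, m, hl, hm, z, hz, hzm⟩ := hF.exists_level hC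
  have hle : ∀ x ∈ C, ∀ p ∈ s, p.1 x ≤ p.2 := fun x hx p hp => by
    rw [hs] at hx; exact hx.2 p hp
  -- a point of `F` where all constraints that are not active on `F` are strict
  have hpt : ∀ t ⊆ s, ∃ x ∈ F, ∀ p ∈ t, (∃ x ∈ F, p.1 x ≠ p.2) → p.1 x < p.2 := by
    intro t
    induction t using Finset.induction_on with
    | empty => exact fun _ => ⟨hF.2.nonempty.some, hF.2.nonempty.some_mem, by simp⟩
    | insert p t hpt ih =>
      intro hts
      obtain ⟨x, hx, hxt⟩ := ih fun q hq => hts (Finset.mem_insert_of_mem hq)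
      by_cases hact : ∃ x ∈ F, p.1 x ≠ p.2
      · obtain ⟨w, hw, hwp⟩ := hact
        refine ⟨(1 / 2 : ℝ) • x + (1 / 2 : ℝ) • w,
          hF.2.convex hx hw (by norm_num) (by norm_num) (by norm_num), fun q hq hqa => ?_⟩
        simp only [map_add, map_smul, smul_eq_mul]
        have h1 := hle x (hF.subset hx) q (hts hq)
        have h2 := hle w (hF.subset hw) q (hts hq)
        rcases Finset.mem_insert.1 hq with rfl | hq
        · have := lt_of_le_of_ne h2 hwp
          linarith
        · have := hxt q hq hqa
          linarith
      · refine ⟨x, hx, fun q hq hqa => ?_⟩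
        rcases Finset.mem_insert.1 hq with rfl | hq
        · exact absurd hqa hact
        · exact hxt q hq hqa
  obtain ⟨x, hx, hxs⟩ := hpt s subset_rfl
  have hxC := hF.subset hx
  -- moving from `x` away from `z` stays in `C` for a short time
  have hev : ∀ᶠ ε in nhdsWithin (0 : ℝ) (Ioi 0), ∀ p ∈ s, p.1 (x + ε • (x - z)) ≤ p.2 := by
    rw [Filter.eventually_all_finset]
    intro p hp
    by_cases hact : ∃ x ∈ F, p.1 x ≠ p.2
    · have h1 := hxs p hp hact
      have hcont : Continuous fun ε : ℝ => p.1 (x + ε • (x - z)) := by fun_prop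
      have h2 : ∀ᶠ ε in nhds (0 : ℝ), p.1 (x + ε • (x - z)) < p.2 :=
        hcont.continuousAt.eventually_lt continuousAt_const (by simpa using h1)
      exact (h2.filter_mono nhdsWithin_le_nhds).mono fun _ h => h.le
    · push Not at hact
      have h1 := hcon p hp hact z hz
      refine Filter.Eventually.of_forall fun ε => ?_
      simp [hact x hx, h1]
  obtain ⟨ε, hε, hεpos⟩ := (hev.and self_mem_nhdsWithin).exists
  have hmem : x + ε • (x - z) ∈ C := by
    rw [hs]
    refine ⟨?_, hε⟩
    have h1 := AffineMap.lineMap_mem (Q := affineSpan ℝ C) (1 + ε) (subset_affineSpan ℝ _ hz)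
      (subset_affineSpan ℝ _ hxC)
    have h2 : AffineMap.lineMap z x (1 + ε) = x + ε • (x - z) := by
      rw [AffineMap.lineMap_apply]
      simp only [vsub_eq_sub, vadd_eq_add]
      module
    rwa [h2] at h1
  have h1 := hm _ hmem
  have h2 : l x = m := (hl ▸ hx : x ∈ {x ∈ C | l x = m}).2
  simp only [map_add, map_smul, map_sub, smul_eq_mul, h2] at h1
  have : 0 < ε * (m - l z) := mul_pos hεpos (by linarith)
  linarith

end IsFacet

/-- Two polyhedra with disjoint relative interiors whose union is a polyhedron of the same
dimension are the two parts into which a hyperplane cuts this union. -/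
theorem exists_cut {k : ℕ} {C C₁ C₂ : Set X} (hC : IsPolyhedron k C) (h₁ : IsPolyhedron k C₁)
    (h₂ : IsPolyhedron k C₂) (hU : C = C₁ ∪ C₂)
    (hd : Disjoint (intrinsicInterior ℝ C₁) (intrinsicInterior ℝ C₂)) :
    ∃ (h : StrongDual ℝ X) (c : ℝ), C₁ = {x ∈ C | h x ≤ c} ∧ C₂ = {x ∈ C | c ≤ h x} ∧
      (∃ a ∈ C, h a < c) ∧ ∃ b ∈ C, c < h b := by
  have hfd := hC.finiteDimensional
  set V := vectorSpan ℝ C with hV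
  obtain ⟨x₀, hx₀⟩ := hC.nonempty
  let φ : V →ᵃ[ℝ] X := ⟨fun v => (v : X) + x₀, V.subtype, fun p v => by simp [add_assoc]⟩
  have hφ : ∀ v : V, φ v = (v : X) + x₀ := fun _ => rfl
  have hφc : Continuous φ := by
    change Continuous fun v : V => (v : X) + x₀
    fun_prop
  have hlift : ∀ x ∈ C, ∃ v : V, φ v = x := fun x hx =>
    ⟨⟨x - x₀, vsub_mem_vectorSpan ℝ hx hx₀⟩, by simp [hφ]⟩
  -- the relative interior, seen in `V`
  have hint : ∀ D : Set X, IsPolyhedron k D → D ⊆ C → (interior (φ ⁻¹' D)).Nonempty ∧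
      ∀ v ∈ interior (φ ⁻¹' D), φ v ∈ intrinsicInterior ℝ D := by
    intro D hD hDC
    have hDV : vectorSpan ℝ D = V := hC.vectorSpan_eq hD hDC
    have himg : φ '' (φ ⁻¹' D) = D := by
      rw [image_preimage_eq_iff]
      intro x hx
      exact hlift x (hDC hx)
    have hconv : Convex ℝ (φ ⁻¹' D) := hD.convex.affine_preimage φ
    constructor
    · rw [hconv.interior_nonempty_iff_affineSpan_eq_top]
      have h1 : (vectorSpan ℝ (φ ⁻¹' D)).map V.subtype = V := by
        have := AffineMap.map_vectorSpan φ (s := φ ⁻¹' D)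
        rw [himg, hDV] at this
        exact this
      have h2 : vectorSpan ℝ (φ ⁻¹' D) = ⊤ := by
        refine Submodule.map_injective_of_injective V.injective_subtype ?_
        rw [h1, Submodule.map_top, Submodule.range_subtype]
      obtain ⟨d, hdD⟩ := hD.nonempty
      obtain ⟨v, hv⟩ := hlift d (hDC hdD)
      refine (AffineSubspace.affineSpan_eq_top_iff_vectorSpan_eq_top_of_nonempty ℝ V V
        (s := φ ⁻¹' D) ⟨v, by simpa [hv] using hdD⟩).2 h2
    · intro v hv
      rw [mem_intrinsicInterior]
      have hvD : φ v ∈ D := (interior_subset hv : v ∈ φ ⁻¹' D)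
      refine ⟨⟨φ v, subset_affineSpan ℝ _ hvD⟩, ?_, rfl⟩
      have hmem : ∀ y : affineSpan ℝ D, (y : X) - x₀ ∈ V := fun y => by
        rw [hV, ← direction_affineSpan]
        exact AffineSubspace.vsub_mem_direction
          (affineSpan_mono ℝ hDC y.2) (subset_affineSpan ℝ _ hx₀)
      let ψ : affineSpan ℝ D → V := fun y => ⟨(y : X) - x₀, hmem y⟩
      have hψ : Continuous ψ := by
        refine Continuous.subtype_mk ?_ _
        exact continuous_subtype_val.sub continuous_const
      rw [mem_interior]
      refine ⟨ψ ⁻¹' interior (φ ⁻¹' D), ?_, isOpen_interior.preimage hψ, ?_⟩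
      · intro y hy
        have : φ (ψ y) ∈ D := (interior_subset (mem_preimage.1 hy) : ψ y ∈ φ ⁻¹' D)
        simpa [hφ, ψ] using this
      · have : ψ ⟨φ v, subset_affineSpan ℝ _ hvD⟩ = v := by
          ext; simp [ψ, hφ]
        simpa [this] using hv
  have hs1 : C₁ ⊆ C := hU ▸ subset_union_left
  have hs2 : C₂ ⊆ C := hU ▸ subset_union_right
  obtain ⟨⟨v₁, hv₁⟩, hi₁⟩ := hint C₁ h₁ hs1
  obtain ⟨⟨v₂, hv₂⟩, hi₂⟩ := hint C₂ h₂ hs2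
  have hc₁ : Convex ℝ (φ ⁻¹' C₁) := h₁.convex.affine_preimage φ
  have hc₂ : Convex ℝ (φ ⁻¹' C₂) := h₂.convex.affine_preimage φ
  obtain ⟨f, u, hf₁, hf₂⟩ := geometric_hahn_banach_open_open hc₁.interior isOpen_interior
    hc₂.interior isOpen_interior
    (disjoint_left.2 fun v hv hv' => disjoint_left.1 hd (hi₁ v hv) (hi₂ v hv'))
  obtain ⟨h, hh, -⟩ := exists_extension_norm_eq V f
  have hφh : ∀ v : V, h (φ v) = f v + h x₀ := fun v => by rw [hφ, map_add, hh]
  have hle₁ : ∀ x ∈ C₁, h x ≤ u + h x₀ := by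
    intro x hx
    obtain ⟨v, rfl⟩ := hlift x (hs1 hx)
    rw [hφh]
    have : v ∈ closure (interior (φ ⁻¹' C₁)) := by
      rw [hc₁.closure_interior_eq_closure_of_nonempty_interior ⟨v₁, hv₁⟩]
      exact subset_closure hx
    have h3 : closure (interior (φ ⁻¹' C₁)) ⊆ {v | f v ≤ u} :=
      closure_minimal (fun v hv => (hf₁ v hv).le) (isClosed_le f.continuous continuous_const)
    have h4 : f v ≤ u := h3 this
    linarith
  have hle₂ : ∀ x ∈ C₂, u + h x₀ ≤ h x := by
    intro x hx
    obtain ⟨v, rfl⟩ := hlift x (hs2 hx)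
    rw [hφh]
    have : v ∈ closure (interior (φ ⁻¹' C₂)) := by
      rw [hc₂.closure_interior_eq_closure_of_nonempty_interior ⟨v₂, hv₂⟩]
      exact subset_closure hx
    have h3 : closure (interior (φ ⁻¹' C₂)) ⊆ {v | u ≤ f v} :=
      closure_minimal (fun v hv => (hf₂ v hv).le) (isClosed_le continuous_const f.continuous)
    have h4 : u ≤ f v := h3 this
    linarith
  have ha : φ v₁ ∈ C₁ := (interior_subset hv₁ : v₁ ∈ φ ⁻¹' C₁)
  have hb : φ v₂ ∈ C₂ := (interior_subset hv₂ : v₂ ∈ φ ⁻¹' C₂)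
  have hau : h (φ v₁) < u + h x₀ := by rw [hφh]; linarith [hf₁ v₁ hv₁]
  have hbu : u + h x₀ < h (φ v₂) := by rw [hφh]; linarith [hf₂ v₂ hv₂]
  -- points of the cutting hyperplane are limits from both sides
  have hlim : ∀ D : Set X, IsPolyhedron k D → ∀ x a : X,
      (∀ t ∈ Ioo (0 : ℝ) 1, x + t • (a - x) ∈ D) → x ∈ D := by
    intro D hD x a hxa
    have hcont : Continuous fun t : ℝ => x + t • (a - x) := by fun_prop
    have ht : Filter.Tendsto (fun t : ℝ => x + t • (a - x)) (nhdsWithin 0 (Ioi 0)) (nhds x) := by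
      have := (hcont.tendsto 0).mono_left (nhdsWithin_le_nhds (s := Ioi (0 : ℝ)))
      simpa using this
    refine hD.isClosed.mem_of_tendsto ht ?_
    filter_upwards [Ioo_mem_nhdsGT (zero_lt_one (α := ℝ))] with t ht using hxa t ht
  refine ⟨h, u + h x₀, ?_, ?_, ⟨_, hs1 ha, hau⟩, ⟨_, hs2 hb, hbu⟩⟩
  · refine Subset.antisymm (fun x hx => ⟨hs1 hx, hle₁ x hx⟩) ?_
    rintro x ⟨hx, hxu⟩
    refine hlim C₁ h₁ x (φ v₁) fun t ht => ?_
    have hmem := hC.convex.add_smul_sub_mem hx (hs1 ha) ⟨ht.1.le, ht.2.le⟩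
    rw [hU] at hmem
    refine hmem.resolve_right fun hm => ?_
    have := hle₂ _ hm
    simp only [map_add, map_smul, map_sub, smul_eq_mul] at this
    nlinarith [ht.1, ht.2]
  · refine Subset.antisymm (fun x hx => ⟨hs2 hx, hle₂ x hx⟩) ?_
    rintro x ⟨hx, hxu⟩
    refine hlim C₂ h₂ x (φ v₂) fun t ht => ?_
    have hmem := hC.convex.add_smul_sub_mem hx (hs2 hb) ⟨ht.1.le, ht.2.le⟩
    rw [hU] at hmem
    refine hmem.resolve_left fun hm => ?_
    have := hle₁ _ hm
    simp only [map_add, map_smul, map_sub, smul_eq_mul] at this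
    nlinarith [ht.1, ht.2]

/-! ### Orientations -/

theorem form_ne_zero {k : ℕ} {V : Submodule ℝ X} [FiniteDimensional ℝ V]
    (hV : Module.finrank ℝ V = k) {ω : X [⋀^Fin k]→ₗ[ℝ] ℝ}
    (hω : ∃ v, (∀ i, v i ∈ V) ∧ ω v ≠ 0) {w : Fin k → X} (hw : ∀ i, w i ∈ V)
    (hli : LinearIndependent ℝ w) : ω w ≠ 0 := by
  obtain ⟨v, hv, hv0⟩ := hω
  rcases Nat.eq_zero_or_pos k with rfl | hk
  · rwa [Subsingleton.elim w v]
  have : Nonempty (Fin k) := ⟨⟨0, hk⟩⟩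
  let w' : Fin k → V := fun i => ⟨w i, hw i⟩
  have hli' : LinearIndependent ℝ w' := LinearIndependent.of_comp V.subtype hli
  let e := basisOfLinearIndependentOfCardEqFinrank hli' (by simp [hV])
  have he : ⇑e = w' := coe_basisOfLinearIndependentOfCardEqFinrank _ _
  have h1 : ω.compLinearMap V.subtype ≠ 0 := by
    intro h0
    have := congrArg (fun η : V [⋀^Fin k]→ₗ[ℝ] ℝ => η fun i => ⟨v i, hv i⟩) h0
    exact hv0 (by simpa using this)
  have h2 := ((ω.compLinearMap V.subtype).map_basis_ne_zero_iff e).2 h1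
  rw [he] at h2
  exact h2

theorem form_eq_zero {k : ℕ} {W : Submodule ℝ X} [FiniteDimensional ℝ W]
    (hW : Module.finrank ℝ W = k) (ω : X [⋀^Fin (k + 1)]→ₗ[ℝ] ℝ) {w : Fin (k + 1) → X}
    (hw : ∀ i, w i ∈ W) : ω w = 0 := by
  refine ω.map_linearDependent w fun hli => ?_
  have hli' : LinearIndependent ℝ (fun i => (⟨w i, hw i⟩ : W)) :=
    LinearIndependent.of_comp W.subtype hli
  have := hli'.fintype_card_le_finrank
  simp [hW] at this

theorem exists_frame {k : ℕ} {V : Submodule ℝ X} [FiniteDimensional ℝ V]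
    (hV : Module.finrank ℝ V = k) : ∃ v : Fin k → X, (∀ i, v i ∈ V) ∧ LinearIndependent ℝ v := by
  let e := Module.finBasisOfFinrankEq ℝ V hV
  exact ⟨fun i => e i, fun i => (e i).2, e.linearIndependent.map' V.subtype (by simp)⟩

/-- Two different orientations of a subspace are opposite. -/
theorem IsOrientation.exists_opposite {k : ℕ} {V : Submodule ℝ X} [FiniteDimensional ℝ V]
    (hV : Module.finrank ℝ V = k) {o o' : Set (Fin k → X)} (ho : IsOrientation V o)
    (ho' : IsOrientation V o') (hne : o ≠ o') :
    ∃ ω : X [⋀^Fin k]→ₗ[ℝ] ℝ, (∃ v, (∀ i, v i ∈ V) ∧ ω v ≠ 0) ∧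
      o = {v | (∀ i, v i ∈ V) ∧ 0 < ω v} ∧ o' = {v | (∀ i, v i ∈ V) ∧ 0 < (-ω) v} := by
  obtain ⟨ω, hω, rfl⟩ := ho
  obtain ⟨ω', hω', rfl⟩ := ho'
  refine ⟨ω, hω, rfl, ?_⟩
  obtain ⟨e, heV, he⟩ := exists_frame hV
  have h1 := form_ne_zero hV hω heV he
  have h2 := form_ne_zero hV hω' heV he
  -- the two forms are proportional on `V`
  have hprop : ∀ v, (∀ i, v i ∈ V) → ω e * ω' v = ω' e * ω v := by
    intro v hv
    by_contra hcon
    have h3 : ∃ v, (∀ i, v i ∈ V) ∧ (ω e • ω' - ω' e • ω) v ≠ 0 :=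
      ⟨v, hv, by simpa [sub_eq_zero] using hcon⟩
    refine form_ne_zero hV h3 heV he ?_
    simp [mul_comm]
  rcases lt_or_gt_of_ne (mul_ne_zero h1 h2) with hneg | hpos
  · ext v
    simp only [mem_ofPred_eq, AlternatingMap.neg_apply]
    refine and_congr_right fun hv => ?_
    have h3 := hprop v hv
    have h4 : ω e * ω e * ω' v = (ω e * ω' e) * ω v := by rw [mul_assoc, h3]; ring
    have h5 : 0 < ω e * ω e := mul_self_pos.2 h1
    constructor <;> intro h <;> nlinarith
  · exfalso
    refine hne ?_
    ext v
    simp only [mem_ofPred_eq]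
    refine and_congr_right fun hv => ?_
    have h3 := hprop v hv
    have h4 : ω e * ω e * ω' v = (ω e * ω' e) * ω v := by rw [mul_assoc, h3]; ring
    have h5 : 0 < ω e * ω e := mul_self_pos.2 h1
    constructor <;> intro h <;> nlinarith

theorem IsOrientation.ne_of_neg {k : ℕ} {V : Submodule ℝ X} {ω : X [⋀^Fin k]→ₗ[ℝ] ℝ}
    (hω : ∃ v, (∀ i, v i ∈ V) ∧ ω v ≠ 0) :
    {v | (∀ i, v i ∈ V) ∧ 0 < ω v} ≠ {v | (∀ i, v i ∈ V) ∧ 0 < (-ω) v} := by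
  intro h
  obtain ⟨v, hv, hv0⟩ := hω
  have := Set.ext_iff.1 h v
  simp only [mem_ofPred_eq, hv, AlternatingMap.neg_apply, implies_true, true_and, Left.neg_pos_iff] at this
  rcases lt_or_gt_of_ne hv0 with h1 | h1
  · exact absurd (this.2 h1) (by linarith)
  · exact absurd (this.1 h1) (by linarith)

/-- The orientation that a facet `F` of `C` inherits from an orientation `o` of `C`: a frame of `F`
is positive if putting a vector that points out of `C` across `F` in front of it gives a positive
frame of `C`. The differences `x - y` with `x` in `F` and `y` in `C` outside `F` are such vectors,
and all of them give the same orientation. -/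
def inducedOrientation {k : ℕ} (o : Set (Fin (k + 1) → X)) (C F : Set X) : Set (Fin k → X) :=
  {v | (∀ i, v i ∈ vectorSpan ℝ F) ∧ ∃ x ∈ F, ∃ y ∈ C \ F, Matrix.vecCons (x - y) v ∈ o}

section induced

variable {k : ℕ} {C F : Set X}

theorem inducedOrientation_eq (hC : IsPolyhedron (k + 1) C) (hF : IsFacet k C F)
    (ω : X [⋀^Fin (k + 1)]→ₗ[ℝ] ℝ) {x₀ y₀ : X} (hx₀ : x₀ ∈ F) (hy₀ : y₀ ∈ C \ F) :
    inducedOrientation {v | (∀ i, v i ∈ vectorSpan ℝ C) ∧ 0 < ω v} C F =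
      {v | (∀ i, v i ∈ vectorSpan ℝ F) ∧ 0 < ω.curryLeft (x₀ - y₀) v} := by
  have := hF.2.finiteDimensional
  obtain ⟨l, m, hl, hm, z, hz, hzm⟩ := hF.exists_level hC
  have hlev : ∀ x ∈ F, l x = m := fun x hx => (hl ▸ hx : x ∈ {x ∈ C | l x = m}).2
  have hlt : ∀ y ∈ C \ F, l y < m := fun y hy =>
    lt_of_le_of_ne (hm y hy.1) fun h => hy.2 (by rw [hl]; exact ⟨hy.1, h⟩)
  have hspan := hC.vectorSpan_level hF.2 hF.subset hlev hz hzm.ne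
  have key : ∀ x ∈ F, ∀ y ∈ C \ F, ∀ v : Fin k → X, (∀ i, v i ∈ vectorSpan ℝ F) →
      ∃ a : ℝ, 0 < a ∧ ω (Matrix.vecCons (x - y) v) = a * ω.curryLeft (x₀ - y₀) v := by
    intro x hx y hy v hv
    have h0 : 0 < l (x₀ - y₀) := by rw [map_sub, hlev x₀ hx₀]; linarith [hlt y₀ hy₀]
    have h1 : 0 < l (x - y) := by rw [map_sub, hlev x hx]; linarith [hlt y hy]
    refine ⟨l (x - y) / l (x₀ - y₀), div_pos h1 h0, ?_⟩
    set a := l (x - y) / l (x₀ - y₀) with ha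
    have hw : (x - y) - a • (x₀ - y₀) ∈ vectorSpan ℝ F := by
      rw [hspan]
      refine ⟨Submodule.sub_mem _ (vsub_mem_vectorSpan ℝ (hF.subset hx) hy.1)
        (Submodule.smul_mem _ _ (vsub_mem_vectorSpan ℝ (hF.subset hx₀) hy₀.1)), ?_⟩
      change l ((x - y) - a • (x₀ - y₀)) = 0
      rw [map_sub, map_smul, smul_eq_mul, ha, div_mul_cancel₀ _ h0.ne', sub_self]
    have h2 : ω.curryLeft ((x - y) - a • (x₀ - y₀)) v = 0 := by
      rw [AlternatingMap.curryLeft_apply_apply]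
      refine form_eq_zero hF.2.finrank_eq ω fun i => ?_
      refine Fin.cases ?_ (fun j => ?_) i
      · simpa using hw
      · simpa using hv j
    have h3 : ω (Matrix.vecCons (x - y) v) = ω.curryLeft (x - y) v := rfl
    rw [map_sub, map_smul, AlternatingMap.sub_apply, AlternatingMap.smul_apply, smul_eq_mul,
      sub_eq_zero] at h2
    rw [h3, h2]
  ext v
  simp only [inducedOrientation, mem_ofPred_eq]
  refine and_congr_right fun hv => ?_
  constructor
  · rintro ⟨x, hx, y, hy, -, hpos⟩
    obtain ⟨a, ha, hae⟩ := key x hx y hy v hv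
    rw [hae] at hpos
    exact pos_of_mul_pos_right hpos ha.le
  · intro hpos
    refine ⟨x₀, hx₀, y₀, hy₀, fun i => ?_, hpos⟩
    refine Fin.cases ?_ (fun j => ?_) i
    · simpa using vsub_mem_vectorSpan ℝ (hF.subset hx₀) hy₀.1
    · simpa using vectorSpan_mono ℝ hF.subset (hv j)

theorem curryLeft_ne_zero (hC : IsPolyhedron (k + 1) C) (hF : IsFacet k C F)
    {ω : X [⋀^Fin (k + 1)]→ₗ[ℝ] ℝ} (hω : ∃ v, (∀ i, v i ∈ vectorSpan ℝ C) ∧ ω v ≠ 0)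
    {x₀ y₀ : X} (hx₀ : x₀ ∈ F) (hy₀ : y₀ ∈ C \ F) :
    ∃ v, (∀ i, v i ∈ vectorSpan ℝ F) ∧ ω.curryLeft (x₀ - y₀) v ≠ 0 := by
  have := hF.2.finiteDimensional
  have := hC.finiteDimensional
  obtain ⟨l, m, hl, hm, z, hz, hzm⟩ := hF.exists_level hC
  have hlev : ∀ x ∈ F, l x = m := fun x hx => (hl ▸ hx : x ∈ {x ∈ C | l x = m}).2
  have hlt : l y₀ < m :=
    lt_of_le_of_ne (hm y₀ hy₀.1) fun h => hy₀.2 (by rw [hl]; exact ⟨hy₀.1, h⟩)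
  obtain ⟨v, hv, hli⟩ := exists_frame hF.2.finrank_eq
  refine ⟨v, hv, ?_⟩
  rw [AlternatingMap.curryLeft_apply_apply]
  refine form_ne_zero hC.finrank_eq hω (fun i => ?_) ?_
  · refine Fin.cases ?_ (fun j => ?_) i
    · simpa using vsub_mem_vectorSpan ℝ (hF.subset hx₀) hy₀.1
    · simpa using vectorSpan_mono ℝ hF.subset (hv j)
  · refine linearIndependent_finCons.2 ⟨hli, fun hmem => ?_⟩
    have h1 : Submodule.span ℝ (range v) ≤ LinearMap.ker (l : X →ₗ[ℝ] ℝ) := by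
      rw [Submodule.span_le]
      rintro _ ⟨i, rfl⟩
      have h2 := hv i
      rw [hC.vectorSpan_level hF.2 hF.subset hlev hz hzm.ne] at h2
      exact h2.2
    have h3 : l (x₀ - y₀) = 0 := h1 hmem
    rw [map_sub, hlev x₀ hx₀] at h3
    linarith

theorem IsFacet.exists_mem_diff (hC : IsPolyhedron (k + 1) C) (hF : IsFacet k C F) :
    ∃ x₀ ∈ F, ∃ y₀, y₀ ∈ C \ F := by
  obtain ⟨l, m, hl, hm, z, hz, hzm⟩ := hF.exists_level hC
  obtain ⟨x₀, hx₀⟩ := hF.2.nonempty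
  exact ⟨x₀, hx₀, z, hz, fun h => hzm.ne (hl ▸ h : z ∈ {x ∈ C | l x = m}).2⟩

theorem isOrientation_induced (hC : IsPolyhedron (k + 1) C) (hF : IsFacet k C F)
    {o : Set (Fin (k + 1) → X)} (ho : IsOrientation (vectorSpan ℝ C) o) :
    IsOrientation (vectorSpan ℝ F) (inducedOrientation o C F) := by
  obtain ⟨ω, hω, rfl⟩ := ho
  obtain ⟨x₀, hx₀, y₀, hy₀⟩ := hF.exists_mem_diff hC
  exact ⟨ω.curryLeft (x₀ - y₀), curryLeft_ne_zero hC hF hω hx₀ hy₀,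
    inducedOrientation_eq hC hF ω hx₀ hy₀⟩

end induced

namespace OrientedPolyhedron

variable {k : ℕ}

/-- Two polyhedra that differ by their orientation only. Since a `k`-dimensional space has exactly
two orientations, `P'` is then the polyhedron `P` with the opposite orientation. -/
def IsOpposite (P P' : OrientedPolyhedron X k) : Prop :=
  P.carrier = P'.carrier ∧ P.orientation ≠ P'.orientation

/-- `P` is the union of `P₁` and `P₂`, which carry the orientation of `P` and are disjoint as open
polyhedra. -/
structure IsSubdivision (P P₁ P₂ : OrientedPolyhedron X k) : Prop where
  carrier_eq : P.carrier = P₁.carrier ∪ P₂.carrier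
  disjoint : Disjoint (intrinsicInterior ℝ P₁.carrier) (intrinsicInterior ℝ P₂.carrier)
  orientation_left : P₁.orientation = P.orientation
  orientation_right : P₂.orientation = P.orientation

/-- The facets of an oriented polyhedron, with the induced orientation. -/
def facets (P : OrientedPolyhedron X (k + 1)) : Set (OrientedPolyhedron X k) :=
  {F | IsFacet k P.carrier F.carrier ∧
    F.orientation = inducedOrientation P.orientation P.carrier F.carrier}

theorem carrier_injOn_facets (P : OrientedPolyhedron X (k + 1)) :
    InjOn carrier P.facets := fun F hF F' hF' h =>
  OrientedPolyhedron.ext h (by rw [hF.2, hF'.2, h])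

theorem carrier_image_facets (P : OrientedPolyhedron X (k + 1)) :
    carrier '' P.facets = {F | IsFacet k P.carrier F} := by
  ext F
  constructor
  · rintro ⟨F, hF, rfl⟩
    exact hF.1
  · intro hF
    exact ⟨⟨F, hF.2, inducedOrientation P.orientation P.carrier F,
      isOrientation_induced P.isPolyhedron hF P.isOrientation⟩, ⟨hF, rfl⟩, rfl⟩

theorem facets_finite (P : OrientedPolyhedron X (k + 1)) : P.facets.Finite := by
  refine Set.Finite.of_finite_image ?_ P.carrier_injOn_facets
  rw [carrier_image_facets]
  exact IsFacet.finite P.isPolyhedron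

/-- The part of `P` in the half-space `f < r` (with its closure), if there is any. -/
def below (P : OrientedPolyhedron X k) (f : StrongDual ℝ X) (r : ℝ)
    (h : ∃ a ∈ P.carrier, f a < r) : OrientedPolyhedron X k where
  carrier := {x ∈ P.carrier | f x ≤ r}
  isPolyhedron := P.isPolyhedron.cut h.choose_spec.1 h.choose_spec.2
  orientation := P.orientation
  isOrientation := by
    have := P.isPolyhedron.vectorSpan_eq
      (P.isPolyhedron.cut h.choose_spec.1 h.choose_spec.2) (sep_subset _ _)
    rw [this]
    exact P.isOrientation

end OrientedPolyhedron

/-! ### Polyhedral chains -/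

section chains

variable {G : Type*} [NormedAddCommGroup G] {k : ℕ}

open OrientedPolyhedron

variable (X G k) in
/-- The relations `(-g)[P] = g[-P]` and `g[P₁ ∪ P₂] = g[P₁] + g[P₂]` between formal sums. The
relation `(g₁ + g₂)[P] = g₁[P] + g₂[P]` holds for finitely supported functions already. -/
def relations : AddSubgroup (OrientedPolyhedron X k →₀ G) :=
  AddSubgroup.closure
    ({z | ∃ (P P' : OrientedPolyhedron X k) (g : G), P.IsOpposite P' ∧
        z = Finsupp.single P (-g) - Finsupp.single P' g} ∪
      {z | ∃ (P P₁ P₂ : OrientedPolyhedron X k) (g : G), P.IsSubdivision P₁ P₂ ∧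
        z = Finsupp.single P g - (Finsupp.single P₁ g + Finsupp.single P₂ g)})

variable (X G k) in
/-- The group of polyhedral `k`-chains in `X` with coefficients in `G`. -/
abbrev PolyChain : Type _ := (OrientedPolyhedron X k →₀ G) ⧸ relations X G k

/-- The chain represented by a formal sum. -/
def toChain : (OrientedPolyhedron X k →₀ G) →+ PolyChain X G k :=
  QuotientAddGroup.mk' (relations X G k)

/-- The simple chain `g[P]`, as a homomorphism in `g`. -/
def simple (P : OrientedPolyhedron X k) : G →+ PolyChain X G k :=
  toChain.comp (Finsupp.singleAddHom P)

theorem simple_opposite {P P' : OrientedPolyhedron X k} (h : P.IsOpposite P') (g : G) :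
    simple P g + simple P' g = 0 := by
  have h1 : toChain (Finsupp.single P (-g) - Finsupp.single P' g) = (0 : PolyChain X G k) :=
    (QuotientAddGroup.eq_zero_iff _).2
      (AddSubgroup.subset_closure (Or.inl ⟨P, P', g, h, rfl⟩))
  rw [map_sub] at h1
  have h2 : simple P (-g) - simple P' g = 0 := h1
  rw [map_neg] at h2
  rw [← neg_eq_zero, ← h2]
  abel

theorem simple_subdivision {P P₁ P₂ : OrientedPolyhedron X k} (h : P.IsSubdivision P₁ P₂) (g : G) :
    simple P g = simple P₁ g + simple P₂ g := by
  have h1 : toChain (Finsupp.single P g - (Finsupp.single P₁ g + Finsupp.single P₂ g)) =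
      (0 : PolyChain X G k) :=
    (QuotientAddGroup.eq_zero_iff _).2
      (AddSubgroup.subset_closure (Or.inr ⟨P, P₁, P₂, g, h, rfl⟩))
  rw [map_sub, map_add, sub_eq_zero] at h1
  exact h1

/-- Homomorphisms on chains, defined on simple chains. -/
def liftChain {A : Type*} [AddCommGroup A] (φ : OrientedPolyhedron X k → G →+ A)
    (hopp : ∀ P P', P.IsOpposite P' → ∀ g, φ P g + φ P' g = 0)
    (hsub : ∀ P P₁ P₂, P.IsSubdivision P₁ P₂ → ∀ g, φ P g = φ P₁ g + φ P₂ g) :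
    PolyChain X G k →+ A :=
  QuotientAddGroup.lift (relations X G k) (Finsupp.liftAddHom φ) <| by
    refine (AddSubgroup.closure_le (Finsupp.liftAddHom φ).ker).2 ?_
    rintro z (⟨P, P', g, h, rfl⟩ | ⟨P, P₁, P₂, g, h, rfl⟩)
    · change Finsupp.liftAddHom φ _ = 0
      rw [map_sub, Finsupp.liftAddHom_apply_single, Finsupp.liftAddHom_apply_single, map_neg,
        ← neg_eq_zero, ← hopp P P' h g]
      abel
    · change Finsupp.liftAddHom φ _ = 0
      rw [map_sub, map_add, Finsupp.liftAddHom_apply_single, Finsupp.liftAddHom_apply_single,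
        Finsupp.liftAddHom_apply_single, hsub P P₁ P₂ h g, sub_self]

/-! ### The boundary operator -/

/-- The boundary of `g[P]`: the sum of `g[F]` over the facets `F` of `P` with the induced
orientation. -/
def simpleBoundary (P : OrientedPolyhedron X (k + 1)) : G →+ PolyChain X G k :=
  ∑ F ∈ P.facets_finite.toFinset, simple F

open Classical in
/-- The simple chain `g[P]` in terms of the set and the orientation of `P`. -/
def simpleOf (C : Set X) (o : Set (Fin k → X)) : G →+ PolyChain X G k :=
  if h : ∃ P : OrientedPolyhedron X k, P.carrier = C ∧ P.orientation = o then simple h.choose else 0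

theorem simpleOf_eq (P : OrientedPolyhedron X k) :
    (simpleOf P.carrier P.orientation : G →+ PolyChain X G k) = simple P := by
  have h : ∃ Q : OrientedPolyhedron X k, Q.carrier = P.carrier ∧ Q.orientation = P.orientation :=
    ⟨P, rfl, rfl⟩
  rw [simpleOf, dif_pos h]
  congr 1
  exact OrientedPolyhedron.ext h.choose_spec.1 h.choose_spec.2

theorem simpleBoundary_eq (P : OrientedPolyhedron X (k + 1)) :
    (simpleBoundary P : G →+ PolyChain X G k) =
      ∑ C ∈ (IsFacet.finite P.isPolyhedron).toFinset,
        simpleOf C (inducedOrientation P.orientation P.carrier C) := by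
  classical
  have h : (IsFacet.finite P.isPolyhedron).toFinset = P.facets_finite.toFinset.image carrier := by
    ext C
    have := Set.ext_iff.1 P.carrier_image_facets C
    simpa using this.symm
  rw [h, Finset.sum_image (fun F hF F' hF' hh => P.carrier_injOn_facets
    (by simpa using hF) (by simpa using hF') hh), simpleBoundary]
  refine Finset.sum_congr rfl fun F hF => ?_
  have hF : F ∈ P.facets := by simpa using hF
  rw [← hF.2, simpleOf_eq]

theorem simpleBoundary_opposite (P P' : OrientedPolyhedron X (k + 1)) (h : P.IsOpposite P')
    (g : G) : (simpleBoundary P g + simpleBoundary P' g : PolyChain X G k) = 0 := by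
  obtain ⟨C, hC, o, ho⟩ := P
  obtain ⟨C', hC', o', ho'⟩ := P'
  obtain ⟨rfl, hne⟩ := h
  rw [simpleBoundary_eq, simpleBoundary_eq]
  simp only [AddMonoidHom.finsetSum_apply]
  rw [← Finset.sum_add_distrib]
  refine Finset.sum_eq_zero fun F hF => ?_
  have hF : IsFacet k C F := by simpa using hF
  have := hC.finiteDimensional
  obtain ⟨ω, hω, hoω, hoω'⟩ := ho.exists_opposite hC.finrank_eq ho' hne
  obtain ⟨x₀, hx₀, y₀, hy₀⟩ := hF.exists_mem_diff hC
  have h1 := inducedOrientation_eq hC hF ω hx₀ hy₀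
  have h2 := inducedOrientation_eq hC hF (-ω) hx₀ hy₀
  have hI := isOrientation_induced hC hF ho
  have hI' := isOrientation_induced hC hF ho'
  have h3 := simpleOf_eq (G := G) (⟨F, hF.2, _, hI⟩ : OrientedPolyhedron X k)
  have h4 := simpleOf_eq (G := G) (⟨F, hF.2, _, hI'⟩ : OrientedPolyhedron X k)
  change (simpleOf F (inducedOrientation o C F)) g + (simpleOf F (inducedOrientation o' C F)) g = 0
  rw [h3, h4]
  apply simple_opposite
  refine ⟨rfl, ?_⟩
  change inducedOrientation o C F ≠ inducedOrientation o' C F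
  rw [hoω, hoω', h1, h2]
  have h5 := IsOrientation.ne_of_neg (curryLeft_ne_zero hC hF hω hx₀ hy₀)
  exact h5

theorem intrinsicInterior_mono_of_affineSpan_eq {C D : Set X} (h : D ⊆ C)
    (hs : affineSpan ℝ D = affineSpan ℝ C) : intrinsicInterior ℝ D ⊆ intrinsicInterior ℝ C := by
  intro x hx
  rw [mem_intrinsicInterior] at hx ⊢
  obtain ⟨y, hy, rfl⟩ := hx
  let θ : affineSpan ℝ C → affineSpan ℝ D := fun z => ⟨z, by rw [hs]; exact z.2⟩
  have hθ : Continuous θ := Continuous.subtype_mk continuous_subtype_val _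
  refine ⟨⟨y, by rw [← hs]; exact y.2⟩, ?_, rfl⟩
  rw [mem_interior]
  refine ⟨θ ⁻¹' interior (Subtype.val ⁻¹' D), fun z hz => ?_, isOpen_interior.preimage hθ, hy⟩
  have : θ z ∈ ((↑) ⁻¹' D : Set (affineSpan ℝ D)) := interior_subset hz
  exact h this

theorem exists_extend_mem {D : Set X} {x a : X} (hx : x ∈ intrinsicInterior ℝ D) (ha : a ∈ D) :
    ∃ ε : ℝ, 0 < ε ∧ x + ε • (x - a) ∈ D := by
  rw [mem_intrinsicInterior] at hx
  obtain ⟨y, hy, rfl⟩ := hx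
  have hmem : ∀ t : ℝ, (y : X) + t • ((y : X) - a) ∈ affineSpan ℝ D := by
    intro t
    have h1 := AffineMap.lineMap_mem (Q := affineSpan ℝ D) (1 + t) (subset_affineSpan ℝ _ ha) y.2
    have h2 : AffineMap.lineMap a (y : X) (1 + t) = (y : X) + t • ((y : X) - a) := by
      rw [AffineMap.lineMap_apply]
      simp only [vsub_eq_sub, vadd_eq_add]
      module
    rwa [h2] at h1
  let τ : ℝ → affineSpan ℝ D := fun t => ⟨(y : X) + t • ((y : X) - a), hmem t⟩
  have hτ : Continuous τ := Continuous.subtype_mk (by fun_prop) _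
  have hτ0 : τ 0 = y := by ext; simp [τ]
  have hev : ∀ᶠ t in nhdsWithin (0 : ℝ) (Ioi 0), τ t ∈ interior (Subtype.val ⁻¹' D) :=
    nhdsWithin_le_nhds (hτ.continuousAt.eventually_mem (isOpen_interior.mem_nhds (by rwa [hτ0])))
  obtain ⟨t, ht, ht0⟩ := (hev.and self_mem_nhdsWithin).exists
  exact ⟨t, ht0, (interior_subset ht : τ t ∈ Subtype.val ⁻¹' D)⟩

theorem disjoint_intrinsicInterior_cut {E : Set X} {h : StrongDual ℝ X} {c : ℝ} {a : X}
    (ha : a ∈ E) (hac : h a < c) :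
    Disjoint (intrinsicInterior ℝ {x ∈ E | h x ≤ c}) (intrinsicInterior ℝ {x ∈ E | c ≤ h x}) := by
  rw [disjoint_left]
  intro x hx hx'
  obtain ⟨ε, hε, h1⟩ := exists_extend_mem hx (a := a) ⟨ha, hac.le⟩
  have h2 := (intrinsicInterior_subset hx').2
  have h3 := h1.2
  simp only [map_add, map_smul, map_sub, smul_eq_mul] at h3
  nlinarith

/-- The facets of the part of a polyhedron on one side of a hyperplane. -/
theorem isFacet_cut_iff {C : Set X} (hC : IsPolyhedron (k + 1) C) {h : StrongDual ℝ X} {c : ℝ}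
    {a b : X} (ha : a ∈ C) (hac : h a < c) (hb : b ∈ C) (hbc : c < h b) (F : Set X) :
    IsFacet k {x ∈ C | h x ≤ c} F ↔ F = {x ∈ C | h x = c} ∨
      ∃ E, IsFacet k C E ∧ (∃ x ∈ E, h x < c) ∧ F = {x ∈ E | h x ≤ c} := by
  have hC₁ := hC.cut ha hac
  have hT := hC.hyperplane_section ha hac hb hbc
  have hTeq : {x ∈ {x ∈ C | h x ≤ c} | h x = c} = {x ∈ C | h x = c} := by
    ext x
    simp only [mem_ofPred_eq]
    exact ⟨fun hx => ⟨hx.1.1, hx.2⟩, fun hx => ⟨⟨hx.1, hx.2.le⟩, hx.2⟩⟩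
  constructor
  · intro hF
    by_cases hFc : ∃ x ∈ F, h x < c
    · right
      obtain ⟨x, hx, hxc⟩ := hFc
      obtain ⟨l, m, hl, hm, -⟩ := hF.exists_level hC₁
      have hxl : x ∈ {x ∈ {x ∈ C | h x ≤ c} | l x = m} := hl ▸ hx
      have hm' : ∀ y ∈ C, l y ≤ m := by
        intro y hy
        by_contra! hym
        rcases le_or_gt (h y) c with hyc | hyc
        · exact absurd (hm y ⟨hy, hyc⟩) (by linarith)
        have hpos : 0 < h y - h x := by linarith
        set t := (c - h x) / (h y - h x) with ht
        have ht0 : 0 < t := div_pos (by linarith) hpos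
        have ht1 : t ≤ 1 := by rw [ht, div_le_one hpos]; linarith
        have h1 := hm (x + t • (y - x))
          ⟨hC.convex.add_smul_sub_mem hxl.1.1 hy ⟨ht0.le, ht1⟩, by
            simp only [map_add, map_smul, map_sub, smul_eq_mul]
            rw [ht, div_mul_cancel₀ _ hpos.ne']; linarith⟩
        simp only [map_add, map_smul, map_sub, smul_eq_mul, hxl.2] at h1
        nlinarith
      have hFE : F = {x ∈ {x ∈ C | l x = m} | h x ≤ c} := by
        rw [hl]
        ext y
        simp only [mem_ofPred_eq]
        tauto
      have hconv : Convex ℝ {x ∈ C | l x = m} := by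
        intro p hp q hq s t hs ht hst
        refine ⟨hC.convex hp.1 hq.1 hs ht hst, ?_⟩
        simp only [map_add, map_smul, smul_eq_mul, hp.2, hq.2]
        rw [← add_mul, hst, one_mul]
      refine ⟨{x ∈ C | l x = m}, IsFacet.of_level hC hm' ⟨x, hxl.1.1, hxl.2⟩ ?_,
        ⟨x, ⟨hxl.1.1, hxl.2⟩, hxc⟩, hFE⟩
      have h2 := IsPolyhedron.affineSpan_eq_of_subset_cut hconv (h := h) (c := c)
        (a := x) ⟨hxl.1.1, hxl.2⟩ hxc
      rw [← direction_affineSpan, ← h2, ← hFE, direction_affineSpan, hF.2.finrank_eq]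
    · left
      push Not at hFc
      have hFT : ∀ x ∈ F, h x = c := fun x hx => le_antisymm (hF.subset hx).2 (hFc x hx)
      rw [← hTeq]
      exact hF.eq_level hC₁ hFT (y := a) ⟨ha, hac.le⟩ hac.ne
  · rintro (rfl | ⟨E, hE, ⟨x, hx, hxc⟩, rfl⟩)
    · rw [← hTeq] at hT ⊢
      exact IsFacet.of_level hC₁ (fun x hx => hx.2) hT.nonempty hT.finrank_eq
    · refine ⟨fun _ => ?_, hE.2.cut hx hxc⟩
      obtain ⟨l, m, hl, hm, -⟩ := hE.exists_level hC
      refine ⟨l, ?_⟩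
      have hxm : x ∈ {x ∈ C | l x = m} := hl ▸ hx
      rw [hl]
      ext y
      simp only [mem_ofPred_eq]
      constructor
      · rintro ⟨⟨hy, hym⟩, hyc⟩
        exact ⟨⟨hy, hyc⟩, fun z hz => hym ▸ hm z hz.1⟩
      · rintro ⟨⟨hy, hyc⟩, hmax⟩
        refine ⟨⟨hy, le_antisymm (hm y hy) ?_⟩, hyc⟩
        have := hmax x ⟨hxm.1, hxc.le⟩
        rwa [hxm.2] at this

open Classical in
/-- The boundary of the part of a polyhedron on one side of a hyperplane. -/
theorem simpleBoundary_cut (P P₁ : OrientedPolyhedron X (k + 1)) {h : StrongDual ℝ X} {c : ℝ}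
    {a b : X} (ha : a ∈ P.carrier) (hac : h a < c) (hb : b ∈ P.carrier) (hbc : c < h b)
    (h₁ : P₁.carrier = {x ∈ P.carrier | h x ≤ c}) (ho : P₁.orientation = P.orientation) :
    (simpleBoundary P₁ : G →+ PolyChain X G k) =
      simpleOf {x ∈ P.carrier | h x = c}
        (inducedOrientation P₁.orientation P₁.carrier {x ∈ P.carrier | h x = c}) +
      ∑ E ∈ (IsFacet.finite P.isPolyhedron).toFinset,
        if ∃ x ∈ E, h x < c then simpleOf {x ∈ E | h x ≤ c}
          (inducedOrientation P.orientation P.carrier E) else 0 := by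
  obtain ⟨C, hC, o, hoC⟩ := P
  obtain ⟨C₁, hC₁, o₁, hoC₁⟩ := P₁
  simp only at ha hb h₁ ho ⊢
  subst h₁ ho
  rw [simpleBoundary_eq]
  simp only
  have hfin : (IsFacet.finite hC₁).toFinset = insert {x ∈ C | h x = c}
      (((IsFacet.finite hC).toFinset.filter fun E => ∃ x ∈ E, h x < c).image
        fun E => {x ∈ E | h x ≤ c}) := by
    ext F
    have := isFacet_cut_iff hC ha hac hb hbc F
    simp only [Set.Finite.mem_toFinset, mem_ofPred_eq, Finset.mem_insert, Finset.mem_image,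
      Finset.mem_filter]
    rw [this]
    refine or_congr_right ⟨?_, ?_⟩
    · rintro ⟨E, h1, h2, rfl⟩
      exact ⟨E, ⟨h1, h2⟩, rfl⟩
    · rintro ⟨E, ⟨h1, h2⟩, rfl⟩
      exact ⟨E, h1, h2, rfl⟩
  rw [hfin, Finset.sum_insert, Finset.sum_image, Finset.sum_filter]
  · congr 1
    refine Finset.sum_congr rfl fun E hE₀ => ?_
    have hE : IsFacet k C E := by simpa using hE₀
    clear hE₀
    split_ifs with hEc
    · congr 1
      obtain ⟨x, hx, hxc⟩ := hEc
      have hF : IsFacet k {x ∈ C | h x ≤ c} {x ∈ E | h x ≤ c} :=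
        (isFacet_cut_iff hC ha hac hb hbc _).2 (Or.inr ⟨E, hE, ⟨x, hx, hxc⟩, rfl⟩)
      obtain ⟨ω, hω, rfl⟩ := hoC
      have hV : vectorSpan ℝ {x ∈ C | h x ≤ c} = vectorSpan ℝ C :=
        hC.vectorSpan_eq hC₁ (sep_subset _ _)
      have hW : vectorSpan ℝ {x ∈ E | h x ≤ c} = vectorSpan ℝ E :=
        hE.2.vectorSpan_eq hF.2 (sep_subset _ _)
      obtain ⟨x₀, hx₀, y₀, hy₀⟩ := hF.exists_mem_diff hC₁
      have h1 := inducedOrientation_eq hC₁ hF ω hx₀ hy₀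
      rw [hV, hW] at h1
      rw [h1, inducedOrientation_eq hC hE ω (x₀ := x₀) (y₀ := y₀) hx₀.1
        ⟨hy₀.1.1, fun hyE => hy₀.2 ⟨hyE, hy₀.1.2⟩⟩]
    · rfl
  · intro E hE E' hE' heq
    simp only [Finset.coe_filter, Set.Finite.mem_toFinset, mem_ofPred_eq] at hE hE'
    obtain ⟨hE, x, hx, hxc⟩ := hE
    obtain ⟨hE', -⟩ := hE'
    have heq : {x ∈ E | h x ≤ c} = {x ∈ E' | h x ≤ c} := heq
    -- the smaller facet lies in `E'`, so `E'` spans the plane of `E`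
    obtain ⟨l, m, hl, hm, z, hz, hzm⟩ := hE'.exists_level hC
    have hsub : {x ∈ E | h x ≤ c} ⊆ E' := heq ▸ sep_subset _ _
    have hlev : ∀ y ∈ E, l y = m := by
      intro y hy
      have h1 := IsPolyhedron.affineSpan_eq_of_subset_cut hE.2.convex hx hxc
      have h2 : y ∈ affineSpan ℝ {x ∈ E | h x ≤ c} := by
        rw [h1]; exact subset_affineSpan ℝ _ hy
      have hxE' : l x = m := (hl ▸ hsub ⟨hx, hxc.le⟩ : x ∈ {x ∈ C | l x = m}).2
      have h3 : y - x ∈ vectorSpan ℝ {x ∈ E | h x ≤ c} := by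
        rw [← direction_affineSpan]
        exact AffineSubspace.vsub_mem_direction h2 (subset_affineSpan ℝ _ ⟨hx, hxc.le⟩)
      have h4 : vectorSpan ℝ {x ∈ E | h x ≤ c} ≤ LinearMap.ker (l : X →ₗ[ℝ] ℝ) := by
        refine (vectorSpan_mono ℝ hsub).trans ?_
        rw [hC.vectorSpan_level hE'.2 hE'.subset
          (fun x hx => (hl ▸ hx : x ∈ {x ∈ C | l x = m}).2) hz hzm.ne]
        exact inf_le_right
      have h5 : l (y - x) = 0 := h4 h3
      rw [map_sub, hxE', sub_eq_zero] at h5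
      exact h5
    rw [hl]
    exact hE.eq_level hC hlev hz hzm.ne
  · intro hmem
    simp only [Finset.mem_image, Finset.mem_filter, Set.Finite.mem_toFinset, mem_ofPred_eq] at hmem
    obtain ⟨E, ⟨hE, x, hx, hxc⟩, heq⟩ := hmem
    have : x ∈ {x ∈ C | h x = c} := heq ▸ ⟨hx, hxc.le⟩
    exact hxc.ne this.2

theorem simpleBoundary_subdivision (P P₁ P₂ : OrientedPolyhedron X (k + 1))
    (hP : P.IsSubdivision P₁ P₂) (g : G) :
    (simpleBoundary P g : PolyChain X G k) = simpleBoundary P₁ g + simpleBoundary P₂ g := by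
  classical
  obtain ⟨h, c, h₁, h₂, ⟨a, ha, hac⟩, b, hb, hbc⟩ := exists_cut P.isPolyhedron P₁.isPolyhedron
    P₂.isPolyhedron hP.carrier_eq hP.disjoint
  have hC := P.isPolyhedron
  have e₁ := simpleBoundary_cut (G := G) P P₁ ha hac hb hbc h₁ hP.orientation_left
  have e₂ := simpleBoundary_cut (G := G) P P₂ (h := -h) (c := -c) (a := b) (b := a) hb (by simpa)
    ha (by simpa) (by simpa using h₂) hP.orientation_right
  simp only [neg_apply, neg_inj, neg_le_neg_iff, neg_lt_neg_iff] at e₂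
  set T := {x ∈ P.carrier | h x = c} with hTdef
  -- the two copies of the cutting section cancel
  have hcancel : (simpleOf T (inducedOrientation P₁.orientation P₁.carrier T) g +
      simpleOf T (inducedOrientation P₂.orientation P₂.carrier T) g : PolyChain X G k) = 0 := by
    have hT₁ : IsFacet k P₁.carrier T := by
      rw [h₁]; exact (isFacet_cut_iff hC ha hac hb hbc T).2 (Or.inl rfl)
    have hT₂ : IsFacet k P₂.carrier T := by
      have := (isFacet_cut_iff hC (h := -h) (c := -c) (a := b) (b := a) hb (by simpa)
        ha (by simpa) T).2 (Or.inl (by simp [hTdef]))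
      rw [h₂]
      simpa using this
    have hI₁ := isOrientation_induced P₁.isPolyhedron hT₁ P₁.isOrientation
    have hI₂ := isOrientation_induced P₂.isPolyhedron hT₂ P₂.isOrientation
    have s₁ := simpleOf_eq (G := G) (⟨T, hT₁.2, _, hI₁⟩ : OrientedPolyhedron X k)
    have s₂ := simpleOf_eq (G := G) (⟨T, hT₂.2, _, hI₂⟩ : OrientedPolyhedron X k)
    simp only at s₁ s₂
    rw [s₁, s₂]
    apply simple_opposite
    refine ⟨rfl, ?_⟩
    simp only
    obtain ⟨ω, hω, hωo⟩ := P.isOrientation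
    have hV₁ : vectorSpan ℝ P₁.carrier = vectorSpan ℝ P.carrier :=
      hC.vectorSpan_eq P₁.isPolyhedron (hP.carrier_eq ▸ subset_union_left)
    have hV₂ : vectorSpan ℝ P₂.carrier = vectorSpan ℝ P.carrier :=
      hC.vectorSpan_eq P₂.isPolyhedron (hP.carrier_eq ▸ subset_union_right)
    have hpos : 0 < h b - h a := by linarith
    set t := (c - h a) / (h b - h a) with ht
    have ht0 : 0 < t := div_pos (by linarith) hpos
    have ht1 : t < 1 := by rw [ht, div_lt_one hpos]; linarith
    set z := a + t • (b - a) with hz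
    have hzT : z ∈ T := by
      refine ⟨hC.convex.add_smul_sub_mem ha hb ⟨ht0.le, ht1.le⟩, ?_⟩
      rw [hz]
      simp only [map_add, map_smul, map_sub, smul_eq_mul]
      rw [ht, div_mul_cancel₀ _ hpos.ne']; linarith
    have haT : a ∈ P₁.carrier \ T := ⟨by rw [h₁]; exact ⟨ha, hac.le⟩, fun h => hac.ne h.2⟩
    have hbT : b ∈ P₂.carrier \ T := ⟨by rw [h₂]; exact ⟨hb, hbc.le⟩, fun h => hbc.ne' h.2⟩
    have i₁ := inducedOrientation_eq P₁.isPolyhedron hT₁ ω hzT haT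
    have i₂ := inducedOrientation_eq P₂.isPolyhedron hT₂ ω hzT hbT
    rw [hV₁, ← hωo] at i₁
    rw [hV₂, ← hωo] at i₂
    rw [hP.orientation_left, hP.orientation_right, i₁, i₂]
    have hne := IsOrientation.ne_of_neg
      (curryLeft_ne_zero P₁.isPolyhedron hT₁ (ω := ω) (hV₁ ▸ hω) hzT haT)
    have hzb : z - b = (-((1 - t) / t)) • (z - a) := by
      have h3 : z - a = t • (b - a) := by rw [hz]; abel
      rw [h3, smul_smul, neg_mul, div_mul_cancel₀ _ ht0.ne', hz]
      module
    have hpos' : 0 < (1 - t) / t := div_pos (by linarith) ht0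
    refine fun heq => hne (heq.trans ?_)
    ext v
    simp only [mem_ofPred_eq]
    refine and_congr_right fun _ => ?_
    rw [hzb, map_smul, AlternatingMap.smul_apply, AlternatingMap.neg_apply, smul_eq_mul, neg_mul,
      ← mul_neg]
    exact mul_pos_iff_of_pos_left hpos'
  rw [e₁, e₂, simpleBoundary_eq]
  simp only [AddMonoidHom.add_apply, AddMonoidHom.finsetSum_apply]
  rw [add_add_add_comm, hcancel, zero_add, ← Finset.sum_add_distrib]
  refine Finset.sum_congr rfl fun E hE => ?_
  have hE : IsFacet k P.carrier E := by simpa using hE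
  have hI := isOrientation_induced hC hE P.isOrientation
  -- a facet is cut, or lies on one side
  by_cases hl : ∃ x ∈ E, h x < c <;> by_cases hr : ∃ x ∈ E, c < h x
  · rw [if_pos hl, if_pos hr]
    obtain ⟨x, hx, hxc⟩ := hl
    obtain ⟨y, hy, hyc⟩ := hr
    have p₁ : IsPolyhedron k {x ∈ E | h x ≤ c} := hE.2.cut hx hxc
    have p₂ : IsPolyhedron k {x ∈ E | c ≤ h x} := by
      simpa using hE.2.cut (h := -h) (c := -c) hy (by simpa)
    have v₁ := hE.2.vectorSpan_eq p₁ (sep_subset _ _)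
    have v₂ := hE.2.vectorSpan_eq p₂ (sep_subset _ _)
    have s₀ := simpleOf_eq (G := G) (⟨E, hE.2, _, hI⟩ : OrientedPolyhedron X k)
    have s₁ := simpleOf_eq (G := G)
      (⟨{x ∈ E | h x ≤ c}, p₁, _, v₁ ▸ hI⟩ : OrientedPolyhedron X k)
    have s₂ := simpleOf_eq (G := G)
      (⟨{x ∈ E | c ≤ h x}, p₂, _, v₂ ▸ hI⟩ : OrientedPolyhedron X k)
    simp only at s₀ s₁ s₂
    rw [s₀, s₁, s₂]
    apply simple_subdivision
    refine ⟨?_, ?_, rfl, rfl⟩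
    · ext x
      simp only [mem_union, mem_ofPred_eq, ← and_or_left]
      exact ⟨fun hx => ⟨hx, le_total _ _⟩, fun hx => hx.1⟩
    · exact disjoint_intrinsicInterior_cut hx hxc
  · rw [if_pos hl, if_neg hr]
    push Not at hr
    have : {x ∈ E | h x ≤ c} = E := sep_eq_self_iff_mem_true.2 hr
    rw [this]; simp
  · rw [if_neg hl, if_pos hr]
    push Not at hl
    have : {x ∈ E | c ≤ h x} = E := sep_eq_self_iff_mem_true.2 hl
    rw [this]; simp
  · exfalso
    push Not at hl hr
    have hET := hE.eq_level hC (fun x hx => le_antisymm (hr x hx) (hl x hx)) ha hac.ne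
    obtain ⟨l, m, hlE, hm, -⟩ := hE.exists_level hC
    have hpos : 0 < h b - h a := by linarith
    set t := (c - h a) / (h b - h a) with ht
    have ht0 : 0 < t := div_pos (by linarith) hpos
    have ht1 : t < 1 := by rw [ht, div_lt_one hpos]; linarith
    have hzE : a + t • (b - a) ∈ E := by
      rw [hET]
      refine ⟨hC.convex.add_smul_sub_mem ha hb ⟨ht0.le, ht1.le⟩, ?_⟩
      simp only [map_add, map_smul, map_sub, smul_eq_mul]
      rw [ht, div_mul_cancel₀ _ hpos.ne']; linarith
    rw [hlE] at hzE
    have h3 := hzE.2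
    simp only [map_add, map_smul, map_sub, smul_eq_mul] at h3
    have h4 := hm a ha
    have h5 := hm b hb
    have h6 : l a = m := by nlinarith
    have haE : a ∈ E := by rw [hlE]; exact ⟨ha, h6⟩
    exact absurd (hl a haE) (by linarith)

/-- The boundary operator on polyhedral chains. -/
def boundary : PolyChain X G (k + 1) →+ PolyChain X G k :=
  liftChain simpleBoundary simpleBoundary_opposite simpleBoundary_subdivision

/-! ### Restriction to half-spaces and slices -/

open Classical in
/-- The part of `g[P]` in the half-space `f < r`. -/
def simpleRestrict (f : StrongDual ℝ X) (r : ℝ) (P : OrientedPolyhedron X k) :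
    G →+ PolyChain X G k :=
  if h : ∃ a ∈ P.carrier, f a < r then simple (P.below f r h) else 0

theorem simpleRestrict_opposite (f : StrongDual ℝ X) (r : ℝ) (P P' : OrientedPolyhedron X k)
    (h : P.IsOpposite P') (g : G) : simpleRestrict f r P g + simpleRestrict f r P' g = 0 := by
  obtain ⟨C, hC, o, ho⟩ := P
  obtain ⟨C', hC', o', ho'⟩ := P'
  obtain ⟨rfl, hne⟩ := h
  by_cases hr : ∃ a ∈ C, f a < r
  · rw [simpleRestrict, simpleRestrict, dif_pos hr, dif_pos hr]
    apply simple_opposite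
    exact ⟨rfl, hne⟩
  · rw [simpleRestrict, simpleRestrict, dif_neg hr, dif_neg hr]
    simp

theorem simpleRestrict_subdivision (f : StrongDual ℝ X) (r : ℝ) (P P₁ P₂ : OrientedPolyhedron X k)
    (h : P.IsSubdivision P₁ P₂) (g : G) :
    simpleRestrict f r P g = simpleRestrict f r P₁ g + simpleRestrict f r P₂ g := by
  have hmem : ∀ x, x ∈ P.carrier ↔ x ∈ P₁.carrier ∨ x ∈ P₂.carrier := fun x => by
    rw [h.carrier_eq, mem_union]
  -- if one part lies in `r ≤ f`, the other one contains everything in `f ≤ r`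
  have key : ∀ Q Q' : OrientedPolyhedron X k, (∀ x, x ∈ P.carrier ↔ x ∈ Q.carrier ∨ x ∈ Q'.carrier) →
      Q.orientation = P.orientation → (∃ a ∈ Q.carrier, f a < r) →
      (¬∃ a ∈ Q'.carrier, f a < r) → simpleRestrict f r P g = simpleRestrict f r Q g := by
    intro Q Q' hQ ho hr hr'
    push Not at hr'
    have hrP : ∃ a ∈ P.carrier, f a < r := by
      obtain ⟨a, ha, har⟩ := hr
      exact ⟨a, (hQ a).2 (Or.inl ha), har⟩
    rw [simpleRestrict, simpleRestrict, dif_pos hrP, dif_pos hr]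
    congr 2
    refine OrientedPolyhedron.ext (Subset.antisymm ?_ ?_) ho.symm
    · rintro x ⟨hx, hxr⟩
      refine ⟨?_, hxr⟩
      obtain ⟨a, ha, har⟩ := hr
      have hcont : Continuous fun t : ℝ => x + t • (a - x) := by fun_prop
      have ht : Filter.Tendsto (fun t : ℝ => x + t • (a - x)) (nhdsWithin 0 (Ioi 0)) (nhds x) := by
        have := (hcont.tendsto 0).mono_left (nhdsWithin_le_nhds (s := Ioi (0 : ℝ)))
        simpa using this
      refine Q.isPolyhedron.isClosed.mem_of_tendsto ht ?_
      filter_upwards [Ioo_mem_nhdsGT (zero_lt_one (α := ℝ))] with t ht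
      have hm := P.isPolyhedron.convex.add_smul_sub_mem hx ((hQ a).2 (Or.inl ha))
        ⟨ht.1.le, ht.2.le⟩
      refine ((hQ _).1 hm).resolve_right fun hm' => ?_
      have := hr' _ hm'
      simp only [map_add, map_smul, map_sub, smul_eq_mul] at this
      nlinarith [ht.1, ht.2]
    · rintro x ⟨hx, hxr⟩
      exact ⟨(hQ x).2 (Or.inl hx), hxr⟩
  by_cases h₁ : ∃ a ∈ P₁.carrier, f a < r <;> by_cases h₂ : ∃ a ∈ P₂.carrier, f a < r
  · have hP : ∃ a ∈ P.carrier, f a < r := by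
      obtain ⟨a, ha, har⟩ := h₁
      exact ⟨a, (hmem a).2 (Or.inl ha), har⟩
    rw [simpleRestrict, simpleRestrict, simpleRestrict, dif_pos hP, dif_pos h₁, dif_pos h₂]
    apply simple_subdivision
    refine ⟨?_, ?_, h.orientation_left, h.orientation_right⟩
    · ext x
      simp only [below, mem_ofPred_eq, mem_union, hmem]
      tauto
    · refine h.disjoint.mono ?_ ?_
      · exact intrinsicInterior_mono_of_affineSpan_eq (sep_subset _ _)
          (P₁.isPolyhedron.affineSpan_eq (P₁.below f r h₁).isPolyhedron (sep_subset _ _))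
      · exact intrinsicInterior_mono_of_affineSpan_eq (sep_subset _ _)
          (P₂.isPolyhedron.affineSpan_eq (P₂.below f r h₂).isPolyhedron (sep_subset _ _))
  · rw [key P₁ P₂ hmem h.orientation_left h₁ h₂]
    conv_rhs => rw [simpleRestrict, simpleRestrict, dif_neg h₂]
    rw [simpleRestrict]; simp
  · rw [key P₂ P₁ (fun x => (hmem x).trans or_comm) h.orientation_right h₂ h₁]
    conv_rhs => rw [simpleRestrict, simpleRestrict, dif_neg h₁]
    rw [simpleRestrict]; simp
  · have hP : ¬∃ a ∈ P.carrier, f a < r := by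
      rintro ⟨a, ha, har⟩
      rcases (hmem a).1 ha with ha | ha
      · exact h₁ ⟨a, ha, har⟩
      · exact h₂ ⟨a, ha, har⟩
    rw [simpleRestrict, simpleRestrict, simpleRestrict, dif_neg hP, dif_neg h₁, dif_neg h₂]
    simp

/-- The portion of a chain in the half-space `f < r`. -/
def restrict (f : StrongDual ℝ X) (r : ℝ) : PolyChain X G k →+ PolyChain X G k :=
  liftChain (simpleRestrict f r) (simpleRestrict_opposite f r) (simpleRestrict_subdivision f r)

/-- The slice `P ∩ f⁻¹(r) = ∂(P_r) - (∂P)_r`. -/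
def slice (f : StrongDual ℝ X) (r : ℝ) (P : PolyChain X G (k + 1)) : PolyChain X G k :=
  boundary (restrict f r P) - restrict f r (boundary P)

/-! ### Mass and flat norm -/

/-- A formal sum whose polyhedra are pairwise disjoint as open polyhedra. -/
def IsDisjointSum (c : OrientedPolyhedron X k →₀ G) : Prop :=
  (c.support : Set (OrientedPolyhedron X k)).Pairwise fun P Q =>
    Disjoint (intrinsicInterior ℝ P.carrier) (intrinsicInterior ℝ Q.carrier)

/-- The mass of a chain. It is the sum of the masses of the simple summands in a representation
with disjoint polyhedra; this does not depend on the representation, so it is taken as the infimum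
over all of them. The mass of a simple `0`-chain `g[x]` is `|g|`, and the mass of a simple chain
of positive dimension is the supremum of the integrals of the masses of its slices by the linear
functionals of norm one. -/
def mass : (k : ℕ) → PolyChain X G k → ℝ≥0∞
  | 0, P => ⨅ (c : OrientedPolyhedron X 0 →₀ G) (_ : IsDisjointSum c ∧ toChain c = P),
      c.sum fun _ g => ‖g‖ₑ
  | k + 1, P => ⨅ (c : OrientedPolyhedron X (k + 1) →₀ G) (_ : IsDisjointSum c ∧ toChain c = P),
      c.sum fun S g => ⨆ (f : StrongDual ℝ X) (_ : ‖f‖ = 1),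
        ∫⁻ r : ℝ, mass k (slice f r (simple S g))

/-- The flat norm. -/
def flatNorm (P : PolyChain X G k) : ℝ≥0∞ :=
  ⨅ Q : PolyChain X G (k + 1), mass (k + 1) Q + mass k (boundary Q - P)

end chains

end FlatChain

end

/-! Finiteness, symmetry and subadditivity of the flat norm follow from the same properties of the
mass. The work lies in understanding the recursively defined mass and in proving positivity.

The mass is made explicit first. `area k S` is the supremum of the Lebesgue measures of the images
of `S` under maps to `ℝᵏ` whose coordinates are functionals of norm one. Parallel sections of a
polyhedron share their directions, so supremum and integral can be exchanged, and Fubini's theorem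
gives the area the recursion that defines the mass (`area_succ`). Moreover any formal sum can be cut
along hyperplanes into a disjoint one without becoming heavier (`exists_isDisjointSum`). Hence the
mass is the infimum of `∑ ‖g‖ · area` over all representations, disjoint or not (`mass_eq`), and its
subadditivity is plain.

Lower bounds come from a degree. For a coordinate map to `ℝᵏ` and almost every `y`, the signed sum
of the coefficients of the polyhedra over `y` depends only on the chain (`degreeAt_congr`), and the
integral of its norm is at most the weight (`lintegral_degreeAt_le`). It vanishes on boundaries,
because a generic fibre is a line that enters a polyhedron through one facet and leaves it through
one (`degreeAt_facetSum`). So the integral of the degree of `P` is at most the mass of `∂Q - P` for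
every `Q`, that is, at most the flat norm (`lintegral_degreeAt_le_flatNorm`). A single polyhedron
with a nonzero coefficient thus has positive flat norm.

In a general chain the degrees of different polyhedra may cancel, so all polyhedra but one are
removed beforehand. If `F(P) = 0`, take fillings `Qₙ` with summable errors. For almost every `r` the
masses of their slices at `r` tend to zero, and `∂(Q_r) - P_r = Q ∩ f⁻¹(r) + (∂Q - P)_r` gives
`F(P_r) = 0` (`ae_flatNorm_restrict`). In a disjoint representation each polyhedron has a point
outside all the others. Half-spaces containing this point remove the others one at a time
(`eq_zero_of_flatNorm_add_sum`), and the coefficient of what remains must vanish. -/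

noncomputable section

open Set MeasureTheory
open scoped ENNReal

namespace FlatChain

variable {X : Type*} [NormedAddCommGroup X] [NormedSpace ℝ X]

/-! ### Coordinate maps and the area of polyhedra -/

section area

variable {k : ℕ}

/-- The map to `ℝᵏ` whose coordinates are the given functionals. -/
def coords (f : Fin k → StrongDual ℝ X) : X →L[ℝ] (Fin k → ℝ) := ContinuousLinearMap.pi f

@[simp]
theorem coords_apply (f : Fin k → StrongDual ℝ X) (x : X) (i : Fin k) : coords f x i = f i x := rfl

theorem vectorSpan_image_coords (f : Fin k → StrongDual ℝ X) (D : Set X) :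
    vectorSpan ℝ (coords f '' D) = (vectorSpan ℝ D).map (coords f : X →ₗ[ℝ] (Fin k → ℝ)) :=
  ((coords f : X →ₗ[ℝ] (Fin k → ℝ)).toAffineMap.map_vectorSpan (s := D)).symm

/-- The image lies in its affine span, a proper affine subspace of `ℝᵏ`, which is a null set. -/
theorem volume_image_coords_of_map_ne_top (f : Fin k → StrongDual ℝ X) {D : Set X}
    (hD : (vectorSpan ℝ D).map (coords f : X →ₗ[ℝ] (Fin k → ℝ)) ≠ ⊤) :
    volume (coords f '' D) = 0 := by
  refine measure_mono_null (subset_affineSpan ℝ _)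
    (Measure.addHaar_affineSubspace volume (affineSpan ℝ (coords f '' D)) fun htop => hD ?_)
  rw [← vectorSpan_image_coords, ← direction_affineSpan, htop, AffineSubspace.direction_top]

theorem volume_image_coords_of_finrank_lt (f : Fin k → StrongDual ℝ X) {D : Set X}
    [FiniteDimensional ℝ (vectorSpan ℝ D)] (hD : Module.finrank ℝ (vectorSpan ℝ D) < k) :
    volume (coords f '' D) = 0 := by
  refine volume_image_coords_of_map_ne_top f fun htop => ?_
  have h := Submodule.finrank_map_le (coords f : X →ₗ[ℝ] (Fin k → ℝ)) (vectorSpan ℝ D)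
  rw [htop, finrank_top, Module.finrank_fin_fun] at h
  omega

/-- The dual basis of `W`, extended by Hahn–Banach and normalized. Rescaling the coordinates keeps
the map injective on `W` and makes it one of the maps that compete in `area`. -/
theorem exists_coords_injective {W : Submodule ℝ X} [FiniteDimensional ℝ W]
    (hW : Module.finrank ℝ W = k) : ∃ f : Fin k → StrongDual ℝ X, (∀ i, ‖f i‖ = 1) ∧
      ∀ w ∈ W, coords f w = 0 → w = 0 := by
  let e := Module.finBasisOfFinrankEq ℝ W hW
  have hext : ∀ i, ∃ g : StrongDual ℝ X, ∀ w : W, g w = e.coord i w := fun i => by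
    obtain ⟨g, hg, -⟩ := exists_extension_norm_eq W (LinearMap.toContinuousLinearMap (e.coord i))
    exact ⟨g, hg⟩
  choose g hg using hext
  have hg0 : ∀ i, ‖g i‖ ≠ 0 := by
    intro i h0
    have h1 := hg i (e i)
    rw [norm_eq_zero.1 h0] at h1
    simp at h1
  refine ⟨fun i => ‖g i‖⁻¹ • g i, fun i => ?_, fun w hw h => ?_⟩
  · rw [norm_smul, norm_inv, norm_norm, inv_mul_cancel₀ (hg0 i)]
  · have h1 : (⟨w, hw⟩ : W) = 0 := by
      refine e.ext_elem fun i => ?_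
      have h2 := congrFun h i
      simp only [coords_apply, smul_apply, smul_eq_mul, Pi.zero_apply, mul_eq_zero,
        inv_eq_zero, hg0 i, false_or] at h2
      have h3 := hg i ⟨w, hw⟩
      simp only [h2, Module.Basis.coord_apply] at h3
      simpa using h3.symm
    simpa using congrArg Subtype.val h1

theorem coords_bijective {W : Submodule ℝ X} [FiniteDimensional ℝ W]
    (hW : Module.finrank ℝ W = k) {e : Fin k → StrongDual ℝ X}
    (he : ∀ w ∈ W, coords e w = 0 → w = 0) :
    Function.Bijective ((coords e : X →ₗ[ℝ] (Fin k → ℝ)).domRestrict W) := by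
  have hinj : Function.Injective ((coords e : X →ₗ[ℝ] (Fin k → ℝ)).domRestrict W) := by
    rw [injective_iff_map_eq_zero]
    intro w hw
    exact Subtype.ext (he w w.2 hw)
  exact ⟨hinj, (LinearMap.injective_iff_surjective_of_finrank_eq_finrank (by simp [hW])).1 hinj⟩

/-- The volumes of the images of subsets of a translate of a `k`-dimensional space under two
coordinate maps are proportional. -/
theorem exists_volume_image_coords_eq_mul {W : Submodule ℝ X} [FiniteDimensional ℝ W]
    (hW : Module.finrank ℝ W = k) {e : Fin k → StrongDual ℝ X}
    (he : ∀ w ∈ W, coords e w = 0 → w = 0) (f : Fin k → StrongDual ℝ X) :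
    ∃ κ : ℝ≥0∞, ∀ (x₀ : X) (T : Set X), (∀ x ∈ T, x - x₀ ∈ W) →
      volume (coords f '' T) = κ * volume (coords e '' T) := by
  let E := LinearEquiv.ofBijective _ (coords_bijective hW he)
  -- `L` is the change of coordinates from `e` to `f` along `W`. The factor is `|det L|`; the base
  -- point `x₀` contributes only a translation.
  let L : (Fin k → ℝ) →ₗ[ℝ] (Fin k → ℝ) :=
    (coords f : X →ₗ[ℝ] (Fin k → ℝ)) ∘ₗ W.subtype ∘ₗ (E.symm : (Fin k → ℝ) →ₗ[ℝ] W)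
  have hL : ∀ w ∈ W, L (coords e w) = coords f w := by
    intro w hw
    have : E ⟨w, hw⟩ = coords e w := rfl
    simp [L, ← this]
  refine ⟨ENNReal.ofReal |LinearMap.det L|, fun x₀ T hT => ?_⟩
  have h1 : coords f '' T = (fun y => (coords f x₀ - L (coords e x₀)) + y) '' (L '' (coords e '' T)) := by
    rw [image_image, image_image]
    refine image_congr fun x hx => ?_
    have := hL _ (hT x hx)
    rw [map_sub, map_sub, map_sub] at this
    change coords f x = coords f x₀ - L (coords e x₀) + L (coords e x)
    rw [sub_add_eq_add_sub, add_sub_assoc, this]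
    abel
  rw [h1, image_add_left, measure_preimage_add, Measure.addHaar_image_linearMap]

/-- The largest volume of an image in `ℝᵏ` under linear maps with coordinates of norm one. -/
def area (k : ℕ) (S : Set X) : ℝ≥0∞ :=
  ⨆ (f : Fin k → StrongDual ℝ X) (_ : ∀ i, ‖f i‖ = 1), volume (coords f '' S)

theorem le_area {f : Fin k → StrongDual ℝ X} (hf : ∀ i, ‖f i‖ = 1) (S : Set X) :
    volume (coords f '' S) ≤ area k S :=
  le_iSup₂ (f := fun (f : Fin k → StrongDual ℝ X) (_ : ∀ i, ‖f i‖ = 1) => volume (coords f '' S)) f hf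

theorem area_mono {S T : Set X} (h : S ⊆ T) : area k S ≤ area k T :=
  iSup₂_mono fun _ _ => measure_mono (image_mono h)

@[simp]
theorem area_empty : area k (∅ : Set X) = 0 := by simp [area]

/-- The volume of the one-point space `ℝ⁰` is one. This matches the mass `|g|` of `g[x]`. -/
theorem area_zero {S : Set X} (hS : S.Nonempty) : area 0 S = 1 := by
  have h : ∀ f : Fin 0 → StrongDual ℝ X, volume (coords f '' S) = 1 := by
    intro f
    rw [Subsingleton.eq_univ_of_nonempty (hS.image (coords f))]
    simp [volume_pi]
  refine le_antisymm (iSup₂_le fun f _ => (h f).le) ?_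
  rw [← h Fin.elim0]
  exact le_area (fun i => i.elim0) S

/-- Functionals of norm one map the ball of radius `R` into the sup-norm ball of radius `R` of `ℝᵏ`,
a bound that is uniform in `f`. -/
theorem area_ne_top {S : Set X} (hS : Bornology.IsBounded S) : area k S ≠ ⊤ := by
  obtain ⟨R, hR0, hR⟩ := hS.subset_closedBall_lt 0 0
  refine ne_top_of_le_ne_top (b := volume (Metric.closedBall (0 : Fin k → ℝ) R))
    (isCompact_closedBall _ _).measure_lt_top.ne (iSup₂_le fun f hf => measure_mono ?_)
  rintro _ ⟨x, hx, rfl⟩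
  rw [mem_closedBall_zero_iff, pi_norm_le_iff_of_nonneg hR0.le]
  intro i
  have := (f i).le_opNorm x
  rw [hf i, one_mul] at this
  exact this.trans (by simpa using hR hx)

/-- On subsets of the translates of a `k`-dimensional space the area is a multiple of the volume of
the image under any injective coordinate map. -/
theorem area_eq_mul {W : Submodule ℝ X} [FiniteDimensional ℝ W]
    (hW : Module.finrank ℝ W = k) {e : Fin k → StrongDual ℝ X}
    (he : ∀ w ∈ W, coords e w = 0 → w = 0) :
    ∃ κ : (Fin k → StrongDual ℝ X) → ℝ≥0∞, ∀ (x₀ : X) (T : Set X), (∀ x ∈ T, x - x₀ ∈ W) →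
      (∀ f, volume (coords f '' T) = κ f * volume (coords e '' T)) ∧
      area k T = (⨆ (f : Fin k → StrongDual ℝ X) (_ : ∀ i, ‖f i‖ = 1), κ f) *
        volume (coords e '' T) := by
  choose κ hκ using exists_volume_image_coords_eq_mul hW he
  refine ⟨κ, fun x₀ T hT => ⟨fun f => hκ f x₀ T hT, ?_⟩⟩
  simp only [area, ENNReal.iSup_mul]
  exact iSup_congr fun f => iSup_congr fun _ => hκ f x₀ T hT

/-! ### Images and sections of polyhedra: compactness, null sets, Fubini -/

namespace IsPolyhedron

variable {C : Set X}

/-- `X` may have infinite dimension, so the polyhedron is pulled back isometrically to its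
finite-dimensional space of directions, where closed bounded sets are compact. -/
theorem isCompact (hC : IsPolyhedron k C) : IsCompact C := by
  have := hC.finiteDimensional
  obtain ⟨x₀, hx₀⟩ := hC.nonempty
  let φ : vectorSpan ℝ C → X := fun v => (v : X) + x₀
  have hφ : Continuous φ := by fun_prop
  have himg : φ '' (φ ⁻¹' C) = C := by
    rw [image_preimage_eq_iff]
    intro x hx
    exact ⟨⟨x - x₀, vsub_mem_vectorSpan ℝ hx hx₀⟩, by simp [φ]⟩
  rw [← himg]
  refine IsCompact.image (Metric.isCompact_of_isClosed_isBounded (hC.isClosed.preimage hφ) ?_) hφ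
  have hiso : Isometry φ := (isometry_add_right x₀).comp isometry_subtype_coe
  exact hiso.antilipschitz.isBounded_preimage hC.bounded

theorem measurableSet_image (hC : IsPolyhedron k C) {n : ℕ} (f : Fin n → StrongDual ℝ X) :
    MeasurableSet (coords f '' C) :=
  (hC.isCompact.image (coords f).continuous).isClosed.measurableSet

/-- The image is convex and spans `ℝᵏ`, so it has interior points. -/
theorem volume_image_coords_pos (hC : IsPolyhedron k C) {e : Fin k → StrongDual ℝ X}
    (he : ∀ w ∈ vectorSpan ℝ C, coords e w = 0 → w = 0) : 0 < volume (coords e '' C) := by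
  have := hC.finiteDimensional
  have hconv : Convex ℝ (coords e '' C) := hC.convex.linear_image (coords e : X →ₗ[ℝ] (Fin k → ℝ))
  have hne : (interior (coords e '' C)).Nonempty := by
    rw [hconv.interior_nonempty_iff_affineSpan_eq_top,
      AffineSubspace.affineSpan_eq_top_iff_vectorSpan_eq_top_of_nonempty ℝ _ _
        (hC.nonempty.image _), vectorSpan_image_coords]
    have h := (coords_bijective hC.finrank_eq he).2
    rw [← LinearMap.range_eq_top, LinearMap.range_domRestrict] at h
    exact h
  exact (isOpen_interior.measure_pos volume hne).trans_le (measure_mono interior_subset)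

/-- The functional `h` kills the directions of `D` but not the direction `u` of `C`. Sets in which
pieces of a polyhedron overlap are shown to be negligible in this way. -/
theorem finrank_vectorSpan_lt (hC : IsPolyhedron k C) {D : Set X} (hDC : D ⊆ C)
    {h : StrongDual ℝ X} {c : ℝ} (hD : ∀ x ∈ D, h x = c) {u : X} (hu : u ∈ vectorSpan ℝ C)
    (hhu : h u ≠ 0) : Module.finrank ℝ (vectorSpan ℝ D) < k := by
  have := hC.finiteDimensional
  have hle : vectorSpan ℝ D ≤ LinearMap.ker (h : X →ₗ[ℝ] ℝ) := by
    rw [vectorSpan_def, Submodule.span_le]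
    rintro _ ⟨p, hp, q, hq, rfl⟩
    simp [hD p hp, hD q hq]
  rw [← hC.finrank_eq]
  exact Submodule.finrank_lt_finrank_of_lt
    (lt_of_le_of_ne (vectorSpan_mono ℝ hDC) fun heq => hhu (hle (heq ▸ hu)))

theorem volume_image_coords_subset (hC : IsPolyhedron k C) {D : Set X} (hDC : D ⊆ C) {n : ℕ}
    (f : Fin n → StrongDual ℝ X) (hD : Module.finrank ℝ (vectorSpan ℝ D) < n) :
    volume (coords f '' D) = 0 := by
  have := hC.finiteDimensional
  have := Submodule.finiteDimensional_of_le (vectorSpan_mono ℝ hDC)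
  exact volume_image_coords_of_finrank_lt f hD

theorem injOn_coords {n : ℕ} {f : Fin n → StrongDual ℝ X}
    (hf : ∀ w ∈ vectorSpan ℝ C, coords f w = 0 → w = 0) : InjOn (coords f) C := fun x hx y hy hxy =>
  sub_eq_zero.1 (hf _ (vsub_mem_vectorSpan ℝ hx hy) (by rw [map_sub, hxy, sub_self]))

/-- The area is additive when a hyperplane cuts a polyhedron. -/
theorem area_cut (hC : IsPolyhedron k C) {h : StrongDual ℝ X} {c : ℝ} {a b : X}
    (ha : a ∈ C) (hac : h a < c) (hb : b ∈ C) (hbc : c < h b) :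
    area k {x ∈ C | h x ≤ c} + area k {x ∈ C | c ≤ h x} = area k C := by
  have := hC.finiteDimensional
  obtain ⟨e, -, he⟩ := exists_coords_injective hC.finrank_eq
  obtain ⟨κ, hκ⟩ := area_eq_mul hC.finrank_eq he
  have hsub : ∀ T ⊆ C, ∀ x ∈ T, x - a ∈ vectorSpan ℝ C := fun T hT x hx =>
    vsub_mem_vectorSpan ℝ (hT hx) ha
  have hC₂ : IsPolyhedron k {x ∈ C | c ≤ h x} := by
    simpa using hC.cut (h := -h) (c := -c) hb (by simpa)
  rw [(hκ a C (hsub C subset_rfl)).2, (hκ a {x ∈ C | h x ≤ c} (hsub _ (sep_subset _ _))).2,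
    (hκ a {x ∈ C | c ≤ h x} (hsub _ (sep_subset _ _))).2, ← mul_add]
  congr 1
  have hinj : InjOn (coords e) C := injOn_coords he
  have hun : {x ∈ C | h x ≤ c} ∪ {x ∈ C | c ≤ h x} = C := by
    ext x
    simp only [mem_union, mem_ofPred_eq, ← and_or_left]
    exact ⟨fun hx => hx.1, fun hx => ⟨hx, le_total _ _⟩⟩
  -- The overlap lies in the cutting hyperplane. Injectivity of the coordinate map is what
  -- identifies the intersection of the images with the image of the overlap.
  have hnull : volume (coords e '' {x ∈ C | h x ≤ c} ∩ coords e '' {x ∈ C | c ≤ h x}) = 0 := by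
    rw [← hinj.image_inter (sep_subset _ _) (sep_subset _ _)]
    exact hC.volume_image_coords_subset (inter_subset_left.trans (sep_subset _ _)) e
      (hC.finrank_vectorSpan_lt (inter_subset_left.trans (sep_subset _ _))
        (fun x hx => le_antisymm hx.1.2 hx.2.2) (vsub_mem_vectorSpan ℝ hb ha)
        (by rw [vsub_eq_sub, map_sub]; linarith))
  have := measure_union_add_inter (μ := volume) (coords e '' {x ∈ C | h x ≤ c})
    (hC₂.measurableSet_image e)
  rw [hnull, add_zero, ← image_union, hun] at this
  exact this.symm

/-- Fubini's theorem for images under coordinate maps. -/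
theorem volume_image_coords_cons (hC : IsPolyhedron k C) {n : ℕ} (f : StrongDual ℝ X)
    (f' : Fin n → StrongDual ℝ X) :
    Measurable (fun r : ℝ => volume (coords f' '' {x ∈ C | f x = r})) ∧
    volume (coords (Fin.cons f f' : Fin (n + 1) → StrongDual ℝ X) '' C) =
      ∫⁻ r : ℝ, volume (coords f' '' {x ∈ C | f x = r}) := by
  let Φ := MeasurableEquiv.piFinSuccAbove (fun _ : Fin (n + 1) => ℝ) 0
  have hΦ := volume_preserving_piFinSuccAbove (fun _ : Fin (n + 1) => ℝ) 0
  set A := coords (Fin.cons f f' : Fin (n + 1) → StrongDual ℝ X) '' C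
  have hA : MeasurableSet (Φ.symm ⁻¹' A) := Φ.symm.measurable (hC.measurableSet_image _)
  have hsec : ∀ r : ℝ, Prod.mk r ⁻¹' (Φ.symm ⁻¹' A) = coords f' '' {x ∈ C | f x = r} := by
    intro r
    ext y
    simp only [mem_preimage, mem_image, A, mem_ofPred_eq]
    have hs : Φ.symm (r, y) = (Fin.cons r y : Fin (n + 1) → ℝ) := by
      change (Fin.insertNth 0 r y : Fin (n + 1) → ℝ) = _
      rw [Fin.insertNth_zero']
    refine exists_congr fun x => ?_
    rw [hs, and_assoc]
    refine and_congr_right fun _ => ?_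
    constructor
    · intro h
      refine ⟨by simpa using congrFun h 0, funext fun i => ?_⟩
      simpa using congrFun h i.succ
    · rintro ⟨h1, h2⟩
      funext i
      refine Fin.cases ?_ (fun j => ?_) i
      · simpa using h1
      · simpa using congrFun h2 j
  constructor
  · simp_rw [← hsec]
    exact measurable_measure_prodMk_left hA
  · simp_rw [← hsec]
    have h1 : volume A = volume (Φ.symm ⁻¹' A) :=
      ((hΦ.symm Φ).measure_preimage (hC.measurableSet_image _).nullMeasurableSet).symm
    rw [h1, Measure.volume_eq_prod]
    exact Measure.prod_apply hA

/-- The integral of the areas of the parallel sections of a polyhedron. -/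
theorem lintegral_area_section (hC : IsPolyhedron (k + 1) C) (f : StrongDual ℝ X) :
    AEMeasurable (fun r : ℝ => area k {x ∈ C | f x = r}) ∧
    ∫⁻ r : ℝ, area k {x ∈ C | f x = r} =
      ⨆ (f' : Fin k → StrongDual ℝ X) (_ : ∀ i, ‖f' i‖ = 1),
        volume (coords (Fin.cons f f' : Fin (k + 1) → StrongDual ℝ X) '' C) := by
  have := hC.finiteDimensional
  simp_rw [fun f' : Fin k → StrongDual ℝ X => (hC.volume_image_coords_cons f f').2]
  obtain ⟨a, ha⟩ := hC.nonempty
  -- If `f` is constant on `C`, only one level is nonempty and both sides vanish.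
  by_cases hconst : ∀ x ∈ C, f x = f a
  · have hemp : ∀ r : ℝ, r ≠ f a → {x ∈ C | f x = r} = ∅ := fun r hr =>
      eq_empty_of_forall_notMem fun x hx => hr (hx.2 ▸ hconst x hx.1)
    have hae : ∀ᵐ r : ℝ, r ≠ f a := by simp [ae_iff]
    have h0 : (fun r : ℝ => area k {x ∈ C | f x = r}) =ᵐ[volume] fun _ => 0 := by
      filter_upwards [hae] with r hr
      rw [hemp r hr, area_empty]
    have h1 : ∀ f' : Fin k → StrongDual ℝ X,
        (fun r : ℝ => volume (coords f' '' {x ∈ C | f x = r})) =ᵐ[volume] fun _ => 0 := by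
      intro f'
      filter_upwards [hae] with r hr
      rw [hemp r hr, image_empty, measure_empty]
    refine ⟨aemeasurable_const.congr h0.symm, ?_⟩
    rw [lintegral_congr_ae h0]
    simp_rw [fun f' => lintegral_congr_ae (h1 f')]
    simp
  · push Not at hconst
    obtain ⟨b, hb, hab⟩ := hconst
    -- All sections lie in translates of this one `k`-dimensional space. The ratios `κ f'` of image
    -- volumes therefore do not depend on the level `r`, and the supremum over `f'` leaves the
    -- integral as a constant.
    have hW : Module.finrank ℝ ↥(vectorSpan ℝ C ⊓ LinearMap.ker (f : X →ₗ[ℝ] ℝ)) = k := by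
      have key : ∀ a ∈ C, ∀ b ∈ C, f a < f b →
          Module.finrank ℝ ↥(vectorSpan ℝ C ⊓ LinearMap.ker (f : X →ₗ[ℝ] ℝ)) = k := by
        intro a ha b hb hab
        obtain ⟨c, hac, hcb⟩ := exists_between hab
        have hT := hC.hyperplane_section ha hac hb hcb
        rw [← hC.vectorSpan_level hT (sep_subset _ _) (fun x hx => hx.2) ha hac.ne, hT.finrank_eq]
      rcases lt_or_gt_of_ne hab with h | h
      · exact key b hb a ha h
      · exact key a ha b hb h
    obtain ⟨e, -, he⟩ := exists_coords_injective hW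
    obtain ⟨κ, hκ⟩ := area_eq_mul hW he
    have hsec : ∀ r : ℝ, ∃ x₀, ∀ x ∈ {x ∈ C | f x = r},
        x - x₀ ∈ vectorSpan ℝ C ⊓ LinearMap.ker (f : X →ₗ[ℝ] ℝ) := by
      intro r
      by_cases hne : ∃ x₀ ∈ C, f x₀ = r
      · obtain ⟨x₀, hx₀, hr⟩ := hne
        refine ⟨x₀, fun x hx => ⟨vsub_mem_vectorSpan ℝ hx.1 hx₀, ?_⟩⟩
        simp [hx.2, hr]
      · exact ⟨0, fun x hx => absurd ⟨x, hx.1, hx.2⟩ hne⟩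
    choose x₀ hx₀ using hsec
    have hm := (hC.volume_image_coords_cons f e).1
    have h1 : (fun r : ℝ => area k {x ∈ C | f x = r}) = fun r =>
        (⨆ (f' : Fin k → StrongDual ℝ X) (_ : ∀ i, ‖f' i‖ = 1), κ f') *
          volume (coords e '' {x ∈ C | f x = r}) := funext fun r => (hκ (x₀ r) _ (hx₀ r)).2
    have h2 : ∀ f' : Fin k → StrongDual ℝ X,
        ∫⁻ r : ℝ, volume (coords f' '' {x ∈ C | f x = r}) =
          κ f' * ∫⁻ r : ℝ, volume (coords e '' {x ∈ C | f x = r}) := fun f' => by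
      rw [← lintegral_const_mul _ hm]
      exact lintegral_congr fun r => (hκ (x₀ r) _ (hx₀ r)).1 f'
    rw [h1]
    refine ⟨(hm.const_mul _).aemeasurable, ?_⟩
    rw [lintegral_const_mul _ hm]
    simp_rw [ENNReal.iSup_mul]
    exact iSup_congr fun f' => iSup_congr fun _ => (h2 f').symm

end IsPolyhedron

/-- A `(k+1)`-tuple of functionals is a first one, which slices, and a `k`-tuple, which measures the
slices. This is the recursion in the definition of the mass. -/
theorem area_succ {C : Set X} (hC : IsPolyhedron (k + 1) C) :
    area (k + 1) C = ⨆ (f : StrongDual ℝ X) (_ : ‖f‖ = 1), ∫⁻ r : ℝ, area k {x ∈ C | f x = r} := by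
  simp_rw [fun f => (hC.lintegral_area_section f).2]
  refine le_antisymm (iSup₂_le fun f hf => ?_) (iSup₂_le fun f hf => iSup₂_le fun f' hf' => ?_)
  · refine le_iSup₂_of_le (f 0) (hf 0) (le_iSup₂_of_le (Fin.tail f) (fun i => hf _) ?_)
    rw [Fin.cons_self_tail]
  · refine le_area (fun i => ?_) C
    refine Fin.cases ?_ (fun j => ?_) i
    · simpa using hf
    · simpa using hf' j

end area

/-! ### The degree of a chain over a point -/

section degree

variable {G : Type*} [NormedAddCommGroup G] {k : ℕ}

open OrientedPolyhedron

/-- The pullback of the determinant under a coordinate map. -/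
def coordForm (f : Fin k → StrongDual ℝ X) : X [⋀^Fin k]→ₗ[ℝ] ℝ :=
  Matrix.detRowAlternating.compLinearMap (coords f : X →ₗ[ℝ] (Fin k → ℝ))

theorem coordForm_apply (f : Fin k → StrongDual ℝ X) (v : Fin k → X) :
    coordForm f v = Matrix.det (Matrix.of fun i j => f j (v i)) := rfl

/-- A form of top degree on `V` is determined by its value on one frame: subtracting the right
multiple of `ω` gives a form that is zero on a frame, hence zero on `V`. -/
theorem exists_form_eq_mul {V : Submodule ℝ X} [FiniteDimensional ℝ V]
    (hV : Module.finrank ℝ V = k) {ω : X [⋀^Fin k]→ₗ[ℝ] ℝ}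
    (hω : ∃ v, (∀ i, v i ∈ V) ∧ ω v ≠ 0) (η : X [⋀^Fin k]→ₗ[ℝ] ℝ) :
    ∃ κ : ℝ, ∀ v, (∀ i, v i ∈ V) → η v = κ * ω v := by
  obtain ⟨e, heV, he⟩ := exists_frame hV
  have h1 := form_ne_zero hV hω heV he
  refine ⟨η e / ω e, fun v hv => ?_⟩
  by_contra hcon
  have h3 : ∃ v, (∀ i, v i ∈ V) ∧ (η - (η e / ω e) • ω) v ≠ 0 :=
    ⟨v, hv, by simpa [sub_eq_zero] using hcon⟩
  refine form_ne_zero hV h3 heV he ?_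
  simp [h1]

open Classical in
/-- The sign with which a coordinate map preserves an orientation `o` of a subspace `V`; it is zero
if the map is not injective on `V`. -/
def orientSign (f : Fin k → StrongDual ℝ X) (V : Submodule ℝ X) (o : Set (Fin k → X)) : ℤ :=
  if ∃ v, (∀ i, v i ∈ V) ∧ coordForm f v ≠ 0 ∧ (0 < coordForm f v ↔ v ∈ o) then 1
  else if ∃ v, (∀ i, v i ∈ V) ∧ coordForm f v ≠ 0 then -1 else 0

/-- The working description of the sign: it is the sign of the factor between the coordinate
determinant and a form that defines the orientation. -/
theorem orientSign_eq {f : Fin k → StrongDual ℝ X} {V : Submodule ℝ X} {ω : X [⋀^Fin k]→ₗ[ℝ] ℝ}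
    (hω : ∃ v, (∀ i, v i ∈ V) ∧ ω v ≠ 0) {κ : ℝ}
    (hκ : ∀ v, (∀ i, v i ∈ V) → coordForm f v = κ * ω v) :
    orientSign f V {v | (∀ i, v i ∈ V) ∧ 0 < ω v} = SignType.sign κ := by
  obtain ⟨v₀, hv₀, h0⟩ := hω
  rcases lt_trichotomy κ 0 with h | h | h
  · rw [orientSign, if_neg, if_pos, sign_neg h]
    · rfl
    · exact ⟨v₀, hv₀, by rw [hκ v₀ hv₀]; exact mul_ne_zero h.ne h0⟩
    · rintro ⟨v, hv, hne, hiff⟩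
      rw [hκ v hv] at hne hiff
      simp only [mem_ofPred_eq, hv, implies_true, true_and] at hiff
      rcases lt_or_gt_of_ne (right_ne_zero_of_mul hne) with h1 | h1
      · exact absurd (hiff.1 (mul_pos_of_neg_of_neg h h1)) (by linarith)
      · exact absurd (hiff.2 h1) (by nlinarith)
  · subst h
    rw [orientSign, if_neg, if_neg, sign_zero]
    · rfl
    · rintro ⟨v, hv, hne⟩
      exact hne (by rw [hκ v hv, zero_mul])
    · rintro ⟨v, hv, hne, -⟩
      exact hne (by rw [hκ v hv, zero_mul])
  · rw [orientSign, if_pos, sign_pos h]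
    · rfl
    · refine ⟨v₀, hv₀, by rw [hκ v₀ hv₀]; exact mul_ne_zero h.ne' h0, ?_⟩
      rw [hκ v₀ hv₀]
      simp [hv₀, mul_pos_iff_of_pos_left h]

theorem orientSign_opposite (f : Fin k → StrongDual ℝ X) {V : Submodule ℝ X}
    [FiniteDimensional ℝ V] (hV : Module.finrank ℝ V = k) {o o' : Set (Fin k → X)}
    (ho : IsOrientation V o) (ho' : IsOrientation V o') (hne : o ≠ o') :
    orientSign f V o' = -orientSign f V o := by
  obtain ⟨ω, hω, rfl, rfl⟩ := ho.exists_opposite hV ho' hne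
  obtain ⟨κ, hκ⟩ := exists_form_eq_mul hV hω (coordForm f)
  rw [orientSign_eq hω hκ, orientSign_eq (κ := -κ) (by simpa using hω) (by simpa using hκ),
    Left.sign_neg]
  simp

theorem enorm_orientSign_smul_le (f : Fin k → StrongDual ℝ X) (V : Submodule ℝ X)
    (o : Set (Fin k → X)) (g : G) : ‖orientSign f V o • g‖ₑ ≤ ‖g‖ₑ := by
  unfold orientSign
  split_ifs <;> simp

open Classical in
/-- The sum of the coefficients, with signs, of the polyhedra whose image under a coordinate map
contains a given point. -/
def degreeAt (f : Fin k → StrongDual ℝ X) (y : Fin k → ℝ) : (OrientedPolyhedron X k →₀ G) →+ G :=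
  Finsupp.liftAddHom fun S => if y ∈ coords f '' S.carrier then
    zsmulAddGroupHom (orientSign f (vectorSpan ℝ S.carrier) S.orientation) else 0

open Classical in
theorem degreeAt_single (f : Fin k → StrongDual ℝ X) (y : Fin k → ℝ) (S : OrientedPolyhedron X k)
    (g : G) : degreeAt f y (Finsupp.single S g) = if y ∈ coords f '' S.carrier then
      orientSign f (vectorSpan ℝ S.carrier) S.orientation • g else 0 := by
  rw [degreeAt, Finsupp.liftAddHom_apply_single]
  split_ifs <;> rfl

theorem degreeAt_single_of_notMem {f : Fin k → StrongDual ℝ X} {y : Fin k → ℝ}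
    {S : OrientedPolyhedron X k} (hy : y ∉ coords f '' S.carrier) (g : G) :
    degreeAt f y (Finsupp.single S g) = 0 := by
  classical
  rw [degreeAt_single, if_neg hy]

/-- If the coordinate map is injective on the plane of `P`, the images of the two parts overlap in a
null set and the parts carry the sign of `P`; a point outside the overlap is counted equally on both
sides. If it is not injective, the image of `P` is null. -/
theorem degreeAt_subdivision (f : Fin k → StrongDual ℝ X) {P P₁ P₂ : OrientedPolyhedron X k}
    (h : P.IsSubdivision P₁ P₂) (g : G) : ∀ᵐ y, degreeAt f y (Finsupp.single P g) =
      degreeAt f y (Finsupp.single P₁ g) + degreeAt f y (Finsupp.single P₂ g) := by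
  classical
  have hC := P.isPolyhedron
  have := hC.finiteDimensional
  have hs₁ : P₁.carrier ⊆ P.carrier := h.carrier_eq ▸ subset_union_left
  have hs₂ : P₂.carrier ⊆ P.carrier := h.carrier_eq ▸ subset_union_right
  by_cases hinj : ∀ w ∈ vectorSpan ℝ P.carrier, coords f w = 0 → w = 0
  · obtain ⟨l, c, h₁, h₂, ⟨a, ha, hac⟩, b, hb, hbc⟩ := exists_cut hC P₁.isPolyhedron
      P₂.isPolyhedron h.carrier_eq h.disjoint
    have hnull : volume (coords f '' (P₁.carrier ∩ P₂.carrier)) = 0 := by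
      refine hC.volume_image_coords_subset (inter_subset_left.trans hs₁) f
        (hC.finrank_vectorSpan_lt (h := l) (c := c) (inter_subset_left.trans hs₁) ?_
          (vsub_mem_vectorSpan ℝ hb ha) (by rw [vsub_eq_sub, map_sub]; linarith))
      rintro x ⟨hx₁, hx₂⟩
      rw [h₁] at hx₁
      rw [h₂] at hx₂
      exact le_antisymm hx₁.2 hx₂.2
    filter_upwards [measure_eq_zero_iff_ae_notMem.1 hnull] with y hy
    rw [(IsPolyhedron.injOn_coords hinj).image_inter hs₁ hs₂] at hy
    rw [degreeAt_single, degreeAt_single, degreeAt_single, h.orientation_left,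
      h.orientation_right, hC.vectorSpan_eq P₁.isPolyhedron hs₁,
      hC.vectorSpan_eq P₂.isPolyhedron hs₂, h.carrier_eq, image_union]
    by_cases hy₁ : y ∈ coords f '' P₁.carrier <;> by_cases hy₂ : y ∈ coords f '' P₂.carrier
    · exact absurd ⟨hy₁, hy₂⟩ hy
    all_goals simp only [mem_union, hy₁, hy₂, or_true, true_or, or_self, if_true, if_false,
      add_zero, zero_add]
  · have hnull : volume (coords f '' P.carrier) = 0 := by
      refine volume_image_coords_of_map_ne_top f fun htop => hinj ?_
      have hsurj : Function.Surjective ((coords f : X →ₗ[ℝ] (Fin k → ℝ)).domRestrict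
          (vectorSpan ℝ P.carrier)) := by
        rw [← LinearMap.range_eq_top, LinearMap.range_domRestrict, htop]
      have := (LinearMap.injective_iff_surjective_of_finrank_eq_finrank
        (by simp [hC.finrank_eq])).2 hsurj
      intro w hw hw0
      have h1 := (injective_iff_map_eq_zero _).1 this ⟨w, hw⟩ hw0
      simpa using congrArg Subtype.val h1
    filter_upwards [measure_eq_zero_iff_ae_notMem.1 hnull] with y hy
    rw [degreeAt_single_of_notMem hy, degreeAt_single_of_notMem fun h => hy (image_mono hs₁ h),
      degreeAt_single_of_notMem fun h => hy (image_mono hs₂ h), add_zero]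

/-- It suffices to check the generators. Opposite polyhedra have opposite signs, and subdivisions
respect the degree off a null set, so the degree is an almost everywhere invariant of the chain. -/
theorem degreeAt_relations (f : Fin k → StrongDual ℝ X) {z : OrientedPolyhedron X k →₀ G}
    (hz : z ∈ relations X G k) : ∀ᵐ y, degreeAt f y z = 0 := by
  classical
  induction hz using AddSubgroup.closure_induction with
  | mem z hz =>
    rcases hz with ⟨P, P', g, ⟨hc, ho⟩, rfl⟩ | ⟨P, P₁, P₂, g, h, rfl⟩
    · have := P.isPolyhedron.finiteDimensional
      have h1 := orientSign_opposite f P.isPolyhedron.finrank_eq P.isOrientation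
        (hc ▸ P'.isOrientation) ho
      refine Filter.Eventually.of_forall fun y => ?_
      rw [map_sub, degreeAt_single, degreeAt_single, ← hc, h1]
      split_ifs <;> simp
    · filter_upwards [degreeAt_subdivision f h g] with y hy
      rw [map_sub, map_add, hy, sub_self]
  | zero => simp
  | add x y _ _ hx hy =>
    filter_upwards [hx, hy] with t h1 h2
    rw [map_add, h1, h2, add_zero]
  | neg x _ hx =>
    filter_upwards [hx] with t h1
    rw [map_neg, h1, neg_zero]

theorem degreeAt_congr (f : Fin k → StrongDual ℝ X) {c d : OrientedPolyhedron X k →₀ G}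
    (h : (toChain c : PolyChain X G k) = toChain d) : ∀ᵐ y, degreeAt f y c = degreeAt f y d := by
  have h1 : c - d ∈ relations X G k := by
    rw [← QuotientAddGroup.eq_zero_iff]
    change toChain (c - d) = 0
    rw [map_sub, h, sub_self]
  filter_upwards [degreeAt_relations f h1] with y hy
  rwa [map_sub, sub_eq_zero] at hy

/-- The sum of the areas of the polyhedra in a formal sum, weighted by the coefficients. -/
def weight (c : OrientedPolyhedron X k →₀ G) : ℝ≥0∞ := c.sum fun S g => ‖g‖ₑ * area k S.carrier

/-- The norm of the degree is at most the sum of the `‖c S‖` over the polyhedra whose image contains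
the point. Integrating gives image volumes, which are bounded by areas. -/
theorem lintegral_degreeAt_le {f : Fin k → StrongDual ℝ X} (hf : ∀ i, ‖f i‖ = 1)
    (c : OrientedPolyhedron X k →₀ G) : ∫⁻ y, ‖degreeAt f y c‖ₑ ≤ weight c := by
  classical
  have h1 : ∀ y, ‖degreeAt f y c‖ₑ ≤
      ∑ S ∈ c.support, (coords f '' S.carrier).indicator (fun _ => ‖c S‖ₑ) y := by
    intro y
    have : degreeAt f y c = ∑ S ∈ c.support, degreeAt f y (Finsupp.single S (c S)) := by
      conv_lhs => rw [← Finsupp.sum_single c, Finsupp.sum, map_sum]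
    rw [this]
    refine (enorm_sum_le _ _).trans (Finset.sum_le_sum fun S _ => ?_)
    rw [degreeAt_single, indicator_apply]
    split_ifs
    · exact enorm_orientSign_smul_le _ _ _ _
    · simp
  refine (lintegral_mono h1).trans ?_
  rw [lintegral_finsetSum _ fun S _ =>
    measurable_const.indicator (S.isPolyhedron.measurableSet_image f)]
  refine Finset.sum_le_sum fun S _ => ?_
  rw [lintegral_indicator_const (S.isPolyhedron.measurableSet_image f)]
  exact mul_le_mul' le_rfl (le_area hf _)

end degree

/-! ### The degree of a boundary -/

section boundary

variable {G : Type*} [NormedAddCommGroup G] {k : ℕ}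

open OrientedPolyhedron

/-- The first row of the determinant is `(1, 0, …, 0)`. -/
theorem coordForm_cons (l : StrongDual ℝ X) (f : Fin k → StrongDual ℝ X) {u : X} (hl : l u = 1)
    (hf : coords f u = 0) (v : Fin k → X) :
    coordForm (Fin.cons l f : Fin (k + 1) → StrongDual ℝ X) (Matrix.vecCons u v) =
      coordForm f v := by
  rw [coordForm_apply, coordForm_apply, Matrix.det_succ_row_zero, Fin.sum_univ_succ]
  have h0 : ∀ j : Fin k, f j u = 0 := fun j => congrFun hf j
  simp [h0, hl, Matrix.submatrix]

/-- A `(k+1)`-form vanishes on vectors of the `k`-dimensional space `W`, so against frames of `W`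
the first argument matters only modulo `W`. -/
theorem curryLeft_eq_of_sub_mem {W : Submodule ℝ X} [FiniteDimensional ℝ W]
    (hW : Module.finrank ℝ W = k) (ω : X [⋀^Fin (k + 1)]→ₗ[ℝ] ℝ) {u w : X} {a : ℝ}
    (h : w - a • u ∈ W) {v : Fin k → X} (hv : ∀ i, v i ∈ W) :
    ω.curryLeft w v = a * ω.curryLeft u v := by
  have h2 : ω.curryLeft (w - a • u) v = 0 := by
    rw [AlternatingMap.curryLeft_apply_apply]
    refine form_eq_zero hW ω fun i => ?_
    refine Fin.cases ?_ (fun j => ?_) i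
    · simpa using h
    · simpa using hv j
  rwa [map_sub, map_smul, AlternatingMap.sub_apply, AlternatingMap.smul_apply, smul_eq_mul,
    sub_eq_zero] at h2

/-- The sign of a facet under a coordinate map with kernel spanned by `u` depends on the side of
the facet to which `u` points. -/
theorem orientSign_facet {C F : Set X} (hC : IsPolyhedron (k + 1) C) (hF : IsFacet k C F)
    {l : StrongDual ℝ X} {m : ℝ} (hFl : F = {x ∈ C | l x = m}) (hm : ∀ x ∈ C, l x ≤ m)
    {f : Fin k → StrongDual ℝ X} {u : X} (hu : u ∈ vectorSpan ℝ C)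
    {ω : X [⋀^Fin (k + 1)]→ₗ[ℝ] ℝ} (hω : ∃ v, (∀ i, v i ∈ vectorSpan ℝ C) ∧ ω v ≠ 0) {κ : ℝ}
    (hκ : ∀ v, (∀ i, v i ∈ vectorSpan ℝ C) → coordForm f v = κ * ω.curryLeft u v) :
    orientSign f (vectorSpan ℝ F)
      (inducedOrientation {v | (∀ i, v i ∈ vectorSpan ℝ C) ∧ 0 < ω v} C F) =
        SignType.sign κ * SignType.sign (l u) := by
  have := hF.2.finiteDimensional
  obtain ⟨x₀, hx₀, y₀, hy₀⟩ := hF.exists_mem_diff hC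
  have hlx : l x₀ = m := (hFl ▸ hx₀ : x₀ ∈ {x ∈ C | l x = m}).2
  have hly : l y₀ < m := lt_of_le_of_ne (hm y₀ hy₀.1) fun h => hy₀.2 (by rw [hFl]; exact ⟨hy₀.1, h⟩)
  have hspan := hC.vectorSpan_level hF.2 hF.subset
    (fun x hx => (hFl ▸ hx : x ∈ {x ∈ C | l x = m}).2) hy₀.1 hly.ne
  have hw : x₀ - y₀ ∈ vectorSpan ℝ C := vsub_mem_vectorSpan ℝ (hF.subset hx₀) hy₀.1
  have hlw : 0 < l (x₀ - y₀) := by rw [map_sub]; linarith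
  have hle := vectorSpan_mono ℝ hF.subset
  -- Modulo the directions of `F`, `u` is the outward vector `x₀ - y₀` times `l u / l (x₀ - y₀)`, a
  -- factor with the sign of `l u`.
  rw [inducedOrientation_eq hC hF ω hx₀ hy₀,
    orientSign_eq (κ := κ * (l u / l (x₀ - y₀))) (curryLeft_ne_zero hC hF hω hx₀ hy₀), sign_mul,
    div_eq_mul_inv, sign_mul, sign_pos (inv_pos.2 hlw), mul_one]
  · simp
  · intro v hv
    rw [hκ v fun i => hle (hv i), mul_assoc]
    congr 1
    refine curryLeft_eq_of_sub_mem hF.2.finrank_eq ω ?_ hv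
    rw [hspan]
    refine ⟨Submodule.sub_mem _ hu (Submodule.smul_mem _ _ hw), ?_⟩
    change l (u - (l u / l (x₀ - y₀)) • (x₀ - y₀)) = 0
    rw [map_sub, map_smul, smul_eq_mul, div_mul_cancel₀ _ hlw.ne', sub_self]

/-- The line in direction `u` through a generic point of a polyhedron leaves it through exactly one
facet. -/
theorem existsUnique_exit_facet {C : Set X} (hC : IsPolyhedron (k + 1) C)
    {l : Set X → StrongDual ℝ X} {m : Set X → ℝ}
    (hl : ∀ F, IsFacet k C F → F = {x ∈ C | l F x = m F} ∧ (∀ x ∈ C, l F x ≤ m F) ∧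
      ∃ y ∈ C, l F y < m F)
    {f : Fin k → StrongDual ℝ X} {u : X} (hu : u ∈ vectorSpan ℝ C) (hu0 : u ≠ 0)
    (hfu : coords f u = 0) (hker : ∀ w ∈ vectorSpan ℝ C, coords f w = 0 → ∃ t : ℝ, w = t • u) :
    ∀ᵐ y, y ∈ coords f '' C →
      ∃! F, IsFacet k C F ∧ 0 < l F u ∧ y ∈ coords f '' F := by
  obtain ⟨s, hs⟩ := hC.halfSpaces
  have hfin := IsFacet.finite hC
  have hmem : ∀ F, IsFacet k C F → ∀ x, x ∈ F ↔ x ∈ C ∧ l F x = m F := fun F hF x => by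
    have := Set.ext_iff.1 (hl F hF).1 x
    exact this
  -- Two different facets meet in dimension less than `k`. Points over such intersections are
  -- discarded; this gives uniqueness.
  have hN₁ : ∀ᵐ y, ∀ F ∈ {F | IsFacet k C F}, ∀ F' ∈ {F | IsFacet k C F}, F ≠ F' →
      y ∉ coords f '' (F ∩ F') := by
    rw [ae_ball_iff hfin.countable]
    intro F hF
    rw [ae_ball_iff hfin.countable]
    intro F' hF'
    have hF : IsFacet k C F := hF
    have hF' : IsFacet k C F' := hF'
    by_cases hne : F = F'
    · simp [hne]
    rcases (F ∩ F').eq_empty_or_nonempty with hem | ⟨x', hx'⟩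
    · simp [hem]
    have hnc : ∃ x ∈ F, l F' x ≠ m F' := by
      by_contra! hcon
      obtain ⟨h1, -, z, hz, hzm⟩ := hl F' hF'
      exact hne ((hF.eq_level hC hcon hz hzm.ne).trans h1.symm)
    obtain ⟨x, hx, hxm⟩ := hnc
    have hx'm := ((hmem F' hF' x').1 hx'.2).2
    have hnull : volume (coords f '' (F ∩ F')) = 0 :=
      hF.2.volume_image_coords_subset inter_subset_left f
        (hF.2.finrank_vectorSpan_lt (h := l F') (c := m F') inter_subset_left
          (fun z hz => ((hmem F' hF' z).1 hz.2).2) (vsub_mem_vectorSpan ℝ hx hx'.1)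
          (by rw [vsub_eq_sub, map_sub, hx'm]; exact sub_ne_zero.2 hxm))
    filter_upwards [measure_eq_zero_iff_ae_notMem.1 hnull] with y hy _ using hy
  -- Points over faces of dimension less than `k` cut out by a single constraint are discarded too;
  -- this ensures that the constraint which stops the line defines a facet.
  have hN₂ : ∀ᵐ y, ∀ p ∈ (s : Set (StrongDual ℝ X × ℝ)),
      Module.finrank ℝ (vectorSpan ℝ {x ∈ C | p.1 x = p.2}) < k →
      y ∉ coords f '' {x ∈ C | p.1 x = p.2} := by
    rw [ae_ball_iff s.countable_toSet]
    intro p hp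
    by_cases hlt : Module.finrank ℝ (vectorSpan ℝ {x ∈ C | p.1 x = p.2}) < k
    · filter_upwards [measure_eq_zero_iff_ae_notMem.1
        (hC.volume_image_coords_subset (sep_subset _ _) f hlt)] with y hy _ using hy
    · simp [hlt]
  filter_upwards [hN₁, hN₂] with y hy₁ hy₂ hyC
  -- the last point of the fibre
  obtain ⟨lam, hlam⟩ := SeparatingDual.exists_eq_one (R := ℝ) hu0
  have hZ : IsCompact (C ∩ coords f ⁻¹' {y}) :=
    hC.isCompact.inter_right (isClosed_singleton.preimage (coords f).continuous)
  obtain ⟨x₀, hx₀, hx₀y⟩ := hyC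
  obtain ⟨b, ⟨hb, hby⟩, hbmax⟩ := hZ.exists_isMaxOn ⟨x₀, hx₀, hx₀y⟩ lam.continuous.continuousOn
  have hby : coords f b = y := hby
  have hfib : ∀ z ∈ C, coords f z = y → ∃ t : ℝ, t ≤ 0 ∧ z = b + t • u := by
    intro z hz hzy
    obtain ⟨t, ht⟩ := hker (z - b) (vsub_mem_vectorSpan ℝ hz hb) (by rw [map_sub, hzy, hby, sub_self])
    have h1 : lam z ≤ lam b := hbmax ⟨hz, hzy⟩
    have h2 := congrArg lam ht
    rw [map_sub, map_smul, hlam, smul_eq_mul, mul_one] at h2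
    exact ⟨t, by linarith, by rw [← ht]; abel⟩
  -- The fibre runs backwards from `b`, and `l F` increases along `u`, so its maximum on `C`, once
  -- reached on the fibre, is also attained at `b`.
  have hexit : ∀ F, IsFacet k C F → 0 < l F u → y ∈ coords f '' F → b ∈ F := by
    rintro F hF hFu ⟨z, hz, hzy⟩
    obtain ⟨t, ht, rfl⟩ := hfib z (hF.subset hz) hzy
    have h1 := ((hmem F hF _).1 hz).2
    have h2 := (hl F hF).2.1 b hb
    rw [map_add, map_smul, smul_eq_mul] at h1
    exact (hmem F hF b).2 ⟨hb, le_antisymm h2 (by nlinarith)⟩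
  -- If no active constraint increased along `u`, the point `b + ε • u` would still lie in `C` for a
  -- small `ε > 0`, against the maximality of `b`.
  have hact : ∃ p ∈ s, p.1 b = p.2 ∧ 0 < p.1 u := by
    by_contra! hcon
    have hle : ∀ p ∈ s, p.1 b ≤ p.2 := by
      have hb' := hb
      rw [hs] at hb'
      exact hb'.2
    have hev : ∀ᶠ ε in nhdsWithin (0 : ℝ) (Ioi 0), ∀ p ∈ s, p.1 (b + ε • u) ≤ p.2 := by
      rw [Filter.eventually_all_finset]
      intro p hp
      rcases (hle p hp).lt_or_eq with h1 | h1
      · have hcont : Continuous fun ε : ℝ => p.1 (b + ε • u) := by fun_prop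
        have h2 : ∀ᶠ ε in nhds (0 : ℝ), p.1 (b + ε • u) < p.2 :=
          hcont.continuousAt.eventually_lt continuousAt_const (by simpa using h1)
        exact (h2.filter_mono nhdsWithin_le_nhds).mono fun _ h => h.le
      · filter_upwards [self_mem_nhdsWithin] with ε hε
        have hε : 0 < ε := hε
        rw [map_add, map_smul, smul_eq_mul, h1]
        nlinarith [hcon p hp h1]
    obtain ⟨ε, hε, hεpos⟩ := (hev.and self_mem_nhdsWithin).exists
    have hεpos : 0 < ε := hεpos
    have hmemC : b + ε • u ∈ C := by
      rw [hs]
      refine ⟨?_, hε⟩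
      rw [add_comm]
      refine AffineSubspace.vadd_mem_of_mem_direction ?_ (subset_affineSpan ℝ _ hb)
      rw [direction_affineSpan]
      exact Submodule.smul_mem _ _ hu
    have h1 : lam (b + ε • u) ≤ lam b := hbmax ⟨hmemC, by simp [hby, hfu]⟩
    rw [map_add, map_smul, hlam, smul_eq_mul] at h1
    linarith
  obtain ⟨p, hp, hpb, hpu⟩ := hact
  have hbE : b ∈ {x ∈ C | p.1 x = p.2} := ⟨hb, hpb⟩
  have hE : IsFacet k C {x ∈ C | p.1 x = p.2} := by
    refine IsFacet.of_level hC (fun x hx => ?_) ⟨b, hbE⟩ (le_antisymm ?_ ?_)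
    · rw [hs] at hx
      exact hx.2 p hp
    · exact Nat.lt_succ_iff.1
        (hC.finrank_vectorSpan_lt (sep_subset _ _) (fun x hx => hx.2) hu hpu.ne')
    · by_contra! hlt
      exact hy₂ p hp hlt ⟨b, hbE, hby⟩
  refine ⟨{x ∈ C | p.1 x = p.2}, ⟨hE, ?_, b, hbE, hby⟩, ?_⟩
  · obtain ⟨h1, h2, z, hz, hzm⟩ := hl _ hE
    set F := {x ∈ C | p.1 x = p.2} with hFdef
    have hzF : z ∉ F := fun h => hzm.ne ((hmem F hE z).1 h).2
    have hzp : p.1 z < p.2 := by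
      have hz' := hz
      rw [hs] at hz'
      exact lt_of_le_of_ne (hz'.2 p hp) fun h => hzF ⟨hz, h⟩
    have hlb := ((hmem F hE b).1 hbE).2
    have e₁ := hC.vectorSpan_level hE.2 hE.subset (fun x hx => hx.2) hz hzp.ne
    have e₂ := hC.vectorSpan_level hE.2 hE.subset (fun x hx => ((hmem F hE x).1 hx).2) hz hzm.ne
    have hzb : z - b ∈ vectorSpan ℝ C := vsub_mem_vectorSpan ℝ hz hb
    -- On the directions of `C`, the functionals `p.1` and `l F` both have the directions of `F` as
    -- kernel, and both are smaller at `z` than on `F`. Hence they have the same sign at `u`.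
    have hv : (z - b) - (p.1 (z - b) / p.1 u) • u ∈ vectorSpan ℝ F := by
      rw [e₁]
      refine ⟨Submodule.sub_mem _ hzb (Submodule.smul_mem _ _ hu), ?_⟩
      change p.1 ((z - b) - (p.1 (z - b) / p.1 u) • u) = 0
      rw [map_sub p.1 (z - b), map_smul, smul_eq_mul, div_mul_cancel₀ _ hpu.ne', sub_self]
    rw [e₂] at hv
    have h3 : l F ((z - b) - (p.1 (z - b) / p.1 u) • u) = 0 := hv.2
    rw [map_sub (l F) (z - b), map_smul, smul_eq_mul, map_sub, hlb] at h3
    have h4 : p.1 (z - b) / p.1 u < 0 := div_neg_of_neg_of_pos (by rw [map_sub]; linarith) hpu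
    nlinarith
  · rintro F ⟨hF, hFu, hFy⟩
    by_contra hne
    exact hy₁ F hF _ hE hne ⟨b, ⟨hexit F hF hFu hFy, hbE⟩, hby⟩

/-- The boundary of a formal sum. -/
def facetSum : (OrientedPolyhedron X (k + 1) →₀ G) →+ (OrientedPolyhedron X k →₀ G) :=
  Finsupp.liftAddHom fun S => ∑ F ∈ S.facets_finite.toFinset, Finsupp.singleAddHom F

theorem facetSum_single (S : OrientedPolyhedron X (k + 1)) (g : G) :
    facetSum (Finsupp.single S g) = ∑ F ∈ S.facets_finite.toFinset, Finsupp.single F g := by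
  rw [facetSum, Finsupp.liftAddHom_apply_single, AddMonoidHom.finsetSum_apply]
  rfl

theorem liftChain_simple {A : Type*} [AddCommGroup A] (φ : OrientedPolyhedron X k → G →+ A)
    (hopp : ∀ P P', P.IsOpposite P' → ∀ g, φ P g + φ P' g = 0)
    (hsub : ∀ P P₁ P₂, P.IsSubdivision P₁ P₂ → ∀ g, φ P g = φ P₁ g + φ P₂ g)
    (S : OrientedPolyhedron X k) (g : G) : liftChain φ hopp hsub (simple S g) = φ S g :=
  Finsupp.liftAddHom_apply_single φ S g

theorem toChain_single (S : OrientedPolyhedron X k) (g : G) :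
    toChain (Finsupp.single S g) = simple S g := rfl

theorem boundary_simple (S : OrientedPolyhedron X (k + 1)) (g : G) :
    boundary (simple S g) = simpleBoundary S g := liftChain_simple _ _ _ S g

theorem restrict_simple (f : StrongDual ℝ X) (r : ℝ) (S : OrientedPolyhedron X k) (g : G) :
    restrict f r (simple S g) = simpleRestrict f r S g := liftChain_simple _ _ _ S g

theorem toChain_facetSum (c : OrientedPolyhedron X (k + 1) →₀ G) :
    (toChain (facetSum c) : PolyChain X G k) = boundary (toChain c) := by
  induction c using Finsupp.induction_linear with
  | zero => simp
  | add c d hc hd => simp only [map_add, hc, hd]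
  | single S g =>
    rw [facetSum_single, toChain_single, boundary_simple, simpleBoundary, map_sum,
      AddMonoidHom.finsetSum_apply]
    rfl

/-- Almost every fibre has degree zero in a boundary. -/
theorem degreeAt_facetSum (f : Fin k → StrongDual ℝ X) (c : OrientedPolyhedron X (k + 1) →₀ G) :
    ∀ᵐ y, degreeAt f y (facetSum c) = 0 := by
  classical
  induction c using Finsupp.induction_linear with
  | zero => simp
  | add c d hc hd =>
    filter_upwards [hc, hd] with y h1 h2
    rw [map_add, map_add, h1, h2, add_zero]
  | single S g =>
    have hC := S.isPolyhedron
    have := hC.finiteDimensional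
    have hfac : ∀ F, F ∈ S.facets_finite.toFinset ↔ IsFacet k S.carrier F.carrier ∧
        F.orientation = inducedOrientation S.orientation S.carrier F.carrier := fun F =>
      S.facets_finite.mem_toFinset
    by_cases htop : (vectorSpan ℝ S.carrier).map (coords f : X →ₗ[ℝ] (Fin k → ℝ)) = ⊤
    · let T := (coords f : X →ₗ[ℝ] (Fin k → ℝ)).domRestrict (vectorSpan ℝ S.carrier)
      have hrange : LinearMap.range T = ⊤ := by rw [LinearMap.range_domRestrict, htop]
      have hdim := T.finrank_range_add_finrank_ker
      rw [hrange, finrank_top, Module.finrank_fin_fun, hC.finrank_eq, add_right_inj] at hdim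
      obtain ⟨⟨⟨u, hu⟩, hTu⟩, hu0, hker⟩ := finrank_eq_one_iff'.1 hdim
      have hfu : coords f u = 0 := hTu
      have hu0 : u ≠ 0 := fun h => hu0 (by ext; exact h)
      have hker : ∀ w ∈ vectorSpan ℝ S.carrier, coords f w = 0 → ∃ t : ℝ, w = t • u := by
        intro w hw hw0
        obtain ⟨t, ht⟩ := hker ⟨⟨w, hw⟩, hw0⟩
        refine ⟨t, ?_⟩
        have := congrArg (fun z : LinearMap.ker T => ((z : vectorSpan ℝ S.carrier) : X)) ht
        exact this.symm
      obtain ⟨lam, hlam⟩ := SeparatingDual.exists_eq_one (R := ℝ) hu0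
      obtain ⟨ω, hω, hωo⟩ := S.isOrientation
      -- The functional `lam`, with value one at `u`, completes `f` to `k + 1` coordinates. The
      -- resulting determinant is comparable with the orienting form of `S`.
      obtain ⟨κ, hκ⟩ := exists_form_eq_mul hC.finrank_eq hω
        (coordForm (Fin.cons lam f : Fin (k + 1) → StrongDual ℝ X))
      have hκ' : ∀ v, (∀ i, v i ∈ vectorSpan ℝ S.carrier) →
          coordForm f v = κ * ω.curryLeft u v := by
        intro v hv
        rw [← coordForm_cons lam f hlam hfu v, hκ _ fun i => ?_]
        · rfl
        · refine Fin.cases ?_ (fun j => ?_) i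
          · simpa using hu
          · simpa using hv j
      -- One supporting functional is fixed for every facet; sets that are not facets get the value
      -- `0`, which plays no role.
      have hlev : ∀ F : Set X, ∃ (l : StrongDual ℝ X) (m : ℝ), IsFacet k S.carrier F →
          F = {x ∈ S.carrier | l x = m} ∧ (∀ x ∈ S.carrier, l x ≤ m) ∧
            ∃ y ∈ S.carrier, l y < m := by
        intro F
        by_cases hF : IsFacet k S.carrier F
        · obtain ⟨l, m, h⟩ := hF.exists_level hC
          exact ⟨l, m, fun _ => h⟩
        · exact ⟨0, 0, fun h => absurd h hF⟩
      choose l m hl using hlev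
      have hsum : ∀ (w : X) (y : Fin k → ℝ), (∃! F, IsFacet k S.carrier F ∧ 0 < l F w ∧
          y ∈ coords f '' F) → ∑ F ∈ S.facets_finite.toFinset,
            (if 0 < l F.carrier w ∧ y ∈ coords f '' F.carrier then (1 : ℤ) else 0) = 1 := by
        rintro w y ⟨F, ⟨hF, hFw, hFy⟩, huniq⟩
        have hF' : F ∈ carrier '' S.facets := by rw [carrier_image_facets]; exact hF
        obtain ⟨F, hFS, rfl⟩ := hF'
        rw [Finset.sum_eq_single F, if_pos ⟨hFw, hFy⟩]
        · intro F' hF' hne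
          refine if_neg fun h => hne ?_
          have hF'S := S.facets_finite.mem_toFinset.1 hF'
          exact S.carrier_injOn_facets hF'S hFS (huniq _ ⟨hF'S.1, h⟩)
        · exact fun h => absurd (S.facets_finite.mem_toFinset.2 hFS) h
      have hex := existsUnique_exit_facet hC hl hu hu0 hfu hker
      -- The exit facet of the reversed line is the entry facet of the line.
      have hen := existsUnique_exit_facet hC hl (u := -u) (Submodule.neg_mem _ hu)
        (neg_ne_zero.2 hu0) (by rw [map_neg, hfu, neg_zero]) fun w hw hw0 => by
          obtain ⟨t, rfl⟩ := hker w hw hw0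
          exact ⟨-t, by simp⟩
      filter_upwards [hex, hen] with y hy₁ hy₂
      rw [facetSum_single, map_sum]
      by_cases hyC : y ∈ coords f '' S.carrier
      · have hterm : ∀ F ∈ S.facets_finite.toFinset, degreeAt f y (Finsupp.single F g) =
            ((SignType.sign κ : ℤ) *
              ((if 0 < l F.carrier u ∧ y ∈ coords f '' F.carrier then (1 : ℤ) else 0) -
                (if 0 < l F.carrier (-u) ∧ y ∈ coords f '' F.carrier then (1 : ℤ) else 0))) • g := by
          intro F hF
          rw [hfac] at hF
          obtain ⟨h1, h2, -⟩ := hl _ hF.1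
          rw [degreeAt_single, hF.2, hωo, orientSign_facet hC hF.1 h1 h2 hu hω hκ']
          by_cases hyF : y ∈ coords f '' F.carrier
          · simp only [hyF, and_true, if_true, map_neg, Left.neg_pos_iff]
            rcases lt_trichotomy (l F.carrier u) 0 with h | h | h
            · simp [h, h.not_gt]
            · simp [h]
            · simp [h, h.not_gt]
          · simp [hyF]
        rw [Finset.sum_congr rfl hterm, ← Finset.sum_smul, ← Finset.mul_sum,
          Finset.sum_sub_distrib, hsum u y (hy₁ hyC), hsum (-u) y (hy₂ hyC), sub_self, mul_zero,
          zero_smul]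
      · refine Finset.sum_eq_zero fun F hF => ?_
        rw [hfac] at hF
        exact degreeAt_single_of_notMem (fun h => hyC (image_mono hF.1.subset h)) g
    -- If the directions of `S` are not mapped onto `ℝᵏ`, the image of `S` and of its facets is
    -- null.
    · filter_upwards [measure_eq_zero_iff_ae_notMem.1
        (volume_image_coords_of_map_ne_top f htop)] with y hy
      rw [facetSum_single, map_sum]
      refine Finset.sum_eq_zero fun F hF => ?_
      rw [hfac] at hF
      exact degreeAt_single_of_notMem (fun h => hy (image_mono hF.1.subset h)) g

end boundary

/-! ### Disjoint representations -/

section refinement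

variable {G : Type*} [NormedAddCommGroup G] {k : ℕ}

open OrientedPolyhedron

theorem weight_single (S : OrientedPolyhedron X k) (g : G) :
    weight (Finsupp.single S g) = ‖g‖ₑ * area k S.carrier := by
  rw [weight, Finsupp.sum_single_index (by simp)]

theorem weight_zero : weight (0 : OrientedPolyhedron X k →₀ G) = 0 := by
  rw [weight, Finsupp.sum_zero_index]

theorem weight_add_le (c d : OrientedPolyhedron X k →₀ G) :
    weight (c + d) ≤ weight c + weight d := by
  classical
  have h : ∀ e : OrientedPolyhedron X k →₀ G, e.support ⊆ c.support ∪ d.support →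
      weight e = ∑ S ∈ c.support ∪ d.support, ‖e S‖ₑ * area k S.carrier := fun e he =>
    Finsupp.sum_of_support_subset e he _ (by simp)
  rw [h _ Finsupp.support_add, h c Finset.subset_union_left, h d Finset.subset_union_right,
    ← Finset.sum_add_distrib]
  refine Finset.sum_le_sum fun S _ => ?_
  rw [← add_mul]
  exact mul_le_mul' (enorm_add_le _ _) le_rfl

theorem weight_sum_le {ι : Type*} (s : Finset ι) (c : ι → OrientedPolyhedron X k →₀ G) :
    weight (∑ i ∈ s, c i) ≤ ∑ i ∈ s, weight (c i) := by
  classical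
  induction s using Finset.induction_on with
  | empty => simp [weight_zero]
  | insert i s hi ih =>
    rw [Finset.sum_insert hi, Finset.sum_insert hi]
    exact (weight_add_le _ _).trans (add_le_add le_rfl ih)

theorem weight_neg (c : OrientedPolyhedron X k →₀ G) : weight (-c) = weight c := by
  simp [weight, Finsupp.sum]

theorem weight_ne_top (c : OrientedPolyhedron X k →₀ G) : weight c ≠ ⊤ := by
  refine ENNReal.sum_ne_top.2 fun S _ => ENNReal.mul_ne_top (by simp) ?_
  exact area_ne_top S.isPolyhedron.bounded

/-! ### Common refinement of polyhedra by hyperplanes -/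

/-- The coordinates of the finite-dimensional quotient of `W` by `V ∩ W`, extended to `X` by
Hahn–Banach, are equations of `V ∩ W` in `W`. -/
theorem exists_finset_functionals {V W : Submodule ℝ X} [FiniteDimensional ℝ W] :
    ∃ t : Finset (StrongDual ℝ X), (∀ f ∈ t, ∀ v ∈ V, v ∈ W → f v = 0) ∧
      ∀ w ∈ W, (∀ f ∈ t, f w = 0) → w ∈ V := by
  classical
  let N := V.comap W.subtype
  let b := Module.finBasis ℝ (W ⧸ N)
  have hext : ∀ i, ∃ g : StrongDual ℝ X, ∀ w : W, g w = b.coord i (N.mkQ w) := fun i => by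
    obtain ⟨g, hg, -⟩ := exists_extension_norm_eq W
      (LinearMap.toContinuousLinearMap (b.coord i ∘ₗ N.mkQ))
    exact ⟨g, hg⟩
  choose g hg using hext
  refine ⟨Finset.univ.image g, fun f hf v hv hvW => ?_, fun w hw h => ?_⟩
  · obtain ⟨i, -, rfl⟩ := Finset.mem_image.1 hf
    have h1 : N.mkQ ⟨v, hvW⟩ = 0 := (Submodule.Quotient.mk_eq_zero N).2 hv
    have h2 := hg i ⟨v, hvW⟩
    rwa [h1, map_zero] at h2
  · have h1 : N.mkQ ⟨w, hw⟩ = 0 := by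
      refine b.forall_coord_eq_zero_iff.1 fun i => ?_
      rw [← hg i ⟨w, hw⟩]
      exact h (g i) (Finset.mem_image_of_mem g (Finset.mem_univ i))
    exact (Submodule.Quotient.mk_eq_zero N).1 h1

/-- A polyhedron is cut out by half-spaces of any finite dimensional space that contains it. -/
theorem IsPolyhedron.exists_halfSpaces {C : Set X} (hC : IsPolyhedron k C) {W : Submodule ℝ X}
    [FiniteDimensional ℝ W] (hCW : C ⊆ W) : ∃ s : Finset (StrongDual ℝ X × ℝ),
      C = {x | x ∈ W ∧ ∀ p ∈ s, p.1 x ≤ p.2} := by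
  classical
  obtain ⟨s, hs⟩ := hC.halfSpaces
  obtain ⟨x₀, hx₀⟩ := hC.nonempty
  obtain ⟨t, ht, ht'⟩ := exists_finset_functionals (V := vectorSpan ℝ C) (W := W)
  -- The affine span of `C` is described inside `W` by the equations `f x = f x₀`, each written as
  -- two inequalities.
  refine ⟨s ∪ (t.image (fun f => (f, f x₀)) ∪ t.image fun f => (-f, -f x₀)), ?_⟩
  have hsub : ∀ x ∈ C, x - x₀ ∈ vectorSpan ℝ C := fun x hx => vsub_mem_vectorSpan ℝ hx hx₀
  ext x
  constructor
  · intro hx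
    have hfx : ∀ f ∈ t, f x = f x₀ := fun f hf => by
      have := ht f hf (x - x₀) (hsub x hx) (W.sub_mem (hCW hx) (hCW hx₀))
      rwa [map_sub, sub_eq_zero] at this
    refine ⟨hCW hx, fun p hp => ?_⟩
    rcases Finset.mem_union.1 hp with hp | hp
    · rw [hs] at hx
      exact hx.2 p hp
    rcases Finset.mem_union.1 hp with hp | hp <;> obtain ⟨f, hf, rfl⟩ := Finset.mem_image.1 hp
    · exact (hfx f hf).le
    · simpa using (hfx f hf).ge
  · rintro ⟨hxW, hx⟩
    rw [hs]
    refine ⟨?_, fun p hp => hx p (Finset.mem_union_left _ hp)⟩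
    have h1 : x - x₀ ∈ vectorSpan ℝ C := by
      refine ht' _ (W.sub_mem hxW (hCW hx₀)) fun f hf => ?_
      have h2 := hx (f, f x₀) (Finset.mem_union_right _ (Finset.mem_union_left _
        (Finset.mem_image_of_mem _ hf)))
      have h3 := hx (-f, -f x₀) (Finset.mem_union_right _ (Finset.mem_union_right _
        (Finset.mem_image_of_mem (fun f : StrongDual ℝ X => (-f, -f x₀)) hf)))
      have h3 : -f x ≤ -f x₀ := h3
      rw [map_sub, sub_eq_zero]
      exact le_antisymm h2 (neg_le_neg_iff.1 h3)
    rw [← direction_affineSpan] at h1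
    have := AffineSubspace.vadd_mem_of_mem_direction h1 (subset_affineSpan ℝ _ hx₀)
    simpa using this

/-- `C` is cut out of `W` by half-spaces of the family `H`. -/
def IsCutOut (W : Submodule ℝ X) (H : Finset (StrongDual ℝ X × ℝ)) (C : Set X) : Prop :=
  ∃ s ⊆ H, C = {x | x ∈ W ∧ ∀ p ∈ s, p.1 x ≤ p.2}

/-- `C` lies on one side of the hyperplane `p`. -/
def IsOnOneSide (p : StrongDual ℝ X × ℝ) (C : Set X) : Prop :=
  (∀ x ∈ C, p.1 x ≤ p.2) ∨ ∀ x ∈ C, p.2 ≤ p.1 x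

theorem IsOnOneSide.mono {p : StrongDual ℝ X × ℝ} {C D : Set X} (h : IsOnOneSide p C)
    (hDC : D ⊆ C) : IsOnOneSide p D :=
  h.imp (fun h x hx => h x (hDC hx)) fun h x hx => h x (hDC hx)

theorem IsCutOut.sep {W : Submodule ℝ X} {H : Finset (StrongDual ℝ X × ℝ)} {C : Set X}
    (h : IsCutOut W H C) {p : StrongDual ℝ X × ℝ} (hp : p ∈ H) :
    IsCutOut W H {x ∈ C | p.1 x ≤ p.2} := by
  classical
  obtain ⟨s, hs, rfl⟩ := h
  refine ⟨insert p s, Finset.insert_subset hp hs, ?_⟩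
  ext x
  simp only [mem_ofPred_eq, Finset.mem_insert, forall_eq_or_imp]
  tauto

/-- Suppose `D` lies on the far side of a half-space `p` that cuts out `C`. Continuing a segment
from `z ∈ D` slightly beyond the relatively interior point `x` stays in `D`, which forces `p.1 z ≤
p.1 x ≤ p.2`. By symmetry, two fully cut pieces whose relative interiors meet coincide. -/
theorem IsCutOut.subset_of_mem {W : Submodule ℝ X} {H : Finset (StrongDual ℝ X × ℝ)}
    {C D : Set X} (hC : IsCutOut W H C) (hD : IsCutOut W H D) (hDs : ∀ p ∈ H, IsOnOneSide p D)
    {x : X} (hx : x ∈ C) (hxD : x ∈ intrinsicInterior ℝ D) : D ⊆ C := by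
  obtain ⟨s, hs, rfl⟩ := hC
  intro z hz
  have hzW : z ∈ W := by
    obtain ⟨s', -, rfl⟩ := hD
    exact hz.1
  refine ⟨hzW, fun p hp => ?_⟩
  rcases hDs p (hs hp) with h | h
  · exact h z hz
  · obtain ⟨ε, hε, hmem⟩ := exists_extend_mem hxD hz
    have h1 := h _ hmem
    have h2 := hx.2 p hp
    simp only [map_add, map_smul, map_sub, smul_eq_mul] at h1
    nlinarith

/-- A polyhedron on both sides of the hyperplane is replaced by its two halves. This is a defining
relation of chains, and the area is additive under it. -/
theorem exists_cut_single {W : Submodule ℝ X} {H t : Finset (StrongDual ℝ X × ℝ)}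
    {p : StrongDual ℝ X × ℝ} (hp : p ∈ H) (hp' : (-p.1, -p.2) ∈ H) (S : OrientedPolyhedron X k)
    (g : G) (hS : IsCutOut W H S.carrier ∧ ∀ q ∈ t, IsOnOneSide q S.carrier) :
    ∃ d : OrientedPolyhedron X k →₀ G, (toChain d : PolyChain X G k) = simple S g ∧
      weight d ≤ ‖g‖ₑ * area k S.carrier ∧ ∀ T ∈ d.support, IsCutOut W H T.carrier ∧
        IsOnOneSide p T.carrier ∧ ∀ q ∈ t, IsOnOneSide q T.carrier := by
  classical
  by_cases hside : IsOnOneSide p S.carrier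
  · refine ⟨Finsupp.single S g, rfl, (weight_single S g).le, fun T hT => ?_⟩
    rw [Finset.mem_singleton.1 (Finsupp.support_single_subset hT)]
    exact ⟨hS.1, hside, hS.2⟩
  · simp only [IsOnOneSide, not_or, not_forall, not_le] at hside
    obtain ⟨⟨b, hb, hbp⟩, a, ha, hap⟩ := hside
    let S₁ := S.below p.1 p.2 ⟨a, ha, hap⟩
    -- The upper half is a lower half for `-p`; the family `H` must therefore contain opposite
    -- half-spaces.
    let S₂ := S.below (-p.1) (-p.2) ⟨b, hb, by simpa using hbp⟩
    have e₁ : S₁.carrier = {x ∈ S.carrier | p.1 x ≤ p.2} := rfl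
    have e₂ : S₂.carrier = {x ∈ S.carrier | p.2 ≤ p.1 x} := by simp [S₂, below]
    have hsub : S.IsSubdivision S₁ S₂ := by
      refine ⟨?_, ?_, rfl, rfl⟩
      · rw [e₁, e₂]
        ext x
        simp only [mem_union, mem_ofPred_eq, ← and_or_left]
        exact ⟨fun hx => ⟨hx, le_total _ _⟩, fun hx => hx.1⟩
      · rw [e₁, e₂]
        exact disjoint_intrinsicInterior_cut ha hap
    refine ⟨Finsupp.single S₁ g + Finsupp.single S₂ g, ?_, ?_, fun T hT => ?_⟩
    · rw [map_add]
      exact (simple_subdivision hsub g).symm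
    · refine (weight_add_le _ _).trans ?_
      rw [weight_single, weight_single, ← mul_add, e₁, e₂,
        S.isPolyhedron.area_cut ha hap hb hbp]
    · rcases Finset.mem_union.1 (Finsupp.support_add hT) with hT | hT <;>
        rw [Finset.mem_singleton.1 (Finsupp.support_single_subset hT)]
      · exact ⟨hS.1.sep hp, Or.inl fun x hx => hx.2, fun q hq => (hS.2 q hq).mono (sep_subset _ _)⟩
      · exact ⟨hS.1.sep hp', Or.inr fun x hx => by rw [e₂] at hx; exact hx.2,
          fun q hq => (hS.2 q hq).mono (sep_subset _ _)⟩

theorem exists_cut_formalSum {W : Submodule ℝ X} {H t : Finset (StrongDual ℝ X × ℝ)}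
    {p : StrongDual ℝ X × ℝ} (hp : p ∈ H) (hp' : (-p.1, -p.2) ∈ H)
    (c : OrientedPolyhedron X k →₀ G)
    (hc : ∀ S ∈ c.support, IsCutOut W H S.carrier ∧ ∀ q ∈ t, IsOnOneSide q S.carrier) :
    ∃ d : OrientedPolyhedron X k →₀ G, (toChain d : PolyChain X G k) = toChain c ∧
      weight d ≤ weight c ∧ ∀ T ∈ d.support, IsCutOut W H T.carrier ∧
        IsOnOneSide p T.carrier ∧ ∀ q ∈ t, IsOnOneSide q T.carrier := by
  classical
  have hd : ∀ S : OrientedPolyhedron X k, ∃ d : OrientedPolyhedron X k →₀ G, S ∈ c.support →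
      (toChain d : PolyChain X G k) = simple S (c S) ∧ weight d ≤ ‖c S‖ₑ * area k S.carrier ∧
      ∀ T ∈ d.support, IsCutOut W H T.carrier ∧ IsOnOneSide p T.carrier ∧
        ∀ q ∈ t, IsOnOneSide q T.carrier := fun S => by
    by_cases hS : S ∈ c.support
    · obtain ⟨d, hd⟩ := exists_cut_single hp hp' S (c S) (hc S hS)
      exact ⟨d, fun _ => hd⟩
    · exact ⟨0, fun h => absurd h hS⟩
  choose d hd using hd
  refine ⟨∑ S ∈ c.support, d S, ?_, ?_, fun T hT => ?_⟩
  · conv_rhs => rw [← Finsupp.sum_single c, Finsupp.sum, map_sum]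
    rw [map_sum]
    exact Finset.sum_congr rfl fun S hS => (hd S hS).1
  · exact (weight_sum_le _ _).trans (Finset.sum_le_sum fun S hS => (hd S hS).2.1)
  · obtain ⟨S, hS, hTS⟩ := Finset.mem_biUnion.1 (Finsupp.support_finsetSum hT)
    exact (hd S hS).2.2 T hTS

/-- The hyperplanes are applied in succession. Being on one side of the earlier ones passes to
smaller pieces. -/
theorem exists_cut_all {W : Submodule ℝ X} {H : Finset (StrongDual ℝ X × ℝ)}
    (hH : ∀ p ∈ H, (-p.1, -p.2) ∈ H) (c : OrientedPolyhedron X k →₀ G)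
    (hc : ∀ S ∈ c.support, IsCutOut W H S.carrier) (t : Finset (StrongDual ℝ X × ℝ)) (ht : t ⊆ H) :
    ∃ d : OrientedPolyhedron X k →₀ G, (toChain d : PolyChain X G k) = toChain c ∧
      weight d ≤ weight c ∧ ∀ T ∈ d.support, IsCutOut W H T.carrier ∧
        ∀ q ∈ t, IsOnOneSide q T.carrier := by
  classical
  induction t using Finset.induction_on with
  | empty => exact ⟨c, rfl, le_rfl, fun T hT => ⟨hc T hT, by simp⟩⟩
  | insert p t _ ih =>
    obtain ⟨d, h1, h2, h3⟩ := ih fun q hq => ht (Finset.mem_insert_of_mem hq)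
    have hp := ht (Finset.mem_insert_self p t)
    obtain ⟨e, h4, h5, h6⟩ := exists_cut_formalSum hp (hH p hp) d h3
    refine ⟨e, h4.trans h1, h5.trans h2, fun T hT => ⟨(h6 T hT).1, fun q hq => ?_⟩⟩
    rcases Finset.mem_insert.1 hq with rfl | hq
    · exact (h6 T hT).2.1
    · exact (h6 T hT).2.2 q hq

/-- A formal sum in which polyhedra that are not disjoint have the same carrier can be made
disjoint by a choice of orientations. -/
theorem exists_collapse (c : OrientedPolyhedron X k →₀ G)
    (hc : ∀ S ∈ c.support, ∀ T ∈ c.support, S.carrier ≠ T.carrier →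
      Disjoint (intrinsicInterior ℝ S.carrier) (intrinsicInterior ℝ T.carrier)) :
    ∃ d : OrientedPolyhedron X k →₀ G, IsDisjointSum d ∧
      (toChain d : PolyChain X G k) = toChain c ∧ weight d ≤ weight c := by
  classical
  -- One orientation is fixed for each carrier, as a function of the set alone, so that summands
  -- with equal carriers are merged; `none` stands for sets that carry no polyhedron.
  have hex : ∀ C : Set X, ∃ R : Option (OrientedPolyhedron X k), ∀ S : OrientedPolyhedron X k,
      S.carrier = C → ∃ T, R = some T ∧ T.carrier = C := by
    intro C
    by_cases h : ∃ S : OrientedPolyhedron X k, S.carrier = C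
    · obtain ⟨S, hS⟩ := h
      exact ⟨some S, fun _ _ => ⟨S, rfl, hS⟩⟩
    · exact ⟨none, fun S hS => absurd ⟨S, hS⟩ h⟩
  choose R hR using hex
  have hcan : ∀ S : OrientedPolyhedron X k, ∃ T, R S.carrier = some T ∧ T.carrier = S.carrier :=
    fun S => hR _ S rfl
  choose τ hτR hτ using hcan
  have hτeq : ∀ S T : OrientedPolyhedron X k, S.carrier = T.carrier → τ S = τ T := by
    intro S T h
    have := hτR S
    rw [h, hτR T] at this
    exact (Option.some_inj.1 this).symm
  let γ : OrientedPolyhedron X k → G := fun S =>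
    if S.orientation = (τ S).orientation then c S else -c S
  have hγ : ∀ S, (simple (τ S) (γ S) : PolyChain X G k) = simple S (c S) := by
    intro S
    by_cases h : S.orientation = (τ S).orientation
    · have : τ S = S := OrientedPolyhedron.ext (hτ S) h.symm
      simp [γ, this]
    · have h1 := simple_opposite (G := G) (P := S) (P' := τ S) ⟨(hτ S).symm, h⟩ (c S)
      simp only [γ, if_neg h, map_neg]
      exact (eq_neg_of_add_eq_zero_left h1).symm
  have hγn : ∀ S, ‖γ S‖ₑ = ‖c S‖ₑ := by
    intro S
    simp only [γ]
    split_ifs <;> simp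
  refine ⟨∑ S ∈ c.support, Finsupp.single (τ S) (γ S), ?_, ?_, ?_⟩
  · have hsupp : ∀ T ∈ (∑ S ∈ c.support, Finsupp.single (τ S) (γ S)).support,
        ∃ S ∈ c.support, T = τ S := by
      intro T hT
      obtain ⟨S, hS, hTS⟩ := Finset.mem_biUnion.1 (Finsupp.support_finsetSum hT)
      exact ⟨S, hS, Finset.mem_singleton.1 (Finsupp.support_single_subset hTS)⟩
    intro P hP Q hQ hne
    obtain ⟨S, hS, rfl⟩ := hsupp P hP
    obtain ⟨T, hT, rfl⟩ := hsupp Q hQ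
    rw [hτ, hτ]
    exact hc S hS T hT fun h => hne (hτeq S T h)
  · conv_rhs => rw [← Finsupp.sum_single c, Finsupp.sum, map_sum]
    rw [map_sum]
    exact Finset.sum_congr rfl fun S _ => hγ S
  · refine (weight_sum_le _ _).trans (Finset.sum_le_sum fun S _ => ?_)
    rw [weight_single, hγn, hτ]

/-- Every formal sum can be replaced by a disjoint one that is not heavier. -/
theorem exists_isDisjointSum (c : OrientedPolyhedron X k →₀ G) :
    ∃ d : OrientedPolyhedron X k →₀ G, IsDisjointSum d ∧
      (toChain d : PolyChain X G k) = toChain c ∧ weight d ≤ weight c := by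
  classical
  -- The directions of a polyhedron together with one of its points span a linear space containing
  -- it. The sum of these spaces is a finite-dimensional space containing all polyhedra of `c`.
  let U : OrientedPolyhedron X k → Submodule ℝ X := fun S =>
    vectorSpan ℝ S.carrier ⊔ ℝ ∙ S.isPolyhedron.nonempty.some
  have hU : ∀ S, FiniteDimensional ℝ (U S) := fun S => by
    have := S.isPolyhedron.finiteDimensional
    infer_instance
  have hSU : ∀ S : OrientedPolyhedron X k, S.carrier ⊆ U S := fun S x hx => by
    have h1 := vsub_mem_vectorSpan ℝ hx S.isPolyhedron.nonempty.some_mem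
    have h2 := Submodule.add_mem_sup h1
      (Submodule.mem_span_singleton_self (R := ℝ) S.isPolyhedron.nonempty.some)
    simpa using h2
  let W := c.support.sup U
  have hW : FiniteDimensional ℝ W := Submodule.finiteDimensional_finset_sup _ _
  have hs : ∀ S : OrientedPolyhedron X k, ∃ s : Finset (StrongDual ℝ X × ℝ), S ∈ c.support →
      S.carrier = {x | x ∈ W ∧ ∀ p ∈ s, p.1 x ≤ p.2} := fun S => by
    by_cases hS : S ∈ c.support
    · obtain ⟨s, hs⟩ := S.isPolyhedron.exists_halfSpaces (W := W)
        ((hSU S).trans (Finset.le_sup (f := U) hS : U S ≤ W))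
      exact ⟨s, fun _ => hs⟩
    · exact ⟨∅, fun h => absurd h hS⟩
  choose s hs using hs
  let H₀ := c.support.biUnion s
  let H := H₀ ∪ H₀.image fun p => (-p.1, -p.2)
  have hH : ∀ p ∈ H, (-p.1, -p.2) ∈ H := by
    intro p hp
    rcases Finset.mem_union.1 hp with hp | hp
    · exact Finset.mem_union_right _ (Finset.mem_image_of_mem
        (fun p : StrongDual ℝ X × ℝ => (-p.1, -p.2)) hp)
    · obtain ⟨q, hq, rfl⟩ := Finset.mem_image.1 hp
      exact Finset.mem_union_left _ (by simpa using hq)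
  obtain ⟨d, h1, h2, h3⟩ := exists_cut_all hH c (fun S hS => ⟨s S, fun p hp =>
    Finset.mem_union_left _ (Finset.mem_biUnion.2 ⟨S, hS, hp⟩), hs S hS⟩) H subset_rfl
  -- Once every piece is on one side of every hyperplane of `H`, pieces with intersecting relative
  -- interiors contain each other.
  obtain ⟨e, h4, h5, h6⟩ := exists_collapse d fun S hS T hT hne => by
    rw [disjoint_left]
    intro x hxS hxT
    exact hne (Subset.antisymm
      ((h3 T hT).1.subset_of_mem (h3 S hS).1 (h3 S hS).2 (intrinsicInterior_subset hxT) hxS)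
      ((h3 S hS).1.subset_of_mem (h3 T hT).1 (h3 T hT).2 (intrinsicInterior_subset hxS) hxT))
  exact ⟨e, h4, h5.trans h1, h6.trans h2⟩

end refinement

/-! ### The mass in terms of the area -/

section mass

variable {G : Type*} [NormedAddCommGroup G] {k : ℕ}

open OrientedPolyhedron

theorem toChain_surjective : Function.Surjective
    (toChain : (OrientedPolyhedron X k →₀ G) → PolyChain X G k) :=
  QuotientAddGroup.mk'_surjective _

theorem toChain_eq_sum (c : OrientedPolyhedron X k →₀ G) :
    (toChain c : PolyChain X G k) = ∑ S ∈ c.support, simple S (c S) := by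
  conv_lhs => rw [← Finsupp.sum_single c, Finsupp.sum, map_sum]
  rfl

/-- An image of positive volume forces the directions of `D` to map onto `ℝᵏ`. Lifting the standard
basis gives a frame with determinant one. -/
theorem orientSign_eq_one_or_neg_one {f : Fin k → StrongDual ℝ X} {D : Set X}
    (hD : volume (coords f '' D) ≠ 0) (o : Set (Fin k → X)) :
    orientSign f (vectorSpan ℝ D) o = 1 ∨ orientSign f (vectorSpan ℝ D) o = -1 := by
  classical
  have htop : (vectorSpan ℝ D).map (coords f : X →ₗ[ℝ] (Fin k → ℝ)) = ⊤ := by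
    by_contra h
    exact hD (volume_image_coords_of_map_ne_top f h)
  have hex : ∀ i : Fin k, ∃ v ∈ vectorSpan ℝ D, coords f v = Pi.single i 1 := fun i => by
    have : (Pi.single i 1 : Fin k → ℝ) ∈
        (vectorSpan ℝ D).map (coords f : X →ₗ[ℝ] (Fin k → ℝ)) := htop ▸ Submodule.mem_top
    exact this
  choose v hv hvi using hex
  have hdet : coordForm f v = 1 := by
    rw [coordForm_apply, ← Matrix.det_one (n := Fin k)]
    congr 1
    ext i j
    rw [Matrix.of_apply, ← coords_apply, hvi, Matrix.one_apply, Pi.single_apply]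
    simp [eq_comm]
  unfold orientSign
  split_ifs with h1 h2
  · exact Or.inl rfl
  · exact Or.inr rfl
  · exact absurd ⟨v, hv, by rw [hdet]; exact one_ne_zero⟩ h2

/-- With one polyhedron nothing cancels: unless the image is null, the degree has norm `‖g‖` on all
of it. -/
theorem mul_volume_le_lintegral_degreeAt (f : Fin k → StrongDual ℝ X) (S : OrientedPolyhedron X k)
    (g : G) : ‖g‖ₑ * volume (coords f '' S.carrier) ≤
      ∫⁻ y, ‖degreeAt f y (Finsupp.single S g)‖ₑ := by
  classical
  by_cases h0 : volume (coords f '' S.carrier) = 0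
  · simp [h0]
  rw [← lintegral_indicator_const (S.isPolyhedron.measurableSet_image f)]
  refine lintegral_mono fun y => ?_
  rw [degreeAt_single, indicator_apply]
  split_ifs
  · rcases orientSign_eq_one_or_neg_one h0 S.orientation with h | h <;> simp [h]
  · simp

/-- Any representation of `g[S]` has almost everywhere the degree of the obvious one, and the weight
bounds its integral for every coordinate map. So no subdivision or cancellation makes `g[S]`
lighter. -/
theorem mul_area_le_weight {S : OrientedPolyhedron X k} {g : G} {c : OrientedPolyhedron X k →₀ G}
    (hc : (toChain c : PolyChain X G k) = simple S g) :
    ‖g‖ₑ * area k S.carrier ≤ weight c := by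
  simp_rw [area, ENNReal.mul_iSup]
  refine iSup₂_le fun f hf => (mul_volume_le_lintegral_degreeAt f S g).trans ?_
  refine le_trans (le_of_eq (lintegral_congr_ae ?_)) (lintegral_degreeAt_le hf c)
  filter_upwards [degreeAt_congr f (hc.trans (toChain_single S g).symm)] with y hy
  rw [hy]

theorem iInf_weight_simple (S : OrientedPolyhedron X k) (g : G) :
    ⨅ (c : OrientedPolyhedron X k →₀ G) (_ : toChain c = simple S g), weight c =
      ‖g‖ₑ * area k S.carrier := by
  refine le_antisymm (iInf₂_le_of_le (Finsupp.single S g) rfl (weight_single S g).le) ?_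
  exact le_iInf₂ fun c hc => mul_area_le_weight hc

/-- Making a representation disjoint does not increase its weight. Dropping disjointness allows
representations to be added. -/
theorem iInf_weight_eq (P : PolyChain X G k) :
    ⨅ (c : OrientedPolyhedron X k →₀ G) (_ : IsDisjointSum c ∧ toChain c = P), weight c =
      ⨅ (c : OrientedPolyhedron X k →₀ G) (_ : toChain c = P), weight c := by
  refine le_antisymm (le_iInf₂ fun c hc => ?_) (le_iInf₂ fun c hc => iInf₂_le c hc.2)
  obtain ⟨d, h1, h2, h3⟩ := exists_isDisjointSum c
  exact iInf₂_le_of_le d ⟨h1, h2.trans hc⟩ h3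

/-! ### Slices of simple chains -/

theorem restrict_boundary_simple (f : StrongDual ℝ X) (r : ℝ) (S : OrientedPolyhedron X (k + 1))
    (g : G) : restrict f r (boundary (simple S g)) =
      ∑ F ∈ S.facets_finite.toFinset, (simpleRestrict f r F g : PolyChain X G k) := by
  rw [boundary_simple, simpleBoundary, AddMonoidHom.finsetSum_apply, map_sum]
  exact Finset.sum_congr rfl fun F _ => restrict_simple f r F g

theorem simpleRestrict_eq_zero {f : StrongDual ℝ X} {r : ℝ} {S : OrientedPolyhedron X k}
    (h : ∀ x ∈ S.carrier, r ≤ f x) : (simpleRestrict f r S : G →+ PolyChain X G k) = 0 := by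
  rw [simpleRestrict, dif_neg]
  push Not
  exact h

theorem simpleRestrict_eq_self {f : StrongDual ℝ X} {r : ℝ} {S : OrientedPolyhedron X k}
    (h : ∀ x ∈ S.carrier, f x < r) : (simpleRestrict f r S : G →+ PolyChain X G k) = simple S := by
  obtain ⟨a, ha⟩ := S.isPolyhedron.nonempty
  rw [simpleRestrict, dif_pos ⟨a, ha, h a ha⟩]
  congr 1
  exact OrientedPolyhedron.ext (sep_eq_self_iff_mem_true.2 fun x hx => (h x hx).le) rfl

theorem slice_simple_of_le {f : StrongDual ℝ X} {r : ℝ} {S : OrientedPolyhedron X (k + 1)}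
    (h : ∀ x ∈ S.carrier, r ≤ f x) (g : G) : (slice f r (simple S g) : PolyChain X G k) = 0 := by
  rw [slice, restrict_simple, simpleRestrict_eq_zero h, AddMonoidHom.zero_apply, map_zero,
    restrict_boundary_simple, zero_sub, neg_eq_zero]
  refine Finset.sum_eq_zero fun F hF => ?_
  have hF := S.facets_finite.mem_toFinset.1 hF
  rw [simpleRestrict_eq_zero fun x hx => h x (hF.1.subset hx), AddMonoidHom.zero_apply]

theorem slice_simple_of_lt {f : StrongDual ℝ X} {r : ℝ} {S : OrientedPolyhedron X (k + 1)}
    (h : ∀ x ∈ S.carrier, f x < r) (g : G) : (slice f r (simple S g) : PolyChain X G k) = 0 := by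
  rw [slice, restrict_simple, simpleRestrict_eq_self h, restrict_boundary_simple, boundary_simple,
    simpleBoundary, AddMonoidHom.finsetSum_apply, sub_eq_zero]
  refine Finset.sum_congr rfl fun F hF => ?_
  have hF := S.facets_finite.mem_toFinset.1 hF
  rw [simpleRestrict_eq_self fun x hx => h x (hF.1.subset hx)]

/-- A hyperplane that meets a polyhedron properly slices it in its section. -/
theorem exists_slice_simple {f : StrongDual ℝ X} {r : ℝ} {S : OrientedPolyhedron X (k + 1)}
    {a b : X} (ha : a ∈ S.carrier) (har : f a < r) (hb : b ∈ S.carrier) (hbr : r < f b) (g : G) :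
    ∃ T : OrientedPolyhedron X k, T.carrier = {x ∈ S.carrier | f x = r} ∧
      slice f r (simple S g) = simple T g := by
  classical
  have hC := S.isPolyhedron
  have hex : ∃ a ∈ S.carrier, f a < r := ⟨a, ha, har⟩
  have hT : IsFacet k (S.below f r hex).carrier {x ∈ S.carrier | f x = r} :=
    (isFacet_cut_iff hC ha har hb hbr _).2 (Or.inl rfl)
  let T : OrientedPolyhedron X k := ⟨_, hT.2, _,
    isOrientation_induced (S.below f r hex).isPolyhedron hT (S.below f r hex).isOrientation⟩
  refine ⟨T, rfl, ?_⟩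
  -- The boundary of the lower part consists of the section and of the lower parts of the facets of
  -- `S`. The latter are exactly the restricted boundary, which the slice subtracts.
  rw [slice, restrict_simple, simpleRestrict, dif_pos hex, boundary_simple,
    simpleBoundary_cut S (S.below f r hex) ha har hb hbr rfl rfl, boundary_simple,
    simpleBoundary_eq S]
  have hT' := simpleOf_eq (G := G) T
  simp only [T] at hT'
  simp only [AddMonoidHom.add_apply, AddMonoidHom.finsetSum_apply, map_sum]
  rw [hT', add_sub_assoc, add_eq_left, sub_eq_zero]
  refine Finset.sum_congr rfl fun E hE => ?_
  have hE : IsFacet k S.carrier E := by simpa using hE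
  let E' : OrientedPolyhedron X k := ⟨E, hE.2, _, isOrientation_induced hC hE S.isOrientation⟩
  have h1 := simpleOf_eq (G := G) E'
  simp only [E'] at h1
  rw [h1, restrict_simple, simpleRestrict]
  split_ifs with h2
  · have h3 := simpleOf_eq (G := G) (E'.below f r h2)
    simp only [E', below] at h3
    rw [h3]
    rfl
  · rfl

/-- A level strictly between the extreme values of `f` on `S` gives the section, and a level that
misses `S` gives zero. The two extreme levels are negligible. The hypotheses are the induction
hypothesis in `mass_eq`. -/
theorem ae_mass_slice_simple
    (hmass : ∀ (T : OrientedPolyhedron X k) (g : G), mass k (simple T g) = ‖g‖ₑ * area k T.carrier)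
    (hzero : mass k (0 : PolyChain X G k) = 0) (f : StrongDual ℝ X)
    (S : OrientedPolyhedron X (k + 1)) (g : G) :
    ∀ᵐ r : ℝ, mass k (slice f r (simple S g)) = ‖g‖ₑ * area k {x ∈ S.carrier | f x = r} := by
  have hsub : ∀ A : Set ℝ, A.Subsingleton → ∀ᵐ r : ℝ, r ∉ A := fun A hA =>
    measure_eq_zero_iff_ae_notMem.1 (hA.measure_zero volume)
  have hA := hsub {r | (∀ x ∈ S.carrier, r ≤ f x) ∧ ∃ x ∈ S.carrier, f x = r} <| by
    rintro r ⟨h1, x, hx, rfl⟩ r' ⟨h1', x', hx', rfl⟩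
    exact le_antisymm (h1 x' hx') (h1' x hx)
  have hB := hsub {r | (∀ x ∈ S.carrier, f x ≤ r) ∧ ∃ x ∈ S.carrier, f x = r} <| by
    rintro r ⟨h1, x, hx, rfl⟩ r' ⟨h1', x', hx', rfl⟩
    exact le_antisymm (h1' x hx) (h1 x' hx')
  filter_upwards [hA, hB] with r hrA hrB
  have hemp : (∀ x ∈ S.carrier, f x ≠ r) → {x ∈ S.carrier | f x = r} = ∅ := fun h =>
    eq_empty_of_forall_notMem fun x hx => h x hx.1 hx.2
  by_cases h1 : ∃ a ∈ S.carrier, f a < r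
  · by_cases h2 : ∃ b ∈ S.carrier, r < f b
    · obtain ⟨a, ha, har⟩ := h1
      obtain ⟨b, hb, hbr⟩ := h2
      obtain ⟨T, hT, hTs⟩ := exists_slice_simple ha har hb hbr g
      rw [hTs, hmass, hT]
    · push Not at h2
      have hne : ∀ x ∈ S.carrier, f x ≠ r := fun x hx h => hrB ⟨h2, x, hx, h⟩
      rw [slice_simple_of_lt fun x hx => lt_of_le_of_ne (h2 x hx) (hne x hx), hzero, hemp hne,
        area_empty, mul_zero]
  · push Not at h1
    have hne : ∀ x ∈ S.carrier, f x ≠ r := fun x hx h => hrA ⟨h1, x, hx, h⟩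
    rw [slice_simple_of_le h1, hzero, hemp hne, area_empty, mul_zero]

/-- The mass of a chain is the least weight of a formal sum that represents it. -/
theorem mass_eq (k : ℕ) (P : PolyChain X G k) :
    mass k P = ⨅ (c : OrientedPolyhedron X k →₀ G) (_ : toChain c = P), weight c := by
  induction k with
  | zero =>
    rw [← iInf_weight_eq, mass]
    refine iInf_congr fun c => iInf_congr fun _ => Finset.sum_congr rfl fun S _ => ?_
    change ‖c S‖ₑ = ‖c S‖ₑ * area 0 S.carrier
    rw [area_zero S.isPolyhedron.nonempty, mul_one]
  | succ k ih =>
    have hmass : ∀ (T : OrientedPolyhedron X k) (g : G),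
        mass k (simple T g) = ‖g‖ₑ * area k T.carrier := fun T g => by
      rw [ih, iInf_weight_simple]
    have hzero : mass k (0 : PolyChain X G k) = 0 := by
      rw [ih, ← nonpos_iff_eq_zero]
      exact iInf₂_le_of_le 0 (map_zero _) weight_zero.le
    rw [← iInf_weight_eq, mass]
    refine iInf_congr fun c => iInf_congr fun _ => Finset.sum_congr rfl fun S _ => ?_
    change _ = ‖c S‖ₑ * area (k + 1) S.carrier
    -- By the induction hypothesis the slices of `S` have mass `‖c S‖` times the area of the
    -- sections, so the supremum of integrals that defines the mass is the recursion of the area.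
    rw [area_succ S.isPolyhedron]
    simp_rw [ENNReal.mul_iSup]
    refine iSup_congr fun f => iSup_congr fun _ => ?_
    rw [lintegral_congr_ae (ae_mass_slice_simple hmass hzero f S (c S)),
      lintegral_const_mul'' _ (S.isPolyhedron.lintegral_area_section f).1]

/-! ### Subadditivity and finiteness of the mass, restrictions and slices -/

theorem mass_le_weight (c : OrientedPolyhedron X k →₀ G) : mass k (toChain c) ≤ weight c := by
  rw [mass_eq]
  exact iInf₂_le (f := fun (d : OrientedPolyhedron X k →₀ G)
    (_ : (toChain d : PolyChain X G k) = toChain c) => weight d) c rfl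

theorem mass_simple (S : OrientedPolyhedron X k) (g : G) :
    mass k (simple S g) = ‖g‖ₑ * area k S.carrier := by
  rw [mass_eq, iInf_weight_simple]

theorem mass_zero : mass k (0 : PolyChain X G k) = 0 := by
  rw [← nonpos_iff_eq_zero, ← map_zero toChain, ← weight_zero (X := X) (G := G) (k := k)]
  exact mass_le_weight 0

theorem exists_weight_lt {P : PolyChain X G k} {ε : ℝ≥0∞} (h : mass k P < ε) :
    ∃ c : OrientedPolyhedron X k →₀ G, toChain c = P ∧ weight c < ε := by
  rw [mass_eq] at h
  simpa only [iInf_lt_iff, exists_prop] using h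

theorem mass_add_le (P Q : PolyChain X G k) : mass k (P + Q) ≤ mass k P + mass k Q := by
  rw [mass_eq k P, mass_eq k Q]
  refine ENNReal.le_iInf₂_add_iInf₂ fun c hc d hd => ?_
  rw [← hc, ← hd, ← map_add]
  exact (mass_le_weight _).trans (weight_add_le c d)

theorem mass_sum_le {ι : Type*} (s : Finset ι) (P : ι → PolyChain X G k) :
    mass k (∑ i ∈ s, P i) ≤ ∑ i ∈ s, mass k (P i) := by
  classical
  induction s using Finset.induction_on with
  | empty => simp [mass_zero]
  | insert i s hi ih =>
    rw [Finset.sum_insert hi, Finset.sum_insert hi]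
    exact (mass_add_le _ _).trans (add_le_add le_rfl ih)

theorem mass_neg (P : PolyChain X G k) : mass k (-P) = mass k P := by
  have h : ∀ P : PolyChain X G k, mass k (-P) ≤ mass k P := fun P => by
    rw [mass_eq k P]
    refine le_iInf₂ fun c hc => ?_
    rw [← hc, ← map_neg, ← weight_neg c]
    exact mass_le_weight _
  refine le_antisymm (h P) ?_
  simpa using h (-P)

theorem mass_ne_top (P : PolyChain X G k) : mass k P ≠ ⊤ := by
  obtain ⟨c, rfl⟩ := toChain_surjective P
  exact ne_top_of_le_ne_top (weight_ne_top c) (mass_le_weight c)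

/-- Each polyhedron of a representation is replaced by a subset or dropped, and the area is
monotone. -/
theorem mass_restrict_le (f : StrongDual ℝ X) (r : ℝ) (P : PolyChain X G k) :
    mass k (restrict f r P) ≤ mass k P := by
  rw [mass_eq k P]
  refine le_iInf₂ fun c hc => ?_
  rw [← hc, toChain_eq_sum, map_sum]
  refine (mass_sum_le _ _).trans (Finset.sum_le_sum fun S _ => ?_)
  rw [restrict_simple, simpleRestrict]
  split_ifs with h
  · rw [mass_simple]
    exact mul_le_mul' le_rfl (area_mono (sep_subset _ _))
  · rw [AddMonoidHom.zero_apply, mass_zero]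
    exact zero_le

theorem slice_sum {ι : Type*} (f : StrongDual ℝ X) (r : ℝ) (s : Finset ι)
    (P : ι → PolyChain X G (k + 1)) : slice f r (∑ i ∈ s, P i) = ∑ i ∈ s, slice f r (P i) := by
  simp only [slice, map_sum, Finset.sum_sub_distrib]

/-- The masses of the slices of a chain are controlled by its weight. -/
theorem exists_mass_slice_le {f : StrongDual ℝ X} (hf : ‖f‖ = 1)
    (c : OrientedPolyhedron X (k + 1) →₀ G) : ∃ ψ : ℝ → ℝ≥0∞, AEMeasurable ψ ∧
      ∫⁻ r, ψ r ≤ weight c ∧ ∀ᵐ r, mass k (slice f r (toChain c)) ≤ ψ r := by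
  have hm : ∀ S : OrientedPolyhedron X (k + 1), AEMeasurable fun r : ℝ =>
      ‖c S‖ₑ * area k {x ∈ S.carrier | f x = r} := fun S =>
    (S.isPolyhedron.lintegral_area_section f).1.const_mul _
  -- The sum of the weighted section areas is an a.e. measurable majorant, so no measurability of
  -- the masses of the slices is needed.
  refine ⟨fun r => ∑ S ∈ c.support, ‖c S‖ₑ * area k {x ∈ S.carrier | f x = r}, ?_, ?_, ?_⟩
  · exact Finset.aemeasurable_fun_sum _ fun S _ => hm S
  · rw [lintegral_finsetSum' _ fun S _ => hm S]
    refine Finset.sum_le_sum fun S _ => ?_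
    change _ ≤ ‖c S‖ₑ * area (k + 1) S.carrier
    rw [lintegral_const_mul'' _ (S.isPolyhedron.lintegral_area_section f).1,
      area_succ S.isPolyhedron]
    exact mul_le_mul' le_rfl (le_iSup₂ (f := fun (f : StrongDual ℝ X) (_ : ‖f‖ = 1) =>
      ∫⁻ r : ℝ, area k {x ∈ S.carrier | f x = r}) f hf)
  · have h : ∀ᵐ r, ∀ S ∈ (c.support : Set (OrientedPolyhedron X (k + 1))),
        mass k (slice f r (simple S (c S))) = ‖c S‖ₑ * area k {x ∈ S.carrier | f x = r} := by
      rw [ae_ball_iff c.support.countable_toSet]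
      exact fun S _ => ae_mass_slice_simple mass_simple mass_zero f S (c S)
    filter_upwards [h] with r hr
    rw [toChain_eq_sum, slice_sum]
    exact (mass_sum_le _ _).trans (Finset.sum_le_sum fun S hS => (hr S hS).le)

end mass

/-! ### The flat norm -/

section flatNorm

variable {G : Type*} [NormedAddCommGroup G] {k : ℕ}

open OrientedPolyhedron

theorem flatNorm_le (P : PolyChain X G k) (Q : PolyChain X G (k + 1)) :
    flatNorm P ≤ mass (k + 1) Q + mass k (boundary Q - P) :=
  iInf_le _ Q

/-- The filling `Q = 0`. -/
theorem flatNorm_le_mass (P : PolyChain X G k) : flatNorm P ≤ mass k P := by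
  have := flatNorm_le P 0
  rwa [mass_zero, map_zero, zero_sub, mass_neg, zero_add] at this

theorem flatNorm_neg (P : PolyChain X G k) : flatNorm (-P) = flatNorm P := by
  have h : ∀ P : PolyChain X G k, flatNorm (-P) ≤ flatNorm P := fun P => by
    refine le_iInf fun Q => (flatNorm_le (-P) (-Q)).trans_eq ?_
    rw [mass_neg, map_neg, ← neg_sub', mass_neg]
  refine le_antisymm (h P) ?_
  simpa using h (-P)

theorem flatNorm_add_le (P Q : PolyChain X G k) :
    flatNorm (P + Q) ≤ flatNorm P + flatNorm Q := by
  refine ENNReal.le_iInf_add_iInf fun R T => (flatNorm_le (P + Q) (R + T)).trans ?_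
  rw [map_add, add_sub_add_comm, add_add_add_comm]
  exact add_le_add (mass_add_le _ _) (mass_add_le _ _)

/-- Boundaries have degree zero almost everywhere, so `∂Q - P` has the degree of `P` up to sign, and
its mass bounds the integral for every `Q`. The mass of `Q` itself is discarded. -/
theorem lintegral_degreeAt_le_flatNorm {f : Fin k → StrongDual ℝ X} (hf : ∀ i, ‖f i‖ = 1)
    (c : OrientedPolyhedron X k →₀ G) : ∫⁻ y, ‖degreeAt f y c‖ₑ ≤ flatNorm (toChain c) := by
  refine le_iInf fun Q => ?_
  obtain ⟨d, rfl⟩ := toChain_surjective Q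
  refine le_trans ?_ le_add_self
  rw [mass_eq]
  refine le_iInf₂ fun b hb => ?_
  rw [← toChain_facetSum, ← map_sub] at hb
  refine le_trans (le_of_eq (lintegral_congr_ae ?_)) (lintegral_degreeAt_le hf b)
  filter_upwards [degreeAt_congr f hb, degreeAt_facetSum f d] with y h1 h2
  rw [h1, map_sub, h2, zero_sub, enorm_neg]

/-- A coordinate map that is injective on the plane of `S` gives an image of positive volume, over
which the degree has norm `‖g‖`. -/
theorem eq_zero_of_flatNorm_simple {S : OrientedPolyhedron X k} {g : G}
    (h : flatNorm (simple S g) = 0) : g = 0 := by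
  have := S.isPolyhedron.finiteDimensional
  obtain ⟨f, hf, hinj⟩ := exists_coords_injective S.isPolyhedron.finrank_eq
  have h1 := (mul_volume_le_lintegral_degreeAt f S g).trans
    (lintegral_degreeAt_le_flatNorm hf (Finsupp.single S g))
  rw [toChain_single, h, nonpos_iff_eq_zero, mul_eq_zero] at h1
  exact enorm_eq_zero.1 (h1.resolve_right (S.isPolyhedron.volume_image_coords_pos hinj).ne')

/-- Almost every half-space restriction of a chain of flat norm zero has flat norm zero. -/
theorem ae_flatNorm_restrict {P : PolyChain X G k} (hP : flatNorm P = 0) {f : StrongDual ℝ X}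
    (hf : ‖f‖ = 1) : ∀ᵐ r : ℝ, flatNorm (restrict f r P) = 0 := by
  have hd : ∀ n : ℕ, ∃ d : OrientedPolyhedron X (k + 1) →₀ G,
      weight d < (2⁻¹ : ℝ≥0∞) ^ n ∧ mass k (boundary (toChain d) - P) < (2⁻¹ : ℝ≥0∞) ^ n := by
    intro n
    have h1 : flatNorm P < (2⁻¹ : ℝ≥0∞) ^ n := by
      rw [hP]
      exact ENNReal.pow_pos (by simp) n
    obtain ⟨Q, hQ⟩ := iInf_lt_iff.1 h1
    obtain ⟨d, rfl, hd⟩ := exists_weight_lt (lt_of_le_of_lt le_self_add hQ)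
    exact ⟨d, hd, lt_of_le_of_lt le_add_self hQ⟩
  choose d hd₁ hd₂ using hd
  choose ψ hψm hψi hψ using fun n => exists_mass_slice_le hf (d n)
  have hgeom : ∑' n : ℕ, (2⁻¹ : ℝ≥0∞) ^ n ≠ ⊤ := by
    rw [ENNReal.tsum_geometric]
    simp
  -- The fillings were chosen with geometrically decreasing weights so that this series converges;
  -- hence `ψ n r → 0` for almost every `r`, without passing to a subsequence.
  have hsum : ∫⁻ r, ∑' n, ψ n r ≠ ⊤ := by
    rw [lintegral_tsum hψm]
    exact ne_top_of_le_ne_top hgeom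
      (ENNReal.tsum_le_tsum fun n => (hψi n).trans (hd₁ n).le)
  have hfin := ae_lt_top' (AEMeasurable.tsum hψm) hsum
  filter_upwards [hfin, ae_all_iff.2 hψ] with r hr hψr
  have hlim : Filter.Tendsto (fun n => (2⁻¹ : ℝ≥0∞) ^ n + (ψ n r + (2⁻¹ : ℝ≥0∞) ^ n)) Filter.atTop
      (nhds 0) := by
    have h1 := ENNReal.tendsto_atTop_zero_of_tsum_ne_top hgeom
    have h2 := ENNReal.tendsto_atTop_zero_of_tsum_ne_top hr.ne
    simpa using h1.add (h2.add h1)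
  refine le_antisymm (ge_of_tendsto' hlim fun n => ?_) zero_le
  refine (flatNorm_le _ (restrict f r (toChain (d n)))).trans (add_le_add ?_ ?_)
  · exact (mass_restrict_le f r _).trans ((mass_le_weight _).trans (hd₁ n).le)
  -- Restricting a filling creates a new boundary part, the slice, whose mass `ψ n r` controls.
  · have h1 : boundary (restrict f r (toChain (d n))) - restrict f r P =
        slice f r (toChain (d n)) + restrict f r (boundary (toChain (d n)) - P) := by
      rw [slice, map_sub]
      abel
    rw [h1]
    exact (mass_add_le _ _).trans (add_le_add (hψr n) ((mass_restrict_le f r _).trans (hd₂ n).le))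

/-! ### Isolating one polyhedron of a chain -/

/-- Strict separation of a point from a closed convex set. The functional is nonzero because `C` is
nonempty, so it can be rescaled to norm one, as `ae_flatNorm_restrict` requires. -/
theorem exists_separating {C : Set X} (hC : IsPolyhedron k C) {x : X} (hx : x ∉ C) :
    ∃ (f : StrongDual ℝ X) (u : ℝ), ‖f‖ = 1 ∧ f x < u ∧ ∀ b ∈ C, u < f b := by
  obtain ⟨f, u, h1, h2⟩ := geometric_hahn_banach_point_closed hC.convex hC.isClosed hx
  obtain ⟨b, hb⟩ := hC.nonempty
  have hf : 0 < ‖f‖ := by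
    rw [norm_pos_iff]
    rintro rfl
    have := h2 b hb
    simp only [zero_apply] at h1 this
    linarith
  refine ⟨‖f‖⁻¹ • f, ‖f‖⁻¹ * u, ?_, ?_, fun b hb => ?_⟩
  · rw [norm_smul, norm_inv, norm_norm, inv_mul_cancel₀ hf.ne']
  · exact mul_lt_mul_of_pos_left h1 (inv_pos.2 hf)
  · exact mul_lt_mul_of_pos_left (h2 b hb) (inv_pos.2 hf)

/-- In a chain of flat norm zero a polyhedron that has a point outside the other ones has
coefficient zero. -/
theorem eq_zero_of_flatNorm_add_sum {ι : Type*} (s : Finset ι) (S : OrientedPolyhedron X k) (g : G)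
    {x₀ : X} (hx₀ : x₀ ∈ S.carrier) (T : ι → OrientedPolyhedron X k) (c : ι → G)
    (hT : ∀ i ∈ s, x₀ ∉ (T i).carrier)
    (h : flatNorm (simple S g + ∑ i ∈ s, simple (T i) (c i)) = 0) : g = 0 := by
  classical
  induction s using Finset.induction_on generalizing S T c with
  | empty => exact eq_zero_of_flatNorm_simple (by simpa using h)
  | insert j s hj ih =>
    obtain ⟨f, u, hf, hxu, hub⟩ := exists_separating (T j).isPolyhedron
      (hT j (Finset.mem_insert_self j s))
    -- The good levels have full measure and are therefore dense, so one lies between `f x₀` and the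
    -- separating value `u`. Restriction to `f < r` keeps `x₀` in `S` and removes `T j`.
    obtain ⟨r, hr, hxr, hru⟩ := (Measure.dense_of_ae (ae_flatNorm_restrict h hf)).exists_between hxu
    have hr : flatNorm (restrict f r
      (simple S g + ∑ i ∈ insert j s, simple (T i) (c i))) = 0 := hr
    have hS : ∃ a ∈ S.carrier, f a < r := ⟨x₀, hx₀, hxr⟩
    -- The remaining polyhedra only shrink, so they still avoid `x₀`; one that disappears is kept
    -- with coefficient zero.
    have hex : ∀ i, ∃ (T' : OrientedPolyhedron X k) (c' : G), T'.carrier ⊆ (T i).carrier ∧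
        (restrict f r (simple (T i) (c i)) : PolyChain X G k) = simple T' c' := by
      intro i
      rw [restrict_simple, simpleRestrict]
      split_ifs with h1
      · exact ⟨_, c i, sep_subset _ _, rfl⟩
      · exact ⟨T i, 0, subset_rfl, by simp⟩
    choose T' c' hT' hc' using hex
    refine ih (S.below f r hS) ⟨hx₀, hxr.le⟩ T' c'
      (fun i hi hx => hT i (Finset.mem_insert_of_mem hi) (hT' i hx)) ?_
    rw [map_add, Finset.sum_insert hj, map_add, map_sum, restrict_simple, simpleRestrict,
      dif_pos hS, restrict_simple, simpleRestrict_eq_zero fun x hx => (hru.trans (hub x hx)).le,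
      AddMonoidHom.zero_apply, zero_add, Finset.sum_congr rfl fun i _ => hc' i] at hr
    exact hr

theorem IsPolyhedron.inter {C D : Set X} (hC : IsPolyhedron k C) (hD : IsPolyhedron k D)
    (hne : (C ∩ D).Nonempty) (hk : k ≤ Module.finrank ℝ (vectorSpan ℝ (C ∩ D))) :
    IsPolyhedron k (C ∩ D) := by
  classical
  have := hC.finiteDimensional
  have hle := vectorSpan_mono ℝ (inter_subset_left : C ∩ D ⊆ C)
  refine ⟨hne, hC.bounded.subset inter_subset_left, Submodule.finiteDimensional_of_le hle,
    le_antisymm (hC.finrank_eq ▸ Submodule.finrank_mono hle) hk, ?_⟩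
  obtain ⟨s, hs⟩ := hC.halfSpaces
  obtain ⟨t, ht⟩ := hD.halfSpaces
  refine ⟨s ∪ t, Subset.antisymm (fun x hx => ⟨subset_affineSpan ℝ _ hx, fun p hp => ?_⟩) ?_⟩
  · rcases Finset.mem_union.1 hp with hp | hp
    · have := hx.1
      rw [hs] at this
      exact this.2 p hp
    · have := hx.2
      rw [ht] at this
      exact this.2 p hp
  · rintro x ⟨hx, hp⟩
    constructor
    · rw [hs]
      exact ⟨affineSpan_mono ℝ inter_subset_left hx, fun p h => hp p (Finset.mem_union_left _ h)⟩
    · rw [ht]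
      exact ⟨affineSpan_mono ℝ inter_subset_right hx, fun p h => hp p (Finset.mem_union_right _ h)⟩

/-- Relative interiors are preserved by affine isometries, which reduces the claim to a nonempty
convex set in a finite-dimensional space. -/
theorem IsPolyhedron.intrinsicInterior_nonempty {C : Set X} (hC : IsPolyhedron k C) :
    (intrinsicInterior ℝ C).Nonempty := by
  have := hC.finiteDimensional
  obtain ⟨x₀, hx₀⟩ := hC.nonempty
  let φ : vectorSpan ℝ C →ᵃⁱ[ℝ] X := (AffineIsometryEquiv.constVAdd ℝ X x₀).toAffineIsometry.comp
    (vectorSpan ℝ C).subtypeₗᵢ.toAffineIsometry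
  have hφ : ∀ v : vectorSpan ℝ C, φ v = x₀ + v := fun _ => rfl
  have himg : φ '' (φ ⁻¹' C) = C := by
    rw [image_preimage_eq_iff]
    intro x hx
    exact ⟨⟨x - x₀, vsub_mem_vectorSpan ℝ hx hx₀⟩, by rw [hφ]; simp⟩
  rw [← himg, AffineIsometry.intrinsicInterior_image]
  refine Set.Nonempty.image _ (Set.Nonempty.intrinsicInterior
    (hC.convex.affine_preimage φ.toAffineMap) ⟨0, ?_⟩)
  simpa [hφ] using hx₀

/-- An intersection of full dimension would be a `k`-polyhedron in the planes of both, and its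
relative interior, which is not empty, would lie in both relative interiors. -/
theorem finrank_vectorSpan_inter_lt {C D : Set X} (hC : IsPolyhedron k C) (hD : IsPolyhedron k D)
    (hne : (C ∩ D).Nonempty)
    (hd : Disjoint (intrinsicInterior ℝ C) (intrinsicInterior ℝ D)) :
    Module.finrank ℝ (vectorSpan ℝ (C ∩ D)) < k := by
  by_contra! hk
  have hI := hC.inter hD hne hk
  obtain ⟨x, hx⟩ := hI.intrinsicInterior_nonempty
  exact disjoint_left.1 hd
    (intrinsicInterior_mono_of_affineSpan_eq inter_subset_left
      (hC.affineSpan_eq hI inter_subset_left) hx)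
    (intrinsicInterior_mono_of_affineSpan_eq inter_subset_right
      (hD.affineSpan_eq hI inter_subset_right) hx)

/-- In a disjoint representation a polyhedron `S` meets each of the others in lower dimension. These
finitely many intersections have null images under a coordinate map for which the image of `S` has
positive volume, so they do not cover `S`. A point of `S` that they miss allows the coefficient of
`S` to be isolated. -/
theorem eq_zero_of_flatNorm_eq_zero {P : PolyChain X G k} (h : flatNorm P = 0) : P = 0 := by
  classical
  obtain ⟨c₀, rfl⟩ := toChain_surjective P
  obtain ⟨c, hdisj, hc, -⟩ := exists_isDisjointSum c₀
  rw [← hc] at h ⊢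
  suffices c = 0 by rw [this, map_zero]
  by_contra hne
  obtain ⟨S, hS⟩ := Finsupp.support_nonempty_iff.2 hne
  have := S.isPolyhedron.finiteDimensional
  obtain ⟨f, -, hinj⟩ := exists_coords_injective S.isPolyhedron.finrank_eq
  have hx₀ : ∃ x₀ ∈ S.carrier, ∀ T ∈ c.support.erase S, x₀ ∉ T.carrier := by
    by_contra! hcon
    refine (S.isPolyhedron.volume_image_coords_pos hinj).ne' (measure_mono_null
      (t := ⋃ T ∈ c.support.erase S, coords f '' (S.carrier ∩ T.carrier)) ?_ ?_)
    · rintro _ ⟨x, hx, rfl⟩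
      obtain ⟨T, hT, hxT⟩ := hcon x hx
      exact mem_iUnion₂.2 ⟨T, hT, x, ⟨hx, hxT⟩, rfl⟩
    · refine (measure_biUnion_null_iff (Finset.countable_toSet _)).2 fun T hT => ?_
      rcases (S.carrier ∩ T.carrier).eq_empty_or_nonempty with hem | hem
      · simp [hem]
      · exact S.isPolyhedron.volume_image_coords_subset inter_subset_left f
          (finrank_vectorSpan_inter_lt S.isPolyhedron T.isPolyhedron hem
            (hdisj hS (Finset.mem_of_mem_erase hT) (Finset.ne_of_mem_erase hT).symm))
  obtain ⟨x₀, hx₀, hT⟩ := hx₀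
  refine Finsupp.mem_support_iff.1 hS
    (eq_zero_of_flatNorm_add_sum (c.support.erase S) S (c S) hx₀ id c hT ?_)
  rw [toChain_eq_sum, ← Finset.add_sum_erase _ _ hS] at h
  exact h

end flatNorm

end FlatChain

end

/-- The flat norm is a norm on the group of polyhedral `k`-chains: it is finite, vanishes at `0`,
is symmetric and subadditive, and vanishes at no other chain. -/
theorem mainTheorem3 {X : Type*} [NormedAddCommGroup X] [NormedSpace ℝ X] [CompleteSpace X]
    {G : Type*} [NormedAddCommGroup G] [CompleteSpace G] (k : ℕ) :
    (∀ P : FlatChain.PolyChain X G k, FlatChain.flatNorm P ≠ ⊤) ∧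
    FlatChain.flatNorm (0 : FlatChain.PolyChain X G k) = 0 ∧
    (∀ P : FlatChain.PolyChain X G k, FlatChain.flatNorm (-P) = FlatChain.flatNorm P) ∧
    (∀ P Q : FlatChain.PolyChain X G k,
      FlatChain.flatNorm (P + Q) ≤ FlatChain.flatNorm P + FlatChain.flatNorm Q) ∧
    (∀ P : FlatChain.PolyChain X G k, FlatChain.flatNorm P = 0 → P = 0) := by
  exact ⟨fun P => ne_top_of_le_ne_top (FlatChain.mass_ne_top P) (FlatChain.flatNorm_le_mass P),
    le_antisymm ((FlatChain.flatNorm_le_mass 0).trans FlatChain.mass_zero.le) zero_le,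
    FlatChain.flatNorm_neg, FlatChain.flatNorm_add_le,
    fun _ => FlatChain.eq_zero_of_flatNorm_eq_zero⟩
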